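/- **Setting.** Let $n\ge 1$, let $\langle\!\langle\cdot,\cdot\rangle\!\rangle$ be the Minkowski inner product of $\mathbb R^{n+2}_1$, $\|x\|^2=\langle\!\langle x,x\rangle\!\rangle$, $\mathcal L$ the light cone of null vectors, and $S^n=\mathbb P(\mathcal L)$; $\langle x\rangle\in S^n$ is the point spanned by $0\ne x\in\mathcal L$. Put $(v\wedge w)(x)=\langle\!\langle v,x\rangle\!\rangle w-\langle\!\langle w,x\rangle\!\rangle v$. For an $\mathfrak o(\mathbb R^{n+2}_1)$-valued 1-form $\Psi$ on $(0,b)$ and $p\in(0,b)$ let $t\mapsto\Gamma_p^{\,t}(\Psi)$ be the solution of $d\Gamma_p(\Psi)=\Gamma_p(\Psi)\Psi$, $\Gamma_p^{\,p}(\Psi)=\mathrm{id}$. Let $\langle c\rangle:(-\epsilon,b)\to S^n$ ($\epsilon,b>0$) be a smooth regular curve with smooth light cone lift $c$. Let $Q=Q(t)\,dt^2$ be a nowhere zero quadratic differential on $(0,b)$ with a pole of second order at $0$: $t^2Q(t)$ has a smooth extension to some $(-\delta,b)$, $\delta>0$, with value $q\neq0$ at $0$. Let $\omega=\frac{Q(t)}{\|c'(t)\|^2}\,c\wedge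 c'\,dt$. For $\lambda\in\mathbb R$ and $p\in(0,b)$ the $\lambda$-Calapso transform normalized at $p$ is $\langle c_{\lambda,p}(t)\rangle=\langle\Gamma_p^{\,t}(\lambda\omega)c(t)\rangle$, $t\in(0,b)$. Put $\mu=q\lambda$ and fix a pseudo-orthonormal basis $o,\iota,\mathfrak t,\mathfrak n_1,\dots,\mathfrak n_{n-1}$ of $\mathbb R^{n+2}_1$: $o,\iota$ are null with $\langle\!\langle o,\iota\rangle\!\rangle=-1$, the other vectors are orthonormal and orthogonal to $o,\iota$. **Theorem.** Suppose $1-2\mu<0$ (that is, $1-2\lambda<0$ if $Q=dt^2/t^2$). (i) There is a regular parameter $s$, smooth with $s'>0$ on some $(-\delta,b)$, $\delta>0$, with $s(0)=0$ and $Q=q\,ds^2/s^2$ on $(0,b)$. For each such $s$, let $f$ be the flat lift, i.e. the positive multiple of $c$ with $\|df/ds\|^2=1$; then there is a smooth frame $F:(0,b)\to O(\mathbb R^{n+2}_1)$ with $Fo=f$, $F\mathfrak t=df/ds$ for which the normal fields $N_i=F\mathfrak n_i$ are parallel, $\langle\!\langle dN_i,N_j\rangle\!\rangle=0$, and satisfy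 $\langle\!\langle dN_i,df\rangle\!\rangle=0$. (ii) For all $s$ and $F$ as in (i), let $g=FR$, where $R(t)o=s(t)^{-1}o$, $R(t)\iota=s(t)\iota$ and $R(t)=\mathrm{id}$ on $\langle o,\iota\rangle^\perp$, and let $$\xi=-\frac{ds}{s}\,(o-\mathfrak t)\wedge(\iota-\mu\mathfrak t),\qquad \Phi=\Gamma_p(\xi)\,\big(g^{-1}\lambda\omega g+g^{-1}dg\big)\,\Gamma_p(\xi)^{-1}-\xi .$$ Then $\Gamma_p^{\,0}(\Phi):=\lim_{t\to0}\Gamma_p^{\,t}(\Phi)$ exists in $O(\mathbb R^{n+2}_1)$. Let $A=g(p)\,\Gamma_p^{\,0}(\Phi)$, $C(t)=A\,\Gamma_p^{\,t}(\xi)\,o$, and let $\mathcal C\subset S^n$ be the circle of the points $\langle x\rangle$ with $0\neq x\in A\langle o,\iota,\mathfrak t\rangle\cap\mathcal L$. - As $t\to0$, $\langle c_{\lambda,p}(t)\rangle$ tends towards $\langle C(t)\rangle$: their distance with respect to any metric representing the conformal structure of $S^n$ tends to $0$. - $\langle C\rangle$ is a motion on the circle $\mathcal C$ which covers all of $\mathcal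 C$ on every interval $(0,\delta)$, $0<\delta\le b$, and its speed, with respect to any metric representing the conformal structure, tends to infinity as $t\to0$. - In particular $\langle c_{\lambda,p}(t)\rangle$ has no limit as $t\to0$, but it has the limit circle $\mathcal C$: the set of its accumulation points as $t\to0$ is exactly $\mathcal C$. -/

import Mathlib

open Set Filter Topology
open scoped ContDiff ENNReal

noncomputable section

namespace Calapso

/-! ### Minkowski space and the conformal sphere -/

/-- The vector space underlying Minkowski space `ℝ^{n+2}_1`; its Euclidean norm is only used for the
topology and for derivatives. -/
abbrev Mink (n : ℕ) : Type := EuclideanSpace ℝ (Fin (n + 2))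

/-- Endomorphisms of Minkowski space. -/
abbrev EndM (n : ℕ) : Type := Mink n →L[ℝ] Mink n

/-- The Minkowski inner product, of signature `(-,+,…,+)`. -/
def mink {n : ℕ} (x y : Mink n) : ℝ :=
  -(x 0 * y 0) + ∑ i : Fin (n + 1), x i.succ * y i.succ

theorem mink_comm {n : ℕ} (x y : Mink n) : mink x y = mink y x := by
  simp [mink, mul_comm]

theorem mink_add_right {n : ℕ} (v x y : Mink n) : mink v (x + y) = mink v x + mink v y := by
  simp only [mink, PiLp.add_apply, mul_add, Finset.sum_add_distrib]
  ring

theorem mink_smul_right {n : ℕ} (v : Mink n) (r : ℝ) (x : Mink n) :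
    mink v (r • x) = r * mink v x := by
  simp only [mink, PiLp.smul_apply, smul_eq_mul, mul_add, Finset.mul_sum]
  congr 1
  · ring
  · exact Finset.sum_congr rfl fun i _ => by ring

/-- Orthogonal transformations of Minkowski space. -/
def IsLorentz {n : ℕ} (A : EndM n) : Prop := ∀ x y, mink (A x) (A y) = mink x y

/-- The element `v ∧ w : x ↦ ⟨v, x⟩ w - ⟨w, x⟩ v` of the Lie algebra `𝔬(ℝ^{n+2}_1)`. -/
def wedge {n : ℕ} (v w : Mink n) : EndM n :=
  LinearMap.toContinuousLinearMap
    { toFun := fun x => mink v x • w - mink w x • v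
      map_add' := fun x y => by
        simp only [mink_add_right, add_smul]
        abel
      map_smul' := fun r x => by
        simp only [mink_smul_right, mul_smul, smul_sub, RingHom.id_apply] }

/-- The Euclidean space containing the round sphere `S^n`. -/
abbrev Amb (n : ℕ) : Type := EuclideanSpace ℝ (Fin (n + 1))

/-- The identification of the projectivized light cone with the unit sphere `S^n ⊆ ℝ^{n+1}`: the
point `⟨x⟩`, for a nonzero null vector `x = (x₀, x₁, …, x_{n+1})`, is
`(x₁ / x₀, …, x_{n+1} / x₀)`. -/
def pt {n : ℕ} (x : Mink n) : Amb n := WithLp.toLp 2 fun i => x i.succ / x 0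

theorem mink_zero_ne {n : ℕ} {x : Mink n} (hx : x ≠ 0) (h : mink x x = 0) : x 0 ≠ 0 := by
  intro h0
  apply hx
  have h1 : ∑ i : Fin (n + 1), x i.succ * x i.succ = 0 := by simpa [mink, h0] using h
  rw [Finset.sum_eq_zero_iff_of_nonneg fun i _ => mul_self_nonneg _] at h1
  ext i
  refine Fin.cases ?_ (fun j => ?_) i
  · simpa using h0
  · simpa using h1 j (Finset.mem_univ j)

/-- `pt` maps the light cone to the unit sphere. -/
theorem norm_pt {n : ℕ} {x : Mink n} (hx : x ≠ 0) (h : mink x x = 0) : ‖pt x‖ = 1 := by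
  have h0 := mink_zero_ne hx h
  have h1 : ∑ i : Fin (n + 1), x i.succ * x i.succ = x 0 * x 0 := by
    unfold mink at h
    linarith
  rw [EuclideanSpace.norm_eq, Real.sqrt_eq_one]
  have : ∀ i : Fin (n + 1), ‖pt x i‖ ^ 2 = (x i.succ * x i.succ) / (x 0 * x 0) := fun i => by
    simp only [pt, Real.norm_eq_abs, sq_abs]
    field_simp
  rw [Finset.sum_congr rfl fun i _ => this i, ← Finset.sum_div, h1]
  field_simp

/-- Two light cone vectors give the same point of the sphere iff they span the same line. -/
theorem pt_eq_pt_iff {n : ℕ} {x y : Mink n} (hx : x ≠ 0) (hxx : mink x x = 0)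
    (hy : y ≠ 0) (hyy : mink y y = 0) : pt x = pt y ↔ ∃ r : ℝ, r ≠ 0 ∧ y = r • x := by
  have h0 := mink_zero_ne hx hxx
  have h1 := mink_zero_ne hy hyy
  constructor
  · intro h
    refine ⟨y 0 / x 0, div_ne_zero h1 h0, ?_⟩
    ext i
    refine Fin.cases ?_ (fun j => ?_) i
    · simp only [PiLp.smul_apply, smul_eq_mul]
      field_simp
    · have h2 : x j.succ / x 0 = y j.succ / y 0 := congrArg (fun z : Amb n => z j) h
      simp only [PiLp.smul_apply, smul_eq_mul]
      field_simp at h2 ⊢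
      linarith
  · rintro ⟨r, hr, rfl⟩
    ext i
    simp only [pt, PiLp.smul_apply, smul_eq_mul]
    rw [mul_div_mul_left _ _ hr]

/-- The set of points of `S^n` represented by null vectors of the subspace `V`; it is a circle if
`V` is three-dimensional of signature `(-,+,+)`. -/
def sphereOf {n : ℕ} (V : Submodule ℝ (Mink n)) : Set (Amb n) :=
  {P | ∃ x ∈ V, x ≠ 0 ∧ mink x x = 0 ∧ P = pt x}

/-- `φ` is the factor of a representative metric `φ² g_round` of the conformal structure of
`S^n`. -/
def IsConformalFactor {n : ℕ} (φ : Amb n → ℝ) : Prop :=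
  ContinuousOn φ (Metric.sphere 0 1) ∧ ∀ P ∈ Metric.sphere (0 : Amb n) 1, 0 < φ P

/-- The distance of two points of `S^n` with respect to the metric `φ² g_round`: the infimum of the
lengths of the `C¹` curves in the sphere which join them. -/
def conformalDist {n : ℕ} (φ : Amb n → ℝ) (P P' : Amb n) : ℝ≥0∞ :=
  ⨅ (γ : ℝ → Amb n) (_ : ContDiffOn ℝ 1 γ (Icc 0 1) ∧ (∀ u ∈ Icc (0 : ℝ) 1, ‖γ u‖ = 1) ∧
    γ 0 = P ∧ γ 1 = P'),
    ∫⁻ u in Icc (0 : ℝ) 1, ENNReal.ofReal (φ (γ u) * ‖derivWithin γ (Icc 0 1) u‖)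

/-! ### Primitives and gauge transformations

A one-form `Ψ(t) dt` on `(0, b)` is given by its coefficient function `Ψ`. -/

/-- `G` is the primitive of `Ψ(t) dt` on `(0, b)` normalized at `p`: `dG = G Ψ` and `G(p) = id`. -/
def IsPrimitive {n : ℕ} (b : ℝ) (Ψ : ℝ → EndM n) (p : ℝ) (G : ℝ → EndM n) : Prop :=
  G p = 1 ∧ ∀ t ∈ Ioo 0 b, HasDerivAt G (G t * Ψ t) t

/-- `Gam b Ψ p t` is `Γ_p^t(Ψ)`. Only its values for `p, t ∈ (0, b)` are meaningful. -/
def Gam {n : ℕ} (b : ℝ) (Ψ : ℝ → EndM n) (p : ℝ) : ℝ → EndM n :=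
  Classical.epsilon (IsPrimitive b Ψ p)

/-- The terms of the Peano-Baker series, by which primitives are shown to exist. -/
def peano {n : ℕ} (Ψ : ℝ → EndM n) (p : ℝ) : ℕ → ℝ → EndM n
  | 0 => fun _ => 1
  | k + 1 => fun t => ∫ τ in p..t, peano Ψ p k τ * Ψ τ

theorem hasDerivAt_integral_Ioo {n : ℕ} {b p : ℝ} {f : ℝ → EndM n}
    (hf : ContinuousOn f (Ioo 0 b)) (hp : p ∈ Ioo 0 b) {t : ℝ} (ht : t ∈ Ioo 0 b) :
    HasDerivAt (fun u => ∫ τ in p..u, f τ) (f t) t := by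
  have hsub : uIcc p t ⊆ Ioo 0 b := (ordConnected_Ioo).uIcc_subset hp ht
  exact intervalIntegral.integral_hasDerivAt_right ((hf.mono hsub).intervalIntegrable)
    (hf.stronglyMeasurableAtFilter isOpen_Ioo t ht) (hf.continuousAt (isOpen_Ioo.mem_nhds ht))

theorem hasDerivAt_peano {n : ℕ} {b p : ℝ} {Ψ : ℝ → EndM n} (hΨ : ContinuousOn Ψ (Ioo 0 b))
    (hp : p ∈ Ioo 0 b) (k : ℕ) : ∀ t ∈ Ioo 0 b,
      HasDerivAt (peano Ψ p (k + 1)) (peano Ψ p k t * Ψ t) t := by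
  induction k with
  | zero =>
    intro t ht
    exact hasDerivAt_integral_Ioo (continuousOn_const.mul hΨ) hp ht
  | succ k ih =>
    intro t ht
    exact hasDerivAt_integral_Ioo
      (ContinuousOn.mul (fun u hu => (ih u hu).continuousAt.continuousWithinAt) hΨ) hp ht

theorem norm_peano_le {n : ℕ} {p : ℝ} {Ψ : ℝ → EndM n} {K : Set ℝ} [K.OrdConnected] (hp : p ∈ K)
    {M : ℝ} (hM : ∀ t ∈ K, ‖Ψ t‖ ≤ M) (k : ℕ) : ∀ t ∈ K,
      ‖peano Ψ p k t‖ ≤ M ^ k * |t - p| ^ k / k.factorial := by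
  have hM0 : 0 ≤ M := (norm_nonneg _).trans (hM p hp)
  induction k with
  | zero =>
    intro t _
    simp [peano]
  | succ k ih =>
    intro t ht
    have key : ∀ τ ∈ uIoc p t, ‖peano Ψ p k τ * Ψ τ‖ ≤
        M ^ (k + 1) / k.factorial * |τ - p| ^ k := by
      intro τ hτ
      have hτ' : τ ∈ K := ‹K.OrdConnected›.uIcc_subset hp ht (uIoc_subset_uIcc hτ)
      calc ‖peano Ψ p k τ * Ψ τ‖ ≤ ‖peano Ψ p k τ‖ * ‖Ψ τ‖ := norm_mul_le _ _
        _ ≤ (M ^ k * |τ - p| ^ k / k.factorial) * M :=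
          mul_le_mul (ih τ hτ') (hM τ hτ') (norm_nonneg _) (by positivity)
        _ = _ := by ring
    have h1 : ‖peano Ψ p (k + 1) t‖ ≤
        |∫ τ in p..t, M ^ (k + 1) / k.factorial * |τ - p| ^ k| := by
      refine intervalIntegral.norm_integral_le_abs_of_norm_le ?_ ?_
      · exact MeasureTheory.ae_restrict_of_forall_mem measurableSet_uIoc key
      · exact (Continuous.intervalIntegrable (by fun_prop) _ _)
    refine h1.trans (le_of_eq ?_)
    rw [intervalIntegral.integral_const_mul, abs_mul, abs_of_nonneg (by positivity)]
    have h2 : |∫ τ in p..t, |τ - p| ^ k| = |t - p| ^ (k + 1) / (k + 1) := by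
      have := integral_pow_abs_sub_uIoc (a := p) (b := t) k
      rw [← this, intervalIntegral.abs_integral_eq_abs_integral_uIoc, abs_of_nonneg]
      exact MeasureTheory.integral_nonneg fun τ => by positivity
    rw [h2, Nat.factorial_succ]
    push_cast
    field_simp

theorem exists_isPrimitive {n : ℕ} {b p : ℝ} {Ψ : ℝ → EndM n} (hΨ : ContinuousOn Ψ (Ioo 0 b))
    (hp : p ∈ Ioo 0 b) : ∃ G, IsPrimitive b Ψ p G := by
  refine ⟨fun t => ∑' k, peano Ψ p k t, ?_, fun t ht => ?_⟩
  · have : ∀ k, k ≠ 0 → peano Ψ p k p = 0 := by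
      intro k hk
      obtain ⟨j, rfl⟩ := Nat.exists_eq_succ_of_ne_zero hk
      simp [peano]
    simp only []
    rw [tsum_eq_single 0 this]
    rfl
  · obtain ⟨α, hα0, hα⟩ := exists_between (lt_min hp.1 ht.1)
    obtain ⟨β, hβ, hβb⟩ := exists_between (max_lt hp.2 ht.2)
    have hK : Icc α β ⊆ Ioo 0 b := fun x hx => ⟨hα0.trans_le hx.1, hx.2.trans_lt hβb⟩
    have hpI : p ∈ Ioo α β := ⟨hα.trans_le (min_le_left _ _), (le_max_left _ _).trans_lt hβ⟩
    have htI : t ∈ Ioo α β := ⟨hα.trans_le (min_le_right _ _), (le_max_right _ _).trans_lt hβ⟩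
    obtain ⟨M, hM⟩ := isCompact_Icc.exists_bound_of_continuousOn (hΨ.mono hK)
    have hM0 : 0 ≤ M := (norm_nonneg _).trans (hM p (Ioo_subset_Icc_self hpI))
    have hb : ∀ k, ∀ u ∈ Ioo α β, ‖peano Ψ p k u‖ ≤ (M * (β - α)) ^ k / k.factorial := by
      intro k u hu
      refine (norm_peano_le (Ioo_subset_Icc_self hpI) hM k u (Ioo_subset_Icc_self hu)).trans ?_
      rw [mul_pow]
      gcongr
      rw [abs_le]
      constructor <;> linarith [hu.1, hu.2, hpI.1, hpI.2]
    have hs : Summable fun k : ℕ => (M * (β - α)) ^ k / k.factorial :=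
      Real.summable_pow_div_factorial _
    have hsum : ∀ u ∈ Ioo α β, Summable fun k => peano Ψ p k u := fun u hu =>
      Summable.of_norm_bounded hs fun k => hb k u hu
    have hg : ∀ (k : ℕ) (u : ℝ), u ∈ Ioo α β →
        HasDerivAt (peano Ψ p (k + 1)) (peano Ψ p k u * Ψ u) u := fun k u hu =>
      hasDerivAt_peano hΨ hp k u (hK (Ioo_subset_Icc_self hu))
    have hg' : ∀ (k : ℕ) (u : ℝ), u ∈ Ioo α β →
        ‖peano Ψ p k u * Ψ u‖ ≤ (M * (β - α)) ^ k / k.factorial * M := fun k u hu =>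
      (norm_mul_le _ _).trans (mul_le_mul (hb k u hu)
        (hM u (Ioo_subset_Icc_self hu)) (norm_nonneg _) ((norm_nonneg _).trans (hb k u hu)))
    have h0 : Summable fun k => peano Ψ p (k + 1) p :=
      (summable_nat_add_iff (f := fun k => peano Ψ p k p) 1).2 (hsum p hpI)
    have hd : HasDerivAt (fun z => ∑' k, peano Ψ p (k + 1) z) (∑' k, peano Ψ p k t * Ψ t) t :=
      hasDerivAt_tsum_of_isPreconnected (hs.mul_right M) isOpen_Ioo isPreconnected_Ioo hg hg'
        hpI h0 htI
    rw [(hsum t htI).tsum_mul_right] at hd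
    have he : (fun z => ∑' k, peano Ψ p k z) =ᶠ[𝓝 t]
        fun z => 1 + ∑' k, peano Ψ p (k + 1) z := by
      filter_upwards [isOpen_Ioo.mem_nhds htI] with u hu
      exact (hsum u hu).tsum_eq_zero_add
    exact (hd.const_add (1 : EndM n)).congr_of_eventuallyEq he

theorem gam_spec {n : ℕ} {b p : ℝ} {Ψ : ℝ → EndM n} (hΨ : ContinuousOn Ψ (Ioo 0 b))
    (hp : p ∈ Ioo 0 b) : IsPrimitive b Ψ p (Gam b Ψ p) :=
  Classical.epsilon_spec (exists_isPrimitive hΨ hp)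

theorem IsPrimitive.eqOn {n : ℕ} {b p : ℝ} {Ψ : ℝ → EndM n} (hΨ : ContinuousOn Ψ (Ioo 0 b))
    (hp : p ∈ Ioo 0 b) {G H : ℝ → EndM n} (hG : IsPrimitive b Ψ p G) (hH : IsPrimitive b Ψ p H) :
    EqOn G H (Ioo 0 b) := by
  intro t ht
  obtain ⟨α, hα0, hα⟩ := exists_between (lt_min hp.1 ht.1)
  obtain ⟨β, hβ, hβb⟩ := exists_between (max_lt hp.2 ht.2)
  have hK : Icc α β ⊆ Ioo 0 b := fun x hx => ⟨hα0.trans_le hx.1, hx.2.trans_lt hβb⟩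
  have hpI : p ∈ Ioo α β := ⟨hα.trans_le (min_le_left _ _), (le_max_left _ _).trans_lt hβ⟩
  have htI : t ∈ Ioo α β := ⟨hα.trans_le (min_le_right _ _), (le_max_right _ _).trans_lt hβ⟩
  obtain ⟨M, hM⟩ := isCompact_Icc.exists_bound_of_continuousOn (hΨ.mono hK)
  refine ODE_solution_unique_of_mem_Ioo (v := fun u X => X * Ψ u) (s := fun _ => univ)
    (K := M.toNNReal) (fun u hu => LipschitzOnWith.of_dist_le_mul fun X _ Y _ => ?_) hpI
    (fun u hu => ⟨hG.2 u (hK (Ioo_subset_Icc_self hu)), mem_univ _⟩)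
    (fun u hu => ⟨hH.2 u (hK (Ioo_subset_Icc_self hu)), mem_univ _⟩)
    (hG.1.trans hH.1.symm) htI
  rw [dist_eq_norm, dist_eq_norm, ← sub_mul, mul_comm (M.toNNReal : ℝ)]
  refine (norm_mul_le _ _).trans (mul_le_mul_of_nonneg_left ?_ (norm_nonneg _))
  exact (hM u (Ioo_subset_Icc_self hu)).trans (Real.le_coe_toNNReal M)

/-- The gauge transform `g⁻¹ Ψ g + g⁻¹ dg` of `Ψ`. -/
def gauge {n : ℕ} (g Ψ : ℝ → EndM n) : ℝ → EndM n := fun t =>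
  Ring.inverse (g t) * Ψ t * g t + Ring.inverse (g t) * deriv g t

/-- The gauge transform `Γ_p(Ξ) Ψ Γ^p(Ξ) - Ξ` of `Ψ`. -/
def gaugeBy {n : ℕ} (b : ℝ) (Ξ : ℝ → EndM n) (p : ℝ) (Ψ : ℝ → EndM n) : ℝ → EndM n := fun t =>
  Gam b Ξ p t * Ψ t * Gam b Ξ t p - Ξ t

/-! ### Polarized curves and their Calapso transforms -/

/-- `c` is a smooth light cone lift of a regular curve `⟨c⟩` in `S^n` on the open interval `I`. For
a light cone lift, `⟨c⟩` is immersed exactly where `‖c'‖² > 0`. -/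
def IsRegularLift {n : ℕ} (c : ℝ → Mink n) (I : Set ℝ) : Prop :=
  ContDiffOn ℝ ∞ c I ∧
    ∀ t ∈ I, c t ≠ 0 ∧ mink (c t) (c t) = 0 ∧ 0 < mink (deriv c t) (deriv c t)

/-- The quadratic differential `Q(t) dt²` on `(0, b)` has a pole of order `k` at `0`, and `q` is the
nonzero value at `0` of the smooth extension of `Q(t) (0 - t)^k`. -/
def HasPole (k : ℕ) (b : ℝ) (Q : ℝ → ℝ) (q : ℝ) : Prop :=
  q ≠ 0 ∧ ∃ δ > 0, ∃ h : ℝ → ℝ, ContDiffOn ℝ ∞ h (Ioo (-δ) b) ∧ h 0 = q ∧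
    ∀ t ∈ Ioo 0 b, h t = Q t * (0 - t) ^ k

/-- The (orthogonal lift of the) one-form `ω = 𝔔 c ∧ dc` associated to the polarized curve
`(⟨c⟩, Q)`, where `Q = 𝔔 ‖dc‖²`. -/
def assocForm {n : ℕ} (c : ℝ → Mink n) (Q : ℝ → ℝ) : ℝ → EndM n := fun t =>
  (Q t / mink (deriv c t) (deriv c t)) • wedge (c t) (deriv c t)

/-- The lift `Γ_p(λω) c` of the `λ`-Calapso transform of `(⟨c⟩, Q)` normalized at `p`. -/
def calapso {n : ℕ} (b : ℝ) (c : ℝ → Mink n) (Q : ℝ → ℝ) (lam p t : ℝ) : Mink n :=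
  Gam b (lam • assocForm c Q) p t (c t)

/-! ### The singular frame -/

/-- A pseudo-orthonormal basis `{o, ι, 𝔱, 𝔫₁, …, 𝔫_{n-1}}` of Minkowski space. -/
structure PseudoBasis (n : ℕ) where
  o : Mink n
  ι : Mink n
  τ : Mink n
  ν : Fin (n - 1) → Mink n
  o_o : mink o o = 0
  ι_ι : mink ι ι = 0
  o_ι : mink o ι = -1
  τ_τ : mink τ τ = 1
  o_τ : mink o τ = 0
  ι_τ : mink ι τ = 0
  o_ν : ∀ i, mink o (ν i) = 0
  ι_ν : ∀ i, mink ι (ν i) = 0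
  τ_ν : ∀ i, mink τ (ν i) = 0
  ν_ν : ∀ i j, mink (ν i) (ν j) = if i = j then 1 else 0

/-- `s` is a regular parameter near `[0, b)` with `s(0) = 0` in which the quadratic differential `Q`
takes the form `q ds² / s²`. -/
def IsNormalParam (b : ℝ) (Q : ℝ → ℝ) (q : ℝ) (s : ℝ → ℝ) : Prop :=
  (∃ δ > 0, ContDiffOn ℝ ∞ s (Ioo (-δ) b) ∧ ∀ t ∈ Ioo (-δ) b, 0 < deriv s t) ∧ s 0 = 0 ∧
    ∀ t ∈ Ioo 0 b, Q t = q * (deriv s t) ^ 2 / (s t) ^ 2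

/-- The flat lift of `⟨c⟩` with respect to the parameter `s`, that is, the positive multiple of `c`
whose derivative with respect to `s` has unit length. -/
def flatLift {n : ℕ} (c : ℝ → Mink n) (s : ℝ → ℝ) (t : ℝ) : Mink n :=
  (deriv s t / √(mink (deriv c t) (deriv c t))) • c t

/-- `F` is a smooth orthogonal frame which maps `o`, `𝔱` to the flat lift `f` and its derivative
`df/ds`, and the `𝔫ᵢ` to orthonormal normal fields `Nᵢ` which are parallel and satisfy
`⟨dNᵢ, df⟩ = 0`. Being orthogonal, `F` maps `ι` to the null vector `f̄` with `⟨f, f̄⟩ = -1` which is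
orthogonal to `df` and all `Nᵢ`. -/
def IsCurveFrame {n : ℕ} (b : ℝ) (c : ℝ → Mink n) (s : ℝ → ℝ) (e : PseudoBasis n)
    (F : ℝ → EndM n) : Prop :=
  ContDiffOn ℝ ∞ F (Ioo 0 b) ∧ ∀ t ∈ Ioo 0 b,
    IsLorentz (F t) ∧
    F t e.o = flatLift c s t ∧
    F t e.τ = (deriv s t)⁻¹ • deriv (flatLift c s) t ∧
    (∀ i, mink (deriv (fun u => F u (e.ν i)) t) (deriv (flatLift c s) t) = 0) ∧
    ∀ i j, mink (deriv (fun u => F u (e.ν i)) t) (F t (e.ν j)) = 0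

/-- The orthogonal transformation `o ↦ r⁻¹ o`, `ι ↦ r ι` which is the identity on `⟨o, ι⟩^⊥`. -/
def boost {n : ℕ} (e : PseudoBasis n) (r : ℝ) : EndM n :=
  LinearMap.toContinuousLinearMap
    { toFun := fun x => x + ((1 - r⁻¹) * mink e.ι x) • e.o + ((1 - r) * mink e.o x) • e.ι
      map_add' := fun x y => by
        simp only [mink_add_right, mul_add, add_smul]
        abel
      map_smul' := fun a x => by
        simp only [mink_smul_right, smul_add, smul_smul, RingHom.id_apply]
        ring_nf }

theorem boost_o {n : ℕ} (e : PseudoBasis n) (r : ℝ) : boost e r e.o = r⁻¹ • e.o := by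
  simp only [boost, LinearMap.coe_toContinuousLinearMap', LinearMap.coe_mk, AddHom.coe_mk, e.o_o,
    mink_comm e.ι e.o, e.o_ι]
  module

theorem boost_ι {n : ℕ} (e : PseudoBasis n) (r : ℝ) : boost e r e.ι = r • e.ι := by
  simp only [boost, LinearMap.coe_toContinuousLinearMap', LinearMap.coe_mk, AddHom.coe_mk, e.ι_ι,
    e.o_ι]
  module

theorem boost_of_orthogonal {n : ℕ} (e : PseudoBasis n) (r : ℝ) {x : Mink n}
    (ho : mink e.o x = 0) (hι : mink e.ι x = 0) : boost e r x = x := by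
  simp [boost, ho, hι]

/-- The singular frame `g = F R`, where `R(t)` scales `o` by `1 / s(t)` and `ι` by `s(t)`. -/
def singFrame {n : ℕ} (s : ℝ → ℝ) (e : PseudoBasis n) (F : ℝ → EndM n) : ℝ → EndM n := fun t =>
  F t * boost e (s t)

/-- The pure pole form `ξ_μ = -(ds / s) (o - 𝔱) ∧ (ι - μ 𝔱)`. -/
def poleForm {n : ℕ} (s : ℝ → ℝ) (e : PseudoBasis n) (μ : ℝ) : ℝ → EndM n := fun t =>
  -(deriv s t / s t) • wedge (e.o - e.τ) (e.ι - μ • e.τ)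

end Calapso

end

/-! Let f be the flat lift, f_s = df/ds, and f̄ the null vector dual to f. In the parameter s the
form λω is μ (ds/s²) f ∧ f_s, with a double pole. The boost R turns this into a simple pole: with v
= F⁻¹(df̄/dt), the gauge transform of λω by g = FR is ξ - s o ∧ v dt (`singFrame_gauge_identity`).

The pole part is ξ = d(log s) X with the constant generator X = -(o - 𝔱) ∧ (ι - μ𝔱). The plane of X
has Gram determinant 2μ - 1, so X³ = -(2μ - 1) X (`poleGen_cube`). For 1 - 2μ < 0 the primitive
Γ_p(ξ) is therefore a periodic, hence bounded, group of rotations in u = log(s / s(p)), and u → -∞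
as t → 0.

Conjugation by this bounded group gives Φ = -s Γ_p(ξ) (o ∧ v) Γ_p(ξ)⁻¹. The vector v is bounded
although nothing is known of F at 0: it lies in the spacelike space ⟨o, ι⟩^⊥ and has the Minkowski
length of df̄/dt, where f̄ is smooth across 0 (`norm_regularPart_le`). Hence Φ → 0, and its
primitive has a limit at 0 (`IsPrimitive.exists_tendsto`).

Both g(p)⁻¹ Γ_p(λω) g and Γ_p(Φ) Γ_p(ξ) are primitives of the same form (`IsPrimitive.gauge`,
`IsPrimitive.mul_of_commute`), so they agree. Applied to o, this gives ⟨c_{λ,p}⟩ = ⟨g(p) Γ_p(Φ)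
Γ_p(ξ) o⟩. Replacing Γ_p(Φ) by its limit costs an error tending to 0, since the orbit of o is
bounded with time component away from zero (`tendsto_norm_pt_sub`). The orbit of o meets every null
line of ⟨o, ι, 𝔱⟩ (`exists_smul_poleRot_o_eq`), and log s sweeps out infinitely many periods near 0.
This yields the limit circle (`mapClusterPt_eq_of_motion`) and, since s'/s → ∞, the unbounded speed.
-/

namespace Calapso

/-! ### The Minkowski inner product -/

section Minkowski

variable {n : ℕ}

theorem mink_add_left (x y v : Mink n) : mink (x + y) v = mink x v + mink y v := by
  rw [mink_comm, mink_add_right, mink_comm v x, mink_comm v y]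

theorem mink_smul_left (r : ℝ) (x v : Mink n) : mink (r • x) v = r * mink x v := by
  rw [mink_comm, mink_smul_right, mink_comm v x]

theorem mink_neg_right (v x : Mink n) : mink v (-x) = -mink v x := by
  simpa using mink_smul_right v (-1) x

theorem mink_neg_left (v x : Mink n) : mink (-v) x = -mink v x := by
  simpa using mink_smul_left (-1) v x

theorem mink_sub_right (v x y : Mink n) : mink v (x - y) = mink v x - mink v y := by
  rw [sub_eq_add_neg, mink_add_right, mink_neg_right, sub_eq_add_neg]

theorem mink_sub_left (x y v : Mink n) : mink (x - y) v = mink x v - mink y v := by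
  rw [sub_eq_add_neg, mink_add_left, mink_neg_left, sub_eq_add_neg]

theorem mink_zero_right (v : Mink n) : mink v 0 = 0 := by
  simpa using mink_smul_right v 0 0

theorem mink_zero_left (v : Mink n) : mink 0 v = 0 := by
  rw [mink_comm, mink_zero_right]

theorem mink_sum_right {ι : Type*} (S : Finset ι) (v : Mink n) (x : ι → Mink n) :
    mink v (∑ i ∈ S, x i) = ∑ i ∈ S, mink v (x i) := by
  classical
  induction S using Finset.induction_on with
  | empty => simp [mink_zero_right]
  | insert a S ha ih => rw [Finset.sum_insert ha, Finset.sum_insert ha, mink_add_right, ih]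

theorem mink_sum_left {ι : Type*} (S : Finset ι) (v : Mink n) (x : ι → Mink n) :
    mink (∑ i ∈ S, x i) v = ∑ i ∈ S, mink (x i) v := by
  simp only [mink_comm _ v, mink_sum_right]

/-- The Euclidean-orthogonal involution relating the Minkowski and the Euclidean inner product. -/
noncomputable def timeFlip (n : ℕ) : EndM n :=
  LinearMap.toContinuousLinearMap
    { toFun := fun x => x - (2 * x 0) • EuclideanSpace.single 0 1
      map_add' := fun x y => by
        simp only [PiLp.add_apply, mul_add, add_smul]
        abel
      map_smul' := fun r x => by
        simp only [PiLp.smul_apply, smul_eq_mul, RingHom.id_apply, smul_sub, smul_smul]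
        ring_nf }

theorem timeFlip_apply (x : Mink n) :
    timeFlip n x = x - (2 * x 0) • EuclideanSpace.single 0 1 := rfl

theorem timeFlip_apply_zero (x : Mink n) : timeFlip n x 0 = -x 0 := by
  simp [timeFlip_apply]
  ring

theorem timeFlip_apply_succ (x : Mink n) (i : Fin (n + 1)) :
    timeFlip n x i.succ = x i.succ := by
  simp [timeFlip_apply, Fin.succ_ne_zero]

theorem mink_eq_inner (x y : Mink n) : mink x y = inner ℝ (timeFlip n x) y := by
  rw [PiLp.inner_apply, Fin.sum_univ_succ, timeFlip_apply_zero]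
  simp only [timeFlip_apply_succ, mink, RCLike.inner_apply, conj_trivial]
  congr 1
  · ring
  · exact Finset.sum_congr rfl fun i _ => mul_comm _ _

theorem timeFlip_mul_self : timeFlip n * timeFlip n = 1 := by
  ext x i
  refine Fin.cases ?_ (fun j => ?_) i
  · simp [timeFlip_apply_zero]
  · simp [timeFlip_apply_succ]

theorem timeFlip_timeFlip (x : Mink n) : timeFlip n (timeFlip n x) = x :=
  congrArg (fun A : EndM n => A x) timeFlip_mul_self

/-- Pairing x with its image under `timeFlip` gives the squared Euclidean norm of x. -/
theorem mink_nondegenerate {x : Mink n} (h : ∀ y, mink y x = 0) : x = 0 := by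
  have h1 := h (timeFlip n x)
  rw [mink_eq_inner, timeFlip_timeFlip] at h1
  exact inner_self_eq_zero.1 h1

/-- The Minkowski inner product as a continuous bilinear map. -/
noncomputable def minkL (n : ℕ) : Mink n →L[ℝ] Mink n →L[ℝ] ℝ := (innerSL ℝ).comp (timeFlip n)

theorem minkL_apply (x y : Mink n) : minkL n x y = mink x y := (mink_eq_inner x y).symm

theorem continuous_mink : Continuous fun p : Mink n × Mink n => mink p.1 p.2 := by
  simp only [← minkL_apply]
  fun_prop

theorem _root_.HasDerivAt.mink {x y : ℝ → Mink n} {x' y' : Mink n} {t : ℝ}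
    (hx : HasDerivAt x x' t) (hy : HasDerivAt y y' t) :
    HasDerivAt (fun u => Calapso.mink (x u) (y u))
      (Calapso.mink x' (y t) + Calapso.mink (x t) y') t := by
  have h := (minkL n).hasFDerivAt_of_bilinear hx.hasFDerivAt hy.hasFDerivAt
  have h' := h.hasDerivAt
  simp only [minkL_apply] at h'
  refine h'.congr_deriv ?_
  simp [minkL_apply, add_comm]

theorem _root_.ContDiffOn.mink {x y : ℝ → Mink n} {m : WithTop ℕ∞} {I : Set ℝ}
    (hx : ContDiffOn ℝ m x I) (hy : ContDiffOn ℝ m y I) :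
    ContDiffOn ℝ m (fun u => Calapso.mink (x u) (y u)) I := by
  have h := (minkL n).isBoundedBilinearMap.contDiff.comp_contDiffOn (hx.prodMk hy)
  simpa only [Function.comp_def, minkL_apply] using h

theorem _root_.Filter.Tendsto.mink {α : Type*} {l : Filter α} {x y : α → Mink n} {a b : Mink n}
    (hx : Tendsto x l (𝓝 a)) (hy : Tendsto y l (𝓝 b)) :
    Tendsto (fun u => Calapso.mink (x u) (y u)) l (𝓝 (Calapso.mink a b)) :=
  (continuous_mink.tendsto (a, b)).comp (hx.prodMk_nhds hy)

/-! ### Adjoints and orthogonal transformations -/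

/-- The adjoint of an endomorphism with respect to the Minkowski inner product. -/
noncomputable def madj (A : EndM n) : EndM n := timeFlip n * star A * timeFlip n

theorem mink_madj (A : EndM n) (x y : Mink n) : mink (madj A x) y = mink x (A y) := by
  rw [mink_eq_inner, mink_eq_inner]
  simp only [madj, mul_apply_eq_comp, timeFlip_timeFlip]
  exact ContinuousLinearMap.adjoint_inner_left A y _

theorem mink_ext {x y : Mink n} (h : ∀ z, mink z x = mink z y) : x = y := by
  rw [← sub_eq_zero]
  exact mink_nondegenerate fun z => by rw [mink_sub_right, h, sub_self]

theorem madj_eq {A A' : EndM n} (h : ∀ x y, mink (A' x) y = mink x (A y)) : madj A = A' := by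
  ext1 x
  refine mink_ext fun z => ?_
  rw [mink_comm z, mink_madj, mink_comm z, h]

theorem madj_mul (A B : EndM n) : madj (A * B) = madj B * madj A :=
  madj_eq fun x y => by simp [mink_madj]

theorem madj_one : madj (1 : EndM n) = 1 := madj_eq fun x y => by simp

theorem _root_.HasDerivAt.madj {A : ℝ → EndM n} {A' : EndM n} {t : ℝ} (h : HasDerivAt A A' t) :
    HasDerivAt (fun u => Calapso.madj (A u)) (Calapso.madj A') t :=
  ((h.star.const_mul (timeFlip n)).mul_const (timeFlip n))

theorem smul_mul_endM (r : ℝ) (A B : EndM n) : r • A * B = r • (A * B) := rfl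

theorem mul_smul_endM (r : ℝ) (A B : EndM n) : A * r • B = r • (A * B) := by
  ext1 x
  exact map_smul A r (B x)

theorem neg_mul_endM (A B : EndM n) : -A * B = -(A * B) := rfl

theorem mul_neg_endM (A B : EndM n) : A * -B = -(A * B) := by
  ext1 x
  exact map_neg A (B x)

theorem smul_smul_endM (r r' : ℝ) (A : EndM n) : r • r' • A = (r * r') • A := by
  ext1 x
  exact smul_smul r r' (A x)

theorem neg_smul_endM (r : ℝ) (A : EndM n) : -r • A = -(r • A) := by
  ext1 x
  exact neg_smul r (A x)

theorem smul_neg_endM (r : ℝ) (A : EndM n) : r • -A = -(r • A) := by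
  ext1 x
  exact smul_neg r (A x)

/-- `A` belongs to the Lie algebra of the Lorentz group. -/
def IsSkew (A : EndM n) : Prop := ∀ x y, mink (A x) y = -mink x (A y)

theorem IsSkew.madj_eq {A : EndM n} (h : IsSkew A) : madj A = -A :=
  Calapso.madj_eq fun x y => by rw [_root_.neg_apply, mink_neg_left, h, neg_neg]

/-- The algebraic form is the one that can be differentiated: orthogonality of a solution of a
linear equation becomes constancy of a product. -/
theorem isLorentz_iff {A : EndM n} : IsLorentz A ↔ madj A * A = 1 := by
  constructor
  · intro h
    ext1 x
    refine mink_ext fun z => ?_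
    rw [mink_comm, mul_apply_eq_comp, mink_madj, h, mink_comm]
    rfl
  · intro h x y
    rw [← mink_madj, ← mul_apply_eq_comp, h]
    rfl

/-- In finite dimension a one-sided inverse of a linear map is two-sided. -/
theorem mul_eq_one_comm_endM {A B : EndM n} (h : A * B = 1) : B * A = 1 := by
  have h1 : A.toLinearMap * B.toLinearMap = 1 := congrArg ContinuousLinearMap.toLinearMap h
  have h2 : B.toLinearMap * A.toLinearMap = 1 := mul_eq_one_comm.1 h1
  ext1 x
  exact congrArg (fun T : Mink n →ₗ[ℝ] Mink n => T x) h2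

theorem IsLorentz.madj_mul_self {A : EndM n} (h : IsLorentz A) : madj A * A = 1 :=
  isLorentz_iff.1 h

theorem IsLorentz.mul_madj_self {A : EndM n} (h : IsLorentz A) : A * madj A = 1 :=
  mul_eq_one_comm_endM h.madj_mul_self

theorem isLorentz_of_mul_madj {A : EndM n} (h : A * madj A = 1) : IsLorentz A :=
  isLorentz_iff.2 (mul_eq_one_comm_endM h)

theorem madj_madj (A : EndM n) : madj (madj A) = A :=
  madj_eq fun x y => by rw [mink_comm, ← mink_madj, mink_comm]

theorem IsLorentz.madj {A : EndM n} (h : IsLorentz A) : IsLorentz (madj A) :=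
  isLorentz_iff.2 (by rw [madj_madj]; exact h.mul_madj_self)

theorem IsLorentz.mul {A B : EndM n} (hA : IsLorentz A) (hB : IsLorentz B) : IsLorentz (A * B) :=
  fun x y => by rw [mul_apply_eq_comp, mul_apply_eq_comp, hA, hB]

theorem IsLorentz.apply_ne_zero {A : EndM n} (h : IsLorentz A) {x : Mink n} (hx : x ≠ 0) :
    A x ≠ 0 := fun h0 => hx <| by
  have := congrArg (fun B : EndM n => B x) h.madj_mul_self
  simpa [h0] using this.symm

theorem IsLorentz.inverse_eq {A : EndM n} (h : IsLorentz A) : Ring.inverse A = Calapso.madj A :=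
  Ring.inverse_unit (⟨A, Calapso.madj A, h.mul_madj_self, h.madj_mul_self⟩ : (EndM n)ˣ)

theorem wedge_apply (v w x : Mink n) : wedge v w x = mink v x • w - mink w x • v := rfl

theorem isSkew_wedge (v w : Mink n) : IsSkew (wedge v w) := fun x y => by
  simp only [wedge_apply, mink_sub_left, mink_smul_left, mink_comm x]
  ring

theorem IsSkew.smul {A : EndM n} (hA : IsSkew A) (r : ℝ) : IsSkew (r • A) := fun x y => by
  simp only [_root_.smul_apply, mink_smul_left, mink_smul_right, hA x y]
  ring

theorem IsSkew.neg {A : EndM n} (hA : IsSkew A) : IsSkew (-A) := fun x y => by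
  simp only [_root_.neg_apply, mink_neg_left, mink_neg_right, hA x y]

theorem IsSkew.sub {A B : EndM n} (hA : IsSkew A) (hB : IsSkew B) : IsSkew (A - B) := fun x y => by
  simp only [_root_.sub_apply, mink_sub_left, mink_sub_right, hA x y, hB x y]
  ring

/-- Equivariance of the wedge product. All gauge transforms below are computed by moving wedges
through orthogonal maps with this rule. -/
theorem IsLorentz.mul_wedge {A : EndM n} (h : IsLorentz A) (v w : Mink n) :
    A * wedge v w = wedge (A v) (A w) * A := by
  ext1 x
  simp only [mul_apply_eq_comp, wedge_apply, map_sub, map_smul, h v x, h w x]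

theorem IsSkew.conj {B : EndM n} (hB : IsSkew B) (A : EndM n) :
    IsSkew (A * B * Calapso.madj A) := fun x y => by
  have h1 : ∀ z w, mink (A z) w = mink z (Calapso.madj A w) := fun z w => by
    rw [mink_comm, ← mink_madj, mink_comm]
  simp only [mul_apply_eq_comp]
  rw [h1, hB, ← mink_madj A x]

/-- The wedge product as a bilinear map. -/
noncomputable def wedgeL (n : ℕ) : Mink n →L[ℝ] Mink n →L[ℝ] EndM n :=
  LinearMap.toContinuousBilinearMap (LinearMap.mk₂ ℝ wedge
    (fun v v' w => by
      ext1 x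
      simp only [_root_.add_apply, wedge_apply, mink_add_left, smul_add, add_smul]
      abel)
    (fun r v w => by
      ext1 x
      simp only [_root_.smul_apply, wedge_apply, mink_smul_left]
      module)
    (fun v w w' => by
      ext1 x
      simp only [_root_.add_apply, wedge_apply, mink_add_left, smul_add, add_smul]
      abel)
    (fun r v w => by
      ext1 x
      simp only [_root_.smul_apply, wedge_apply, mink_smul_left]
      module))

theorem wedgeL_apply (v w : Mink n) : wedgeL n v w = wedge v w := rfl

theorem wedge_smul_left (r : ℝ) (v w : Mink n) : wedge (r • v) w = r • wedge v w := by
  simp only [← wedgeL_apply, map_smul, _root_.smul_apply]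

theorem wedge_add_right (v w w' : Mink n) : wedge v (w + w') = wedge v w + wedge v w' := by
  simp only [← wedgeL_apply, map_add]

theorem wedge_smul_right (r : ℝ) (v w : Mink n) : wedge v (r • w) = r • wedge v w := by
  simp only [← wedgeL_apply, map_smul]

theorem wedge_self (v : Mink n) : wedge v v = 0 := by
  ext1 x
  simp [wedge_apply]

theorem _root_.ContDiffOn.wedge {x y : ℝ → Mink n} {m : WithTop ℕ∞} {I : Set ℝ}
    (hx : ContDiffOn ℝ m x I) (hy : ContDiffOn ℝ m y I) :
    ContDiffOn ℝ m (fun u => Calapso.wedge (x u) (y u)) I := by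
  have h := (wedgeL n).isBoundedBilinearMap.contDiff.comp_contDiffOn (hx.prodMk hy)
  simpa only [Function.comp_def, wedgeL_apply] using h

end Minkowski

/-! ### Pseudo-orthonormal bases -/

section PseudoBasis

variable {n : ℕ}

/-- The orthogonal complement of a timelike vector is spacelike. -/
theorem mink_self_pos_of_orthogonal {u x : Mink n} (hu : mink u u < 0) (hux : mink u x = 0)
    (hx : x ≠ 0) : 0 < mink x x := by
  by_contra! hle
  have hcs := Finset.sum_mul_sq_le_sq_mul_sq Finset.univ (fun i : Fin (n + 1) => u i.succ)
    (fun i => x i.succ)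
  simp only [mink, ← sq] at hu hux hle
  set U := ∑ i : Fin (n + 1), u i.succ ^ 2
  set V := ∑ i : Fin (n + 1), x i.succ ^ 2 with hV
  have hU : 0 ≤ U := Finset.sum_nonneg fun i _ => sq_nonneg _
  have hV0 : 0 ≤ V := Finset.sum_nonneg fun i _ => sq_nonneg _
  have h1 : ∑ i : Fin (n + 1), u i.succ * x i.succ = u 0 * x 0 := by linarith
  rw [h1] at hcs
  -- For x₀ ≠ 0, Cauchy-Schwarz would give u₀²x₀² ≤ UV ≤ U x₀² < u₀²x₀², since U < u₀² and V ≤ x₀².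
  have hx0 : x 0 = 0 := by
    by_contra hne
    have : 0 < x 0 ^ 2 := by positivity
    nlinarith
  have hVz : V = 0 := by
    rw [hx0] at hle
    linarith [hle]
  apply hx
  rw [hV, Finset.sum_eq_zero_iff_of_nonneg fun i _ => sq_nonneg _] at hVz
  ext i
  refine Fin.cases ?_ (fun j => ?_) i
  · simpa using hx0
  · simpa using hVz j (Finset.mem_univ j)

namespace PseudoBasis

variable (e : PseudoBasis n)

/-- The vector with the given coefficients with respect to a pseudo-orthonormal basis. -/
noncomputable def comb (a b d : ℝ) (k : Fin (n - 1) → ℝ) : Mink n :=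
  a • e.o + b • e.ι + d • e.τ + ∑ i, k i • e.ν i

theorem mink_o_comb (a b d : ℝ) (k : Fin (n - 1) → ℝ) : mink e.o (e.comb a b d k) = -b := by
  simp [comb, mink_add_right, mink_smul_right, mink_sum_right, e.o_o, e.o_ι, e.o_τ, e.o_ν]

theorem mink_ι_comb (a b d : ℝ) (k : Fin (n - 1) → ℝ) : mink e.ι (e.comb a b d k) = -a := by
  simp [comb, mink_add_right, mink_smul_right, mink_sum_right, e.ι_ι, mink_comm e.ι e.o, e.o_ι,
    e.ι_τ, e.ι_ν]

theorem mink_τ_comb (a b d : ℝ) (k : Fin (n - 1) → ℝ) : mink e.τ (e.comb a b d k) = d := by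
  simp [comb, mink_add_right, mink_smul_right, mink_sum_right, mink_comm e.τ e.o,
    mink_comm e.τ e.ι, e.o_τ, e.ι_τ, e.τ_τ, e.τ_ν]

theorem mink_ν_comb (j : Fin (n - 1)) (a b d : ℝ) (k : Fin (n - 1) → ℝ) :
    mink (e.ν j) (e.comb a b d k) = k j := by
  simp [comb, mink_add_right, mink_smul_right, mink_sum_right, mink_comm (e.ν j) e.o,
    mink_comm (e.ν j) e.ι, mink_comm (e.ν j) e.τ, e.o_ν, e.ι_ν, e.τ_ν, e.ν_ν]

/-- The coordinates of a vector, up to sign. -/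
noncomputable def pairing : Mink n →ₗ[ℝ] ℝ × ℝ × ℝ × (Fin (n - 1) → ℝ) where
  toFun x := (mink e.o x, mink e.ι x, mink e.τ x, fun i => mink (e.ν i) x)
  map_add' x y := by ext <;> simp [mink_add_right]
  map_smul' r x := by ext <;> simp [mink_smul_right]

/-- A dimension count reduces this to surjectivity, where `comb` supplies preimages. The count n + 2
= 3 + (n - 1) needs 1 ≤ n because the subtraction is truncated. -/
theorem pairing_injective (hn : 1 ≤ n) : Function.Injective e.pairing := by
  have hd : Module.finrank ℝ (Mink n) = Module.finrank ℝ (ℝ × ℝ × ℝ × (Fin (n - 1) → ℝ)) := by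
    simp
    omega
  rw [LinearMap.injective_iff_surjective_of_finrank_eq_finrank hd]
  rintro ⟨a, b, d, k⟩
  refine ⟨e.comb (-b) (-a) d k, ?_⟩
  simp [pairing, mink_o_comb, mink_ι_comb, mink_τ_comb, mink_ν_comb]

theorem ext_mink (hn : 1 ≤ n) {x y : Mink n} (ho : mink e.o x = mink e.o y)
    (hι : mink e.ι x = mink e.ι y) (hτ : mink e.τ x = mink e.τ y)
    (hν : ∀ i, mink (e.ν i) x = mink (e.ν i) y) : x = y :=
  e.pairing_injective hn (by simp [pairing, ho, hι, hτ, hν])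

theorem eq_comb (hn : 1 ≤ n) (x : Mink n) :
    x = e.comb (-mink e.ι x) (-mink e.o x) (mink e.τ x) fun i => mink (e.ν i) x := by
  apply e.ext_mink hn <;> simp [mink_o_comb, mink_ι_comb, mink_τ_comb, mink_ν_comb]

theorem ext_endM (hn : 1 ≤ n) {A B : EndM n} (ho : A e.o = B e.o) (hι : A e.ι = B e.ι)
    (hτ : A e.τ = B e.τ) (hν : ∀ i, A (e.ν i) = B (e.ν i)) : A = B := by
  ext1 x
  rw [e.eq_comb hn x]
  simp [comb, ho, hι, hτ, hν]

theorem mink_comb_comb (a b d a' b' d' : ℝ) (k k' : Fin (n - 1) → ℝ) :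
    mink (e.comb a b d k) (e.comb a' b' d' k') = -(a * b') - b * a' + d * d' + ∑ i, k i * k' i := by
  conv_lhs => rw [comb]
  simp only [mink_add_left, mink_smul_left, mink_sum_left, mink_o_comb, mink_ι_comb, mink_τ_comb,
    mink_ν_comb]
  ring

theorem mink_eq_sum (hn : 1 ≤ n) (x y : Mink n) :
    mink x y = -(mink e.ι x * mink e.o y) - mink e.o x * mink e.ι y + mink e.τ x * mink e.τ y +
      ∑ i, mink (e.ν i) x * mink (e.ν i) y := by
  conv_lhs => rw [e.eq_comb hn x, e.eq_comb hn y]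
  rw [mink_comb_comb]
  ring

/-- The transformation which maps one pseudo-orthonormal basis to another. -/
noncomputable def toFrame (e' : PseudoBasis n) : EndM n :=
  LinearMap.toContinuousLinearMap
    { toFun := fun x =>
        e'.comb (-mink e.ι x) (-mink e.o x) (mink e.τ x) fun i => mink (e.ν i) x
      map_add' := fun x y => by
        simp only [comb, mink_add_right, add_smul, Finset.sum_add_distrib]
        module
      map_smul' := fun r x => by
        simp only [comb, mink_smul_right, RingHom.id_apply, smul_add, Finset.smul_sum, mul_smul]
        module }

theorem toFrame_apply (e' : PseudoBasis n) (x : Mink n) : e.toFrame e' x =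
    e'.comb (-mink e.ι x) (-mink e.o x) (mink e.τ x) fun i => mink (e.ν i) x := rfl

theorem isLorentz_toFrame (hn : 1 ≤ n) (e' : PseudoBasis n) : IsLorentz (e.toFrame e') :=
  fun x y => by
    rw [toFrame_apply, toFrame_apply, mink_comb_comb, e.mink_eq_sum hn x y]
    ring

theorem toFrame_o (e' : PseudoBasis n) : e.toFrame e' e.o = e'.o := by
  simp [toFrame_apply, comb, e.o_o, mink_comm e.ι e.o, e.o_ι, mink_comm e.τ e.o, e.o_τ,
    mink_comm (e.ν _) e.o, e.o_ν]

theorem toFrame_ι (e' : PseudoBasis n) : e.toFrame e' e.ι = e'.ι := by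
  simp [toFrame_apply, comb, e.ι_ι, e.o_ι, mink_comm e.τ e.ι, e.ι_τ,
    mink_comm (e.ν _) e.ι, e.ι_ν]

theorem toFrame_τ (e' : PseudoBasis n) : e.toFrame e' e.τ = e'.τ := by
  simp [toFrame_apply, comb, e.ι_τ, e.o_τ, e.τ_τ, mink_comm (e.ν _) e.τ, e.τ_ν]

theorem o_ne_zero : e.o ≠ 0 := fun h => by
  have := e.o_ι
  rw [h, mink_zero_left] at this
  norm_num at this

theorem ι_ne_zero : e.ι ≠ 0 := fun h => by
  have := e.o_ι
  rw [h, mink_zero_right] at this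
  norm_num at this

/-- On the orthogonal complement of `o` and `ι`, the Euclidean norm is bounded by the Minkowski
norm. -/
theorem norm_le_of_orthogonal (hn : 1 ≤ n) {x : Mink n} (ho : mink e.o x = 0)
    (hι : mink e.ι x = 0) : ‖x‖ ≤ √(mink x x) * (‖e.τ‖ + ∑ i, ‖e.ν i‖) := by
  have hxx : mink x x = mink e.τ x ^ 2 + ∑ i, mink (e.ν i) x ^ 2 := by
    rw [e.mink_eq_sum hn x x, ho, hι]
    simp [sq]
  have hs : 0 ≤ ∑ i, mink (e.ν i) x ^ 2 := Finset.sum_nonneg fun i _ => sq_nonneg _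
  have hτ : |mink e.τ x| ≤ √(mink x x) := Real.abs_le_sqrt (by rw [hxx]; linarith)
  have hν : ∀ i, |mink (e.ν i) x| ≤ √(mink x x) := fun i => Real.abs_le_sqrt (by
    rw [hxx]
    have := Finset.single_le_sum (f := fun i => mink (e.ν i) x ^ 2) (fun i _ => sq_nonneg _)
      (Finset.mem_univ i)
    have h2 := sq_nonneg (mink e.τ x)
    linarith)
  have hx : x = mink e.τ x • e.τ + ∑ i, mink (e.ν i) x • e.ν i := by
    conv_lhs => rw [e.eq_comb hn x]
    simp [comb, ho, hι]
  calc ‖x‖ = ‖mink e.τ x • e.τ + ∑ i, mink (e.ν i) x • e.ν i‖ := by rw [← hx]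
    _ ≤ ‖mink e.τ x • e.τ‖ + ∑ i, ‖mink (e.ν i) x • e.ν i‖ :=
      (norm_add_le _ _).trans (add_le_add_right (norm_sum_le _ _) _)
    _ ≤ √(mink x x) * ‖e.τ‖ + ∑ i, √(mink x x) * ‖e.ν i‖ := by
      simp only [norm_smul, Real.norm_eq_abs]
      gcongr with i
      exact hν i
    _ = _ := by rw [mul_add, Finset.mul_sum]

end PseudoBasis

/-- The common complement of o, ι, τ is orthogonal to o + ι, a timelike vector of square -2, so the
form is positive definite on it. An orthogonal basis for the restricted form can then be normalized.
-/
theorem exists_orthonormal_complement (hn : 1 ≤ n) {o ι τ : Mink n} (hoo : mink o o = 0)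
    (hιι : mink ι ι = 0) (hoι : mink o ι = -1) (hττ : mink τ τ = 1) (hoτ : mink o τ = 0)
    (hιτ : mink ι τ = 0) :
    ∃ ν : Fin (n - 1) → Mink n, (∀ i, mink o (ν i) = 0 ∧ mink ι (ν i) = 0 ∧ mink τ (ν i) = 0) ∧
      ∀ i j, mink (ν i) (ν j) = if i = j then 1 else 0 := by
  let P : Mink n →ₗ[ℝ] ℝ × ℝ × ℝ :=
    { toFun := fun x => (mink o x, mink ι x, mink τ x)
      map_add' := fun x y => by ext <;> simp [mink_add_right]
      map_smul' := fun r x => by ext <;> simp [mink_smul_right] }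
  have hP : Function.Surjective P := by
    rintro ⟨a, b, d⟩
    refine ⟨(-b) • o + (-a) • ι + d • τ, ?_⟩
    simp [P, mink_add_right, mink_smul_right, mink_neg_right, hoo, hιι, hoι, hττ, hoτ, hιτ,
      mink_comm ι o, mink_comm τ o, mink_comm τ ι]
  have hrank : Module.finrank ℝ (LinearMap.ker P) = n - 1 := by
    have h := LinearMap.finrank_range_add_finrank_ker P
    rw [LinearMap.range_eq_top.2 hP, finrank_top] at h
    simp at h
    omega
  let β : LinearMap.BilinForm ℝ (LinearMap.ker P) :=
    LinearMap.mk₂ ℝ (fun x y => mink x.1 y.1) (fun x y z => mink_add_left _ _ _)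
      (fun r x y => mink_smul_left _ _ _) (fun x y z => mink_add_right _ _ _)
      (fun r x y => mink_smul_right _ _ _)
  have hβ : LinearMap.IsSymm β := ⟨fun x y => mink_comm _ _⟩
  obtain ⟨v, hv⟩ := LinearMap.BilinForm.exists_orthogonal_basis (B := β) hβ
  have hker : ∀ x : LinearMap.ker P, mink o x = 0 ∧ mink ι x = 0 ∧ mink τ x = 0 := fun x => by
    have h := x.2
    rw [LinearMap.mem_ker] at h
    simpa only [P, LinearMap.coe_mk, AddHom.coe_mk, Prod.mk_eq_zero] using h
  have hpos : ∀ i, 0 < mink (v i : Mink n) (v i) := fun i => by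
    refine mink_self_pos_of_orthogonal (u := o + ι) ?_ ?_ ?_
    · simp only [mink_add_right, mink_add_left, hoo, hιι, hoι, mink_comm ι o]
      norm_num
    · rw [mink_add_left, (hker _).1, (hker _).2.1, add_zero]
    · simpa using v.ne_zero i
  refine ⟨fun i => (√(mink (v (Fin.cast hrank.symm i) : Mink n) (v (Fin.cast hrank.symm i))))⁻¹ •
    (v (Fin.cast hrank.symm i) : Mink n), fun i => ?_, fun i j => ?_⟩
  · simp only [mink_smul_right, hker, mul_zero, and_self]
  · rw [mink_smul_left, mink_smul_right]
    split_ifs with hij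
    · subst hij
      have h := hpos (Fin.cast hrank.symm i)
      have h2 := Real.sq_sqrt h.le
      have h3 := Real.sqrt_pos.2 h
      field_simp
      exact h2.symm
    · have h : β (v (Fin.cast hrank.symm i)) (v (Fin.cast hrank.symm j)) = 0 :=
        hv (fun h => hij (by simpa using h))
      have h' : mink (v (Fin.cast hrank.symm i) : Mink n) (v (Fin.cast hrank.symm j)) = 0 := h
      rw [h', mul_zero, mul_zero]

end PseudoBasis

/-! ### Primitives -/

section Primitive

variable {n : ℕ} {b p : ℝ}

theorem eqOn_const_of_hasDerivAt_zero {E : Type*} [NormedAddCommGroup E] [NormedSpace ℝ E]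
    {f : ℝ → E} (hf : ∀ t ∈ Ioo 0 b, HasDerivAt f 0 t) {t u : ℝ} (ht : t ∈ Ioo 0 b)
    (hu : u ∈ Ioo 0 b) : f t = f u :=
  isOpen_Ioo.is_const_of_deriv_eq_zero isPreconnected_Ioo
    (fun x hx => (hf x hx).differentiableAt.differentiableWithinAt)
    (fun x hx => (hf x hx).deriv) ht hu

/-- The product of G with its Minkowski adjoint has derivative G (Ψ - Ψ) G* = 0, so it keeps its
value 1 at p. -/
theorem IsPrimitive.isLorentz {Ψ G : ℝ → EndM n} (hp : p ∈ Ioo 0 b)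
    (hΨ : ∀ t ∈ Ioo 0 b, IsSkew (Ψ t)) (hG : IsPrimitive b Ψ p G) {t : ℝ} (ht : t ∈ Ioo 0 b) :
    IsLorentz (G t) := by
  refine isLorentz_of_mul_madj ?_
  have hd : ∀ u ∈ Ioo 0 b, HasDerivAt (fun u => G u * madj (G u)) 0 u := fun u hu => by
    refine ((hG.2 u hu).mul (hG.2 u hu).madj).congr_deriv ?_
    rw [madj_mul, (hΨ u hu).madj_eq, mul_assoc, ← mul_add, ← add_mul, add_neg_cancel, zero_mul,
      mul_zero]
  have h := eqOn_const_of_hasDerivAt_zero hd ht hp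
  simpa [hG.1, madj_one] using h

/-- Solutions of `F' = B F` in the Lorentz group, for skew `B`. -/
theorem exists_isLorentz_solution {B : ℝ → EndM n} (hB : ContinuousOn B (Ioo 0 b))
    (hskew : ∀ t ∈ Ioo 0 b, IsSkew (B t)) (hp : p ∈ Ioo 0 b) {F₀ : EndM n} (hF₀ : IsLorentz F₀) :
    ∃ F : ℝ → EndM n, (∀ t ∈ Ioo 0 b, IsLorentz (F t) ∧ HasDerivAt F (B t * F t) t) ∧
      ∀ (a : Mink n) (x : ℝ → Mink n), (∀ t ∈ Ioo 0 b, HasDerivAt x (B t (x t)) t) → F₀ a = x p →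
        ∀ t ∈ Ioo 0 b, F t a = x t := by
  -- From G' = -GB and skewness of B the adjoint satisfies (G*)' = B G*. This converts
  -- right-multiplicative primitives into solutions of F' = BF.
  obtain ⟨G, hG⟩ := exists_isPrimitive (hB.neg) hp
  have hskew' : ∀ t ∈ Ioo 0 b, IsSkew ((-B) t) := fun t ht => (hskew t ht).neg
  have hL : ∀ t ∈ Ioo 0 b, IsLorentz (G t) := fun t ht => hG.isLorentz hp hskew' ht
  refine ⟨fun t => madj (G t) * F₀, fun t ht => ⟨(hL t ht).madj.mul hF₀, ?_⟩,
    fun a x hx ha t ht => ?_⟩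
  · refine ((hG.2 t ht).madj.mul_const F₀).congr_deriv ?_
    rw [madj_mul, (hskew' t ht).madj_eq]
    simp [mul_assoc]
  -- For x' = Bx the vector Gx is constant, which identifies Fa with x from their common value at p.
  · have hd : ∀ u ∈ Ioo 0 b, HasDerivAt (fun u => G u (x u)) 0 u := fun u hu => by
      refine ((hG.2 u hu).clm_apply (hx u hu)).congr_deriv ?_
      simp
    have h := eqOn_const_of_hasDerivAt_zero hd ht hp
    simp only [hG.1, one_apply_eq_self] at h
    rw [mul_apply_eq_comp, ha, ← h, ← mul_apply_eq_comp, (hL t ht).madj_mul_self]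
    rfl

/-- The relation Ψg + g' = gZ expresses that Z is the gauge transform without mentioning an inverse;
it is verified directly for the singular frame. -/
theorem gauge_eq {g Ψ : ℝ → EndM n} {Z g' : EndM n} {t : ℝ} (hg : IsLorentz (g t))
    (hg' : HasDerivAt g g' t) (hZ : Ψ t * g t + g' = g t * Z) : gauge g Ψ t = Z := by
  rw [gauge, hg.inverse_eq, hg'.deriv, mul_assoc, ← mul_add, hZ, ← mul_assoc, hg.madj_mul_self,
    one_mul]

/-- (Gg)' = G(Ψg + g') = (Gg)Z; the constant factor on the left normalizes the value at p. -/
theorem IsPrimitive.gauge {g g' Ψ Z G : ℝ → EndM n} (hp : p ∈ Ioo 0 b)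
    (hG : IsPrimitive b Ψ p G) (hg : ∀ t ∈ Ioo 0 b, IsLorentz (g t))
    (hg' : ∀ t ∈ Ioo 0 b, HasDerivAt g (g' t) t)
    (hZ : ∀ t ∈ Ioo 0 b, Ψ t * g t + g' t = g t * Z t) :
    IsPrimitive b Z p fun t => madj (g p) * G t * g t := by
  refine ⟨?_, fun t ht => ?_⟩
  · simp [hG.1, (hg p hp).madj_mul_self]
  · refine (((hG.2 t ht).const_mul (madj (g p))).mul (hg' t ht)).congr_deriv ?_
    calc madj (g p) * (G t * Ψ t) * g t + madj (g p) * G t * g' t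
        = madj (g p) * G t * (Ψ t * g t + g' t) := by noncomm_ring
      _ = madj (g p) * G t * g t * Z t := by rw [hZ t ht]; noncomm_ring

/-- Here (GE)' = G(EZE⁻¹ - ξ)E + GEξ, and the two terms with ξ cancel because E commutes with ξ. -/
theorem IsPrimitive.mul_of_commute {Φ ξ Z G E E' : ℝ → EndM n}
    (hG : IsPrimitive b Φ p G) (hE : IsPrimitive b ξ p E)
    (hEE : ∀ t ∈ Ioo 0 b, E' t * E t = 1) (hcomm : ∀ t ∈ Ioo 0 b, E t * ξ t = ξ t * E t)
    (hΦ : ∀ t ∈ Ioo 0 b, Φ t = E t * Z t * E' t - ξ t) :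
    IsPrimitive b Z p fun t => G t * E t := by
  refine ⟨by simp [hG.1, hE.1], fun t ht => ?_⟩
  refine ((hG.2 t ht).mul (hE.2 t ht)).congr_deriv ?_
  calc G t * Φ t * E t + G t * (E t * ξ t)
      = G t * (E t * Z t * (E' t * E t)) + G t * (E t * ξ t - ξ t * E t) := by
        rw [hΦ t ht]; simp only [mul_assoc, sub_mul, mul_sub]; abel
    _ = G t * E t * Z t := by rw [hEE t ht, hcomm t ht]; simp [mul_assoc]

/-- A primitive of a one-form which tends to zero at `0` has a limit at `0`. -/
theorem IsPrimitive.exists_tendsto {Φ G : ℝ → EndM n} (hp : p ∈ Ioo 0 b)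
    (hΦ : ContinuousOn Φ (Ioo 0 b)) (h0 : Tendsto Φ (𝓝[>] 0) (𝓝 0)) (hG : IsPrimitive b Φ p G) :
    ∃ Γ₀, Tendsto G (𝓝[>] 0) (𝓝 Γ₀) := by
  -- Translation by 1 moves the singular end 0 to an interior point of (0, b + 1), and extension by
  -- zero is continuous there. A primitive of the extended form then exists across that point, and
  -- uniqueness identifies it with G.
  set Ψ : ℝ → EndM n := fun t => if t ≤ 1 then 0 else Φ (t - 1) with hΨ
  have hΨc : ContinuousOn Ψ (Ioo 0 (b + 1)) := by
    intro t ht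
    apply ContinuousAt.continuousWithinAt
    rcases lt_trichotomy t 1 with h | h | h
    · refine (continuousAt_const (y := (0 : EndM n))).congr ?_
      filter_upwards [Iio_mem_nhds h] with u hu
      simp [hΨ, le_of_lt (mem_Iio.1 hu)]
    · subst h
      refine continuousAt_iff_continuous_left'_right'.2 ⟨?_, ?_⟩
      · have h1 : Tendsto (fun _ : ℝ => (0 : EndM n)) (𝓝[<] 1) (𝓝 (Ψ 1)) := by
          simp [hΨ]
        refine h1.congr' ?_
        filter_upwards [self_mem_nhdsWithin] with u hu
        simp [hΨ, le_of_lt (mem_Iio.1 hu)]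
      · have h2 : Tendsto (fun u : ℝ => u - 1) (𝓝[>] 1) (𝓝[>] 0) := by
          refine tendsto_nhdsWithin_iff.2 ⟨?_, ?_⟩
          · have : Tendsto (fun u : ℝ => u - 1) (𝓝 1) (𝓝 (1 - 1)) :=
              (continuous_id.sub continuous_const).tendsto 1
            rw [sub_self] at this
            exact this.mono_left nhdsWithin_le_nhds
          · filter_upwards [self_mem_nhdsWithin] with u hu
            exact sub_pos.2 (mem_Ioi.1 hu)
        have h1 : Tendsto (fun u => Φ (u - 1)) (𝓝[>] 1) (𝓝 (Ψ 1)) := by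
          simpa [hΨ, Function.comp_def] using h0.comp h2
        refine h1.congr' ?_
        filter_upwards [self_mem_nhdsWithin] with u hu
        simp [hΨ, not_le.2 (mem_Ioi.1 hu)]
    · have h1 : ContinuousAt (fun u => Φ (u - 1)) t := by
        refine ContinuousAt.comp (f := fun u => u - 1) (g := Φ) ?_ (by fun_prop)
        exact hΦ.continuousAt (Ioo_mem_nhds (by linarith) (by linarith [ht.2]))
      refine h1.congr ?_
      filter_upwards [Ioi_mem_nhds h] with u hu
      simp [hΨ, not_le.2 (mem_Ioi.1 hu)]
  have hp' : p + 1 ∈ Ioo 0 (b + 1) := ⟨by linarith [hp.1], by linarith [hp.2]⟩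
  obtain ⟨H, hH⟩ := exists_isPrimitive hΨc hp'
  have hH' : IsPrimitive b Φ p fun t => H (t + 1) := by
    refine ⟨hH.1, fun t ht => ?_⟩
    have h := (hH.2 (t + 1) ⟨by linarith [ht.1], by linarith [ht.2]⟩).comp_add_const t 1
    simpa [hΨ, not_le.2 ht.1] using h
  refine ⟨H 1, ?_⟩
  have hb : 0 < b := hp.1.trans hp.2
  have hc : Tendsto (fun t => H (t + 1)) (𝓝 0) (𝓝 (H (0 + 1))) := by
    have h := (hH.2 (0 + 1) ⟨by linarith, by linarith⟩).continuousAt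
    exact ContinuousAt.comp (f := fun t : ℝ => t + 1) (g := H) h (by fun_prop)
  rw [zero_add] at hc
  refine (hc.mono_left nhdsWithin_le_nhds).congr' ?_
  filter_upwards [Ioo_mem_nhdsGT hb] with t ht
  exact (hG.eqOn hΦ hp hH' ht).symm

theorem isLorentz_of_tendsto {α : Type*} {l : Filter α} [l.NeBot] {G : α → EndM n} {A : EndM n}
    (h : Tendsto G l (𝓝 A)) (hG : ∀ᶠ t in l, IsLorentz (G t)) : IsLorentz A := fun x y => by
  have h1 : ∀ z, Tendsto (fun t => G t z) l (𝓝 (A z)) := fun z =>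
    ((ContinuousLinearMap.apply ℝ (Mink n) z).continuous.tendsto A).comp h
  refine tendsto_nhds_unique ((h1 x).mink (h1 y)) (tendsto_const_nhds.congr' ?_)
  filter_upwards [hG] with t ht
  exact (ht x y).symm

end Primitive

/-! ### The rotations generated by the pure pole form -/

section Rotation

variable {n : ℕ}

/-- The image lies in the span of v and w, on which v ∧ w squares to minus the Gram determinant
times the identity. -/
theorem wedge_mul_wedge_mul_wedge (v w : Mink n) : wedge v w * wedge v w * wedge v w =
    -(mink v v * mink w w - mink v w ^ 2) • wedge v w := by
  ext1 x
  simp only [mul_apply_eq_comp, wedge_apply, map_sub, map_smul, mink_comm w v, _root_.smul_apply]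
  module

/-- The generator `-(o - 𝔱) ∧ (ι - μ 𝔱)` of the pure pole form. -/
noncomputable def poleGen (e : PseudoBasis n) (μ : ℝ) : EndM n :=
  -wedge (e.o - e.τ) (e.ι - μ • e.τ)

variable (e : PseudoBasis n) (μ : ℝ)

theorem poleForm_eq (s : ℝ → ℝ) (t : ℝ) :
    poleForm s e μ t = (deriv s t / s t) • poleGen e μ := by
  rw [poleForm, poleGen, smul_neg_endM, neg_smul_endM]

theorem isSkew_poleGen : IsSkew (poleGen e μ) := (isSkew_wedge _ _).neg

theorem poleGen_apply (x : Mink n) : poleGen e μ x =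
    (mink e.ι x - μ * mink e.τ x) • (e.o - e.τ) - (mink e.o x - mink e.τ x) • (e.ι - μ • e.τ) := by
  simp only [poleGen, _root_.neg_apply, wedge_apply, mink_sub_left, mink_smul_left]
  module

theorem poleGen_o : poleGen e μ e.o = e.τ - e.o := by
  simp only [poleGen_apply, mink_comm e.ι e.o, mink_comm e.τ e.o, e.o_o, e.o_ι, e.o_τ]
  module

theorem poleGen_τ : poleGen e μ e.τ = e.ι - μ • e.o := by
  simp only [poleGen_apply, e.ι_τ, e.o_τ, e.τ_τ]
  module

/-- The Gram determinant of o - 𝔱 and ι - μ𝔱 is μ² - (μ - 1)² = 2μ - 1. Its positivity makes their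
plane spacelike, so that the generated transformations are rotations. -/
theorem poleGen_cube :
    poleGen e μ * poleGen e μ * poleGen e μ = -(2 * μ - 1) • poleGen e μ := by
  have h := wedge_mul_wedge_mul_wedge (e.o - e.τ) (e.ι - μ • e.τ)
  have h1 : mink (e.o - e.τ) (e.o - e.τ) * mink (e.ι - μ • e.τ) (e.ι - μ • e.τ) -
      mink (e.o - e.τ) (e.ι - μ • e.τ) ^ 2 = 2 * μ - 1 := by
    simp only [mink_sub_left, mink_sub_right, mink_smul_left, mink_smul_right, e.o_o, e.o_ι,
      e.o_τ, e.τ_τ, e.ι_τ, e.ι_ι, mink_comm e.τ e.o, mink_comm e.τ e.ι]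
    ring
  rw [h1] at h
  simp only [poleGen, neg_mul_endM, mul_neg_endM, h, smul_neg_endM, neg_neg]

/-- The angular velocity of the rotations generated by the pure pole form. -/
noncomputable def poleFreq (μ : ℝ) : ℝ := √(2 * μ - 1)

theorem poleFreq_pos {μ : ℝ} (hμ : 1 - 2 * μ < 0) : 0 < poleFreq μ :=
  Real.sqrt_pos.2 (by linarith)

theorem poleFreq_sq {μ : ℝ} (hμ : 1 - 2 * μ < 0) : poleFreq μ ^ 2 = 2 * μ - 1 :=
  Real.sq_sqrt (by linarith)

/-- The one-parameter group of rotations generated by the pure pole form. -/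
noncomputable def poleRot (u : ℝ) : EndM n :=
  1 + (Real.sin (poleFreq μ * u) / poleFreq μ) • poleGen e μ +
    ((1 - Real.cos (poleFreq μ * u)) / poleFreq μ ^ 2) • (poleGen e μ * poleGen e μ)

theorem poleRot_zero : poleRot e μ 0 = 1 := by
  ext1 x
  simp [poleRot]

theorem poleRot_commute (u : ℝ) : poleRot e μ u * poleGen e μ = poleGen e μ * poleRot e μ u := by
  simp only [poleRot, add_mul, mul_add, one_mul, mul_one, smul_mul_endM, mul_smul_endM,
    mul_assoc]

variable {μ}

/-- With X³ = -k²X the exponential series of uX sums to 1 + (sin ku / k) X + ((1 - cos ku) / k²) X².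
Here its differential equation is verified directly. -/
theorem hasDerivAt_poleRot (hμ : 1 - 2 * μ < 0) (u : ℝ) :
    HasDerivAt (poleRot e μ) (poleRot e μ u * poleGen e μ) u := by
  have hk := (poleFreq_pos hμ).ne'
  have hlin : HasDerivAt (fun u => poleFreq μ * u) (poleFreq μ) u := by
    simpa using (hasDerivAt_id u).const_mul (poleFreq μ)
  have h1 := ((hlin.sin.div_const (poleFreq μ)).smul_const (poleGen e μ)).const_add (1 : EndM n)
  have h2 := ((hlin.cos.const_sub 1).div_const (poleFreq μ ^ 2)).smul_const
    (poleGen e μ * poleGen e μ)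
  refine (h1.add h2).congr_deriv ?_
  simp only [poleRot, add_mul, one_mul, smul_mul_endM, poleGen_cube, smul_smul_endM,
    ← poleFreq_sq hμ]
  have e1 : Real.cos (poleFreq μ * u) * poleFreq μ / poleFreq μ = Real.cos (poleFreq μ * u) := by
    field_simp
  have e2 : -(-Real.sin (poleFreq μ * u) * poleFreq μ) / poleFreq μ ^ 2 =
      Real.sin (poleFreq μ * u) / poleFreq μ := by
    field_simp
  have e3 : (1 - Real.cos (poleFreq μ * u)) / poleFreq μ ^ 2 * -poleFreq μ ^ 2 =
      Real.cos (poleFreq μ * u) - 1 := by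
    field_simp
    ring
  rw [e1, e2, e3]
  ext1 x
  simp only [_root_.add_apply, _root_.smul_apply]
  module

theorem continuous_poleRot (hμ : 1 - 2 * μ < 0) : Continuous (poleRot e μ) :=
  continuous_iff_continuousAt.2 fun u => (hasDerivAt_poleRot e hμ u).continuousAt

theorem poleRot_neg_mul (hμ : 1 - 2 * μ < 0) (u : ℝ) : poleRot e μ (-u) * poleRot e μ u = 1 := by
  have hd : ∀ u, HasDerivAt (fun u => poleRot e μ (-u) * poleRot e μ u) 0 u := fun u => by
    have h1 : HasDerivAt (fun u => poleRot e μ (-u))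
        ((-1 : ℝ) • (poleRot e μ (-u) * poleGen e μ)) u :=
      HasDerivAt.scomp u (hasDerivAt_poleRot e hμ (-u)) (hasDerivAt_neg u)
    refine (h1.mul (hasDerivAt_poleRot e hμ u)).congr_deriv ?_
    rw [poleRot_commute e μ u, neg_smul_endM, neg_mul_endM, smul_mul_endM, mul_assoc]
    ext1 x
    simp
  have h := is_const_of_deriv_eq_zero (fun u => (hd u).differentiableAt)
    (fun u => (hd u).deriv) u 0
  simpa [poleRot_zero] using h

theorem isLorentz_poleRot (hμ : 1 - 2 * μ < 0) (u : ℝ) : IsLorentz (poleRot e μ u) := fun x y => by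
  have hx : ∀ x u, HasDerivAt (fun u => poleRot e μ u x) (poleGen e μ (poleRot e μ u x)) u :=
    fun x u => by
      have h := (hasDerivAt_poleRot e hμ u).clm_apply (hasDerivAt_const u x)
      rw [poleRot_commute] at h
      simpa using h
  have hd : ∀ u, HasDerivAt (fun u => mink (poleRot e μ u x) (poleRot e μ u y)) 0 u := fun u => by
    refine ((hx x u).mink (hx y u)).congr_deriv ?_
    rw [isSkew_poleGen e μ, neg_add_cancel]
  have h := is_const_of_deriv_eq_zero (fun u => (hd u).differentiableAt)
    (fun u => (hd u).deriv) u 0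
  simpa [poleRot_zero] using h

theorem poleRot_sub_period (hμ : 1 - 2 * μ < 0) (u : ℝ) (N : ℕ) :
    poleRot e μ (u - N * (2 * Real.pi / poleFreq μ)) = poleRot e μ u := by
  have hk := (poleFreq_pos hμ).ne'
  have h : poleFreq μ * (u - N * (2 * Real.pi / poleFreq μ)) =
      poleFreq μ * u - N * (2 * Real.pi) := by
    field_simp
  simp only [poleRot, h, Real.sin_sub_nat_mul_two_pi, Real.cos_sub_nat_mul_two_pi]

/-- Uniformity in u is essential: the angle runs to -∞ at the pole, and conjugation by these
rotations must not destroy the decay of the remainder. -/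
theorem exists_norm_poleRot_le : ∃ K, ∀ u, ‖poleRot e μ u‖ ≤ K := by
  refine ⟨‖(1 : EndM n)‖ + 1 / |poleFreq μ| * ‖poleGen e μ‖ +
    2 / poleFreq μ ^ 2 * ‖poleGen e μ * poleGen e μ‖, fun u => ?_⟩
  refine (norm_add₃_le).trans ?_
  rw [norm_smul, norm_smul, norm_div, norm_div, Real.norm_eq_abs, Real.norm_eq_abs,
    Real.norm_eq_abs, Real.norm_eq_abs, abs_of_nonneg (sq_nonneg (poleFreq μ))]
  gcongr
  · exact Real.abs_sin_le_one _
  · rw [abs_le]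
    constructor <;> linarith [Real.neg_one_le_cos (poleFreq μ * u),
      Real.cos_le_one (poleFreq μ * u)]

theorem poleRot_o (u : ℝ) : poleRot e μ u e.o =
    e.o + (Real.sin (poleFreq μ * u) / poleFreq μ) • (e.τ - e.o) +
      ((1 - Real.cos (poleFreq μ * u)) / poleFreq μ ^ 2) •
        ((1 - μ) • e.o + e.ι - e.τ) := by
  simp only [poleRot, _root_.add_apply, _root_.smul_apply, mul_apply_eq_comp, one_apply_eq_self,
    poleGen_o, map_sub, poleGen_τ]
  module

theorem poleRot_o_mem (u : ℝ) :
    poleRot e μ u e.o ∈ Submodule.span ℝ {e.o, e.ι, e.τ} := by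
  have ho : e.o ∈ Submodule.span ℝ {e.o, e.ι, e.τ} := Submodule.subset_span (by simp)
  have hι : e.ι ∈ Submodule.span ℝ {e.o, e.ι, e.τ} := Submodule.subset_span (by simp)
  have hτ : e.τ ∈ Submodule.span ℝ {e.o, e.ι, e.τ} := Submodule.subset_span (by simp)
  rw [poleRot_o]
  exact add_mem (add_mem ho (Submodule.smul_mem _ _ (sub_mem hτ ho)))
    (Submodule.smul_mem _ _ (sub_mem (add_mem (Submodule.smul_mem _ _ ho) hι) hτ))

theorem mink_poleRot_o (hμ : 1 - 2 * μ < 0) (u : ℝ) :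
    mink (poleRot e μ u e.o) (poleRot e μ u e.o) = 0 := by
  rw [isLorentz_poleRot e hμ, e.o_o]

/-- The orbit of `o` meets every null line of `⟨o, ι, 𝔱⟩`. -/
theorem exists_smul_poleRot_o_eq (hμ : 1 - 2 * μ < 0) {x : Mink n}
    (hx : x ∈ Submodule.span ℝ {e.o, e.ι, e.τ}) (hx0 : x ≠ 0) (hxx : mink x x = 0) :
    ∃ u r : ℝ, r ≠ 0 ∧ x = r • poleRot e μ u e.o := by
  have hk := poleFreq_pos hμ
  obtain ⟨a, y, hy, rfl⟩ := Submodule.mem_span_insert.1 hx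
  obtain ⟨b, d, rfl⟩ := Submodule.mem_span_pair.1 hy
  have hnull : d ^ 2 = 2 * a * b := by
    simp only [mink_add_left, mink_add_right, mink_smul_left, mink_smul_right, e.o_o, e.o_ι,
      e.o_τ, e.τ_τ, e.ι_τ, e.ι_ι, mink_comm e.τ e.o, mink_comm e.τ e.ι, mink_comm e.ι e.o] at hxx
    linarith
  by_cases hb : b = 0
  · have hd : d = 0 := by simpa [hb] using hnull
    subst hb hd
    refine ⟨0, a, fun h => hx0 (by simp [h]), by simp [poleRot_zero]⟩
  · set k := poleFreq μ with hkdef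
    have hk2 : k ^ 2 = 2 * μ - 1 := poleFreq_sq hμ
    -- At angle 2φ, the orbit of o has 𝔱- and ι-coefficients in the ratio k cot φ - 1, which must
    -- equal d/b. The inverse cotangent is written through arctan so that sin φ > 0.
    set φ := Real.pi / 2 - Real.arctan ((d / b + 1) / k) with hφ
    have hsin : Real.sin φ = Real.cos (Real.arctan ((d / b + 1) / k)) := Real.sin_pi_div_two_sub _
    have hcos : Real.cos φ = Real.sin (Real.arctan ((d / b + 1) / k)) := Real.cos_pi_div_two_sub _
    have hpos : 0 < Real.sin φ := by
      rw [hsin]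
      exact Real.cos_arctan_pos _
    have hcot : k * Real.cos φ = (d / b + 1) * Real.sin φ := by
      have h := Real.tan_arctan ((d / b + 1) / k)
      rw [Real.tan_eq_sin_div_cos, ← hcos, ← hsin, div_eq_iff hpos.ne'] at h
      rw [h]
      field_simp
    have harg : k * (2 * φ / k) = 2 * φ := by field_simp
    -- The factor is fixed by the ι-coefficient, since (1 - cos 2φ)/k² = 2 sin²φ / k².
    refine ⟨2 * φ / k, b * k ^ 2 / (2 * Real.sin φ ^ 2), by positivity, ?_⟩
    rw [poleRot_o, ← hkdef, harg, Real.sin_two_mul, Real.cos_two_mul']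
    have hS := Real.sin_sq_add_cos_sq φ
    have hm : k * Real.cos φ * b = (d + b) * Real.sin φ := by
      rw [hcot]
      field_simp
    set S := Real.sin φ
    set c := Real.cos φ
    have hc1 : c = (d + b) * S / (k * b) := by
      field_simp
      linarith
    have hkb : (k ^ 2 * b ^ 2 + (d + b) ^ 2) * S ^ 2 = k ^ 2 * b ^ 2 := by
      rw [hc1] at hS
      field_simp at hS
      linarith
    have h2 : b * k ^ 2 / (2 * S ^ 2) * ((1 - (c ^ 2 - S ^ 2)) / k ^ 2) = b := by
      have : 1 - (c ^ 2 - S ^ 2) = 2 * S ^ 2 := by linarith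
      rw [this]
      field_simp
    have h1 : b * k ^ 2 / (2 * S ^ 2) * (2 * S * c / k) = d + b := by
      rw [hc1]
      field_simp
    -- The remaining o-coefficient is forced by nullity d² = 2ab together with k² = 2μ - 1.
    have h0 : b * k ^ 2 / (2 * S ^ 2) = a + d + b * μ := by
      have h3 : k ^ 2 * b ^ 2 = 2 * (a + d + b * μ) * b * S ^ 2 := by
        rw [← hkb, hk2]
        linear_combination S ^ 2 * hnull
      field_simp
      have h4 : b * (b * k ^ 2) = b * ((a + d + b * μ) * 2 * S ^ 2) := by linarith
      have := mul_left_cancel₀ hb h4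
      linarith
    rw [smul_add, smul_add, smul_smul, smul_smul, h1, h2, h0]
    module

end Rotation

/-! ### The flat lift and its moving frame -/

section FlatLift

variable {n : ℕ}

/-- The source of the structure equations: each orthogonality or normalization relation is
differentiated in this form. -/
theorem mink_deriv_of_eqOn_const {I : Set ℝ} (hI : IsOpen I) {x y : ℝ → Mink n} {x' y' : Mink n}
    {t k : ℝ} (ht : t ∈ I) (hx : HasDerivAt x x' t) (hy : HasDerivAt y y' t)
    (h : ∀ u ∈ I, mink (x u) (y u) = k) : mink x' (y t) + mink (x t) y' = 0 := by
  refine (hx.mink hy).unique ((hasDerivAt_const t k).congr_of_eventuallyEq ?_)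
  filter_upwards [hI.mem_nhds ht] with u hu
  exact h u hu

theorem _root_.ContDiffOn.hasDerivAt_of_isOpen {E : Type*} [NormedAddCommGroup E] [NormedSpace ℝ E]
    {f : ℝ → E} {I : Set ℝ} (hf : ContDiffOn ℝ ∞ f I) (hI : IsOpen I) {t : ℝ} (ht : t ∈ I) :
    HasDerivAt f (deriv f t) t :=
  ((hf.differentiableOn (by simp)).differentiableAt (hI.mem_nhds ht)).hasDerivAt

theorem _root_.ContDiffOn.deriv_infty {E : Type*} [NormedAddCommGroup E] [NormedSpace ℝ E]
    {f : ℝ → E} {I : Set ℝ} (hf : ContDiffOn ℝ ∞ f I) (hI : IsOpen I) :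
    ContDiffOn ℝ ∞ (deriv f) I :=
  ((contDiffOn_infty_iff_deriv_of_isOpen hI).1 hf).2

/-- `c` is a light cone lift of a regular curve and `s` a regular parameter on the open set `I`. -/
structure IsParamCurve (c : ℝ → Mink n) (s : ℝ → ℝ) (I : Set ℝ) : Prop where
  isOpen : IsOpen I
  lift : IsRegularLift c I
  smooth : ContDiffOn ℝ ∞ s I
  deriv_pos : ∀ t ∈ I, 0 < deriv s t

/-- The unit tangent field `df/ds` of the flat lift `f`. -/
noncomputable def flatTangent (c : ℝ → Mink n) (s : ℝ → ℝ) (t : ℝ) : Mink n :=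
  (deriv s t)⁻¹ • deriv (flatLift c s) t

/-- The second derivative `d²f/ds²` of the flat lift `f`. -/
noncomputable def flatAccel (c : ℝ → Mink n) (s : ℝ → ℝ) (t : ℝ) : Mink n :=
  (deriv s t)⁻¹ • deriv (flatTangent c s) t

/-- The null vector `f̄` in the span of `f`, `df/ds` and `d²f/ds²`, orthogonal to `df/ds`, with
`⟨f, f̄⟩ = -1`. -/
noncomputable def flatDual (c : ℝ → Mink n) (s : ℝ → ℝ) (t : ℝ) : Mink n :=
  flatAccel c s t + (mink (flatAccel c s t) (flatAccel c s t) / 2) • flatLift c s t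

/-- The element of the Lie algebra by which the frames of the flat lift evolve. -/
noncomputable def frameForm (c : ℝ → Mink n) (s : ℝ → ℝ) (t : ℝ) : EndM n :=
  deriv s t • wedge (flatTangent c s t) (flatDual c s t) -
    wedge (flatLift c s t) (deriv (flatDual c s) t)

theorem isSkew_frameForm (c : ℝ → Mink n) (s : ℝ → ℝ) (t : ℝ) : IsSkew (frameForm c s t) :=
  ((isSkew_wedge _ _).smul _).sub (isSkew_wedge _ _)

namespace IsParamCurve

variable {c : ℝ → Mink n} {s : ℝ → ℝ} {I : Set ℝ}

theorem contDiffOn_deriv (h : IsParamCurve c s I) :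
    ContDiffOn ℝ ∞ (deriv s) I :=
  h.smooth.deriv_infty h.isOpen

theorem contDiffOn_inv (h : IsParamCurve c s I) : ContDiffOn ℝ ∞ (fun t => (deriv s t)⁻¹) I :=
  h.contDiffOn_deriv.inv fun t ht => (h.deriv_pos t ht).ne'

theorem contDiffOn_scale (h : IsParamCurve c s I) :
    ContDiffOn ℝ ∞ (fun t => deriv s t / √(mink (deriv c t) (deriv c t))) I := by
  have hc' := h.lift.1.deriv_infty h.isOpen
  refine h.contDiffOn_deriv.div ((hc'.mink hc').sqrt fun t ht => (h.lift.2 t ht).2.2.ne') ?_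
  exact fun t ht => (Real.sqrt_pos.2 (h.lift.2 t ht).2.2).ne'

theorem contDiffOn_flatLift (h : IsParamCurve c s I) :
    ContDiffOn ℝ ∞ (flatLift c s) I :=
  h.contDiffOn_scale.smul h.lift.1

theorem contDiffOn_flatTangent (h : IsParamCurve c s I) : ContDiffOn ℝ ∞ (flatTangent c s) I :=
  h.contDiffOn_inv.smul (h.contDiffOn_flatLift.deriv_infty h.isOpen)

theorem contDiffOn_flatAccel (h : IsParamCurve c s I) : ContDiffOn ℝ ∞ (flatAccel c s) I :=
  h.contDiffOn_inv.smul (h.contDiffOn_flatTangent.deriv_infty h.isOpen)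

theorem contDiffOn_flatDual (h : IsParamCurve c s I) : ContDiffOn ℝ ∞ (flatDual c s) I :=
  h.contDiffOn_flatAccel.add
    (((h.contDiffOn_flatAccel.mink h.contDiffOn_flatAccel).div_const 2).smul
      h.contDiffOn_flatLift)

theorem contDiffOn_deriv_flatDual (h : IsParamCurve c s I) :
    ContDiffOn ℝ ∞ (deriv (flatDual c s)) I :=
  h.contDiffOn_flatDual.deriv_infty h.isOpen

theorem contDiffOn_frameForm (h : IsParamCurve c s I) : ContDiffOn ℝ ∞ (frameForm c s) I :=
  (h.contDiffOn_deriv.smul (h.contDiffOn_flatTangent.wedge h.contDiffOn_flatDual)).sub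
    (h.contDiffOn_flatLift.wedge h.contDiffOn_deriv_flatDual)

variable {t : ℝ}

theorem scale_pos (h : IsParamCurve c s I) (ht : t ∈ I) :
    0 < deriv s t / √(mink (deriv c t) (deriv c t)) :=
  div_pos (h.deriv_pos t ht) (Real.sqrt_pos.2 (h.lift.2 t ht).2.2)

theorem hasDerivAt_flatLift (h : IsParamCurve c s I) (ht : t ∈ I) :
    HasDerivAt (flatLift c s) (deriv s t • flatTangent c s t) t := by
  rw [flatTangent, smul_inv_smul₀ (h.deriv_pos t ht).ne']
  exact h.contDiffOn_flatLift.hasDerivAt_of_isOpen h.isOpen ht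

theorem hasDerivAt_flatTangent (h : IsParamCurve c s I) (ht : t ∈ I) :
    HasDerivAt (flatTangent c s) (deriv s t • flatAccel c s t) t := by
  rw [flatAccel, smul_inv_smul₀ (h.deriv_pos t ht).ne']
  exact h.contDiffOn_flatTangent.hasDerivAt_of_isOpen h.isOpen ht

theorem hasDerivAt_flatDual (h : IsParamCurve c s I) (ht : t ∈ I) :
    HasDerivAt (flatDual c s) (deriv (flatDual c s) t) t :=
  h.contDiffOn_flatDual.hasDerivAt_of_isOpen h.isOpen ht

theorem mink_flatLift_flatLift (h : IsParamCurve c s I) (ht : t ∈ I) :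
    mink (flatLift c s t) (flatLift c s t) = 0 := by
  simp [flatLift, mink_smul_left, mink_smul_right, (h.lift.2 t ht).2.1]

theorem mink_flatLift_flatTangent (h : IsParamCurve c s I) (ht : t ∈ I) :
    mink (flatLift c s t) (flatTangent c s t) = 0 := by
  have h1 := mink_deriv_of_eqOn_const h.isOpen ht (h.hasDerivAt_flatLift ht)
    (h.hasDerivAt_flatLift ht) fun u hu => h.mink_flatLift_flatLift hu
  rw [mink_comm (flatLift c s t), mink_smul_left] at h1
  have h2 : deriv s t * mink (flatTangent c s t) (flatLift c s t) = 0 := by linarith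
  rw [mink_comm]
  exact (mul_eq_zero.1 h2).resolve_left (h.deriv_pos t ht).ne'

/-- The coefficient r need not be known: c is null and orthogonal to c', so r drops out of lengths,
and it drops out of wedges with c. -/
theorem exists_deriv_flatLift_eq (h : IsParamCurve c s I) (ht : t ∈ I) :
    ∃ r : ℝ, deriv (flatLift c s) t =
    r • c t + (deriv s t / √(mink (deriv c t) (deriv c t))) • deriv c t := by
  have h1 := (h.contDiffOn_scale.hasDerivAt_of_isOpen h.isOpen ht).smul
    (h.lift.1.hasDerivAt_of_isOpen h.isOpen ht)
  refine ⟨deriv (fun t => deriv s t / √(mink (deriv c t) (deriv c t))) t, ?_⟩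
  exact h1.deriv.trans (add_comm _ _)

theorem mink_flatTangent_flatTangent (h : IsParamCurve c s I) (ht : t ∈ I) :
    mink (flatTangent c s t) (flatTangent c s t) = 1 := by
  obtain ⟨r, hr⟩ := h.exists_deriv_flatLift_eq ht
  have hc := h.lift.1.hasDerivAt_of_isOpen h.isOpen ht
  have h1 := mink_deriv_of_eqOn_const h.isOpen ht hc hc fun u hu => (h.lift.2 u hu).2.1
  rw [mink_comm (c t)] at h1
  have h2 : mink (deriv c t) (c t) = 0 := by linarith
  have hs := (h.deriv_pos t ht).ne'
  have hpos := (h.lift.2 t ht).2.2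
  have hsq := Real.sq_sqrt hpos.le
  have hne := (Real.sqrt_pos.2 hpos).ne'
  rw [flatTangent, hr]
  simp only [mink_smul_left, mink_smul_right, mink_add_left, mink_add_right, h2,
    mink_comm (c t) (deriv c t), (h.lift.2 t ht).2.1]
  field_simp
  rw [hsq]
  ring

theorem mink_flatTangent_flatAccel (h : IsParamCurve c s I) (ht : t ∈ I) :
    mink (flatTangent c s t) (flatAccel c s t) = 0 := by
  have h1 := mink_deriv_of_eqOn_const h.isOpen ht (h.hasDerivAt_flatTangent ht)
    (h.hasDerivAt_flatTangent ht) fun u hu => h.mink_flatTangent_flatTangent hu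
  rw [mink_comm (flatTangent c s t), mink_smul_left] at h1
  have h2 : deriv s t * mink (flatAccel c s t) (flatTangent c s t) = 0 := by linarith
  rw [mink_comm]
  exact (mul_eq_zero.1 h2).resolve_left (h.deriv_pos t ht).ne'

theorem mink_flatLift_flatAccel (h : IsParamCurve c s I) (ht : t ∈ I) :
    mink (flatLift c s t) (flatAccel c s t) = -1 := by
  have h1 := mink_deriv_of_eqOn_const h.isOpen ht (h.hasDerivAt_flatLift ht)
    (h.hasDerivAt_flatTangent ht) fun u hu => h.mink_flatLift_flatTangent hu
  rw [mink_smul_left, mink_smul_right, h.mink_flatTangent_flatTangent ht, ← mul_add] at h1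
  have := (mul_eq_zero.1 h1).resolve_left (h.deriv_pos t ht).ne'
  linarith

theorem mink_flatLift_flatDual (h : IsParamCurve c s I) (ht : t ∈ I) :
    mink (flatLift c s t) (flatDual c s t) = -1 := by
  rw [flatDual, mink_add_right, mink_smul_right, h.mink_flatLift_flatAccel ht,
    h.mink_flatLift_flatLift ht]
  ring

theorem mink_flatTangent_flatDual (h : IsParamCurve c s I) (ht : t ∈ I) :
    mink (flatTangent c s t) (flatDual c s t) = 0 := by
  rw [flatDual, mink_add_right, mink_smul_right, h.mink_flatTangent_flatAccel ht,
    mink_comm _ (flatLift c s t), h.mink_flatLift_flatTangent ht]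
  ring

theorem mink_flatDual_flatDual (h : IsParamCurve c s I) (ht : t ∈ I) :
    mink (flatDual c s t) (flatDual c s t) = 0 := by
  rw [flatDual]
  simp only [mink_add_left, mink_add_right, mink_smul_left, mink_smul_right,
    h.mink_flatLift_flatAccel ht, mink_comm (flatAccel c s t) (flatLift c s t),
    h.mink_flatLift_flatLift ht]
  ring

/-- Together with the next lemma, this places the pulled-back vector v in ⟨o, ι⟩^⊥, where the
Minkowski form is positive definite. -/
theorem mink_flatLift_deriv_flatDual (h : IsParamCurve c s I) (ht : t ∈ I) :
    mink (flatLift c s t) (deriv (flatDual c s) t) = 0 := by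
  have h1 := mink_deriv_of_eqOn_const h.isOpen ht (h.hasDerivAt_flatLift ht)
    (h.hasDerivAt_flatDual ht) fun u hu => h.mink_flatLift_flatDual hu
  rwa [mink_smul_left, h.mink_flatTangent_flatDual ht, mul_zero, zero_add] at h1

theorem mink_flatDual_deriv_flatDual (h : IsParamCurve c s I) (ht : t ∈ I) :
    mink (flatDual c s t) (deriv (flatDual c s) t) = 0 := by
  have h1 := mink_deriv_of_eqOn_const h.isOpen ht (h.hasDerivAt_flatDual ht)
    (h.hasDerivAt_flatDual ht) fun u hu => h.mink_flatDual_flatDual hu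
  rw [mink_comm (deriv (flatDual c s) t)] at h1
  linarith

/-- This and the next two lemmas say that f, f̄ and f_s all solve x' = Bx with B = `frameForm`.
Hence a solution of F' = BF with the right initial value carries them as columns. -/
theorem frameForm_flatLift (h : IsParamCurve c s I) (ht : t ∈ I) :
    frameForm c s t (flatLift c s t) = deriv s t • flatTangent c s t := by
  simp only [frameForm, _root_.sub_apply, _root_.smul_apply, wedge_apply,
    mink_comm _ (flatLift c s t), h.mink_flatLift_flatTangent ht, h.mink_flatLift_flatDual ht,
    h.mink_flatLift_flatLift ht, h.mink_flatLift_deriv_flatDual ht]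
  module

theorem frameForm_flatDual (h : IsParamCurve c s I) (ht : t ∈ I) :
    frameForm c s t (flatDual c s t) = deriv (flatDual c s) t := by
  simp only [frameForm, _root_.sub_apply, _root_.smul_apply, wedge_apply,
    h.mink_flatTangent_flatDual ht, h.mink_flatLift_flatDual ht,
    h.mink_flatDual_flatDual ht, mink_comm _ (flatDual c s t), h.mink_flatDual_deriv_flatDual ht]
  module

theorem frameForm_flatTangent (h : IsParamCurve c s I) (ht : t ∈ I) :
    frameForm c s t (flatTangent c s t) = deriv s t • flatAccel c s t := by
  have h1 := mink_deriv_of_eqOn_const h.isOpen ht (h.hasDerivAt_flatDual ht)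
    (h.hasDerivAt_flatTangent ht) fun u hu => by
      rw [mink_comm]
      exact h.mink_flatTangent_flatDual hu
  -- This makes ⟨f̄', f_s⟩ = -s' ‖f_ss‖²/2, exactly the f-component by which f_ss and f̄ differ.
  have h2 : mink (flatDual c s t) (flatAccel c s t) =
      mink (flatAccel c s t) (flatAccel c s t) / 2 := by
    rw [flatDual, mink_add_left, mink_smul_left, h.mink_flatLift_flatAccel ht]
    ring
  rw [mink_smul_right, h2] at h1
  simp only [frameForm, _root_.sub_apply, _root_.smul_apply, wedge_apply,
    h.mink_flatTangent_flatTangent ht, h.mink_flatLift_flatTangent ht,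
    mink_comm (flatDual c s t) (flatTangent c s t), h.mink_flatTangent_flatDual ht,
    eq_neg_of_add_eq_zero_left h1]
  rw [flatDual]
  module

/-- Rescaling the lift multiplies both c ∧ c' and ‖c'‖² by the square of the factor, so the quotient
may be computed with the flat lift. -/
theorem assocForm_eq (h : IsParamCurve c s I) (ht : t ∈ I) (Q : ℝ → ℝ) : assocForm c Q t =
    (Q t / deriv s t) • wedge (flatLift c s t) (flatTangent c s t) := by
  obtain ⟨r, hr⟩ := h.exists_deriv_flatLift_eq ht
  have hs := (h.deriv_pos t ht).ne'
  have hpos := (h.lift.2 t ht).2.2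
  have hsq := Real.sq_sqrt hpos.le
  have hne := (Real.sqrt_pos.2 hpos).ne'
  rw [assocForm, flatTangent, hr, flatLift, wedge_smul_left, wedge_smul_right, wedge_add_right,
    wedge_smul_right, wedge_smul_right, wedge_self]
  ext1 x
  simp only [_root_.smul_apply, _root_.add_apply, _root_.zero_apply, smul_zero, zero_add,
    smul_smul]
  congr 1
  field_simp
  rw [hsq]

end IsParamCurve

end FlatLift

/-! ### Curve frames -/

section Frames

variable {n : ℕ} {b p : ℝ} {c : ℝ → Mink n} {s : ℝ → ℝ} {I : Set ℝ}

/-- Bootstrapping: if F is of class C^m, then so is F' = BF, whence F is of class C^(m+1). -/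
theorem contDiffOn_of_linear_ode {U : Set ℝ} (hU : IsOpen U) {B F : ℝ → EndM n}
    (hB : ContDiffOn ℝ ∞ B U) (hF : ∀ t ∈ U, HasDerivAt F (B t * F t) t) :
    ContDiffOn ℝ ∞ F U := by
  have hd : DifferentiableOn ℝ F U := fun t ht => (hF t ht).differentiableAt.differentiableWithinAt
  refine contDiffOn_infty.2 fun m => ?_
  induction m with
  | zero => exact contDiffOn_zero.2 hd.continuousOn
  | succ m ih =>
    push_cast
    refine (contDiffOn_succ_iff_deriv_of_isOpen hU).2 ⟨hd, fun h => by simp at h, ?_⟩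
    refine ((hB.of_le (by exact_mod_cast le_top)).clm_comp ih).congr fun t ht => ?_
    exact (hF t ht).deriv

/-- A pseudo-orthonormal basis f, f̄, f_s, ν_i at p is transported by F' = BF. The normal columns
then have derivatives proportional to f, which gives parallelism and ⟨dN_i, df⟩ = 0 together. -/
theorem exists_isCurveFrame (hn : 1 ≤ n) (h : IsParamCurve c s I) (hI : Ioo 0 b ⊆ I)
    (hp : p ∈ Ioo 0 b) (e : PseudoBasis n) : ∃ F, IsCurveFrame b c s e F := by
  have hpI := hI hp
  obtain ⟨ν, hν, hνν⟩ := exists_orthonormal_complement hn (h.mink_flatLift_flatLift hpI)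
    (h.mink_flatDual_flatDual hpI) (h.mink_flatLift_flatDual hpI)
    (h.mink_flatTangent_flatTangent hpI) (h.mink_flatLift_flatTangent hpI)
    ((mink_comm _ _).trans (h.mink_flatTangent_flatDual hpI))
  let e' : PseudoBasis n :=
    { o := flatLift c s p
      ι := flatDual c s p
      τ := flatTangent c s p
      ν := ν
      o_o := h.mink_flatLift_flatLift hpI
      ι_ι := h.mink_flatDual_flatDual hpI
      o_ι := h.mink_flatLift_flatDual hpI
      τ_τ := h.mink_flatTangent_flatTangent hpI
      o_τ := h.mink_flatLift_flatTangent hpI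
      ι_τ := (mink_comm _ _).trans (h.mink_flatTangent_flatDual hpI)
      o_ν := fun i => (hν i).1
      ι_ν := fun i => (hν i).2.1
      τ_ν := fun i => (hν i).2.2
      ν_ν := hνν }
  obtain ⟨F, hF, hFx⟩ := exists_isLorentz_solution (b := b) (p := p)
    (h.contDiffOn_frameForm.continuousOn.mono hI) (fun t _ => isSkew_frameForm c s t) hp
    (e.isLorentz_toFrame hn e')
  have hFo : ∀ t ∈ Ioo 0 b, F t e.o = flatLift c s t := hFx _ _ (fun t ht => by
    rw [h.frameForm_flatLift (hI ht)]
    exact h.hasDerivAt_flatLift (hI ht)) (e.toFrame_o e')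
  have hFτ : ∀ t ∈ Ioo 0 b, F t e.τ = flatTangent c s t := hFx _ _ (fun t ht => by
    rw [h.frameForm_flatTangent (hI ht)]
    exact h.hasDerivAt_flatTangent (hI ht)) (e.toFrame_τ e')
  have hFι : ∀ t ∈ Ioo 0 b, F t e.ι = flatDual c s t := hFx _ _ (fun t ht => by
    rw [h.frameForm_flatDual (hI ht)]
    exact h.hasDerivAt_flatDual (hI ht)) (e.toFrame_ι e')
  have hN : ∀ t ∈ Ioo 0 b, ∀ i, deriv (fun u => F u (e.ν i)) t =
      mink (deriv (flatDual c s) t) (F t (e.ν i)) • flatLift c s t := fun t ht i => by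
    have hd := (hF t ht).2.clm_apply (hasDerivAt_const t (e.ν i))
    rw [hd.deriv, map_zero, add_zero, mul_apply_eq_comp]
    simp only [frameForm, _root_.sub_apply, _root_.smul_apply, wedge_apply]
    rw [← hFo t ht, ← hFτ t ht, ← hFι t ht, (hF t ht).1, (hF t ht).1, (hF t ht).1, e.τ_ν, e.ι_ν,
      e.o_ν]
    module
  refine ⟨F, contDiffOn_of_linear_ode isOpen_Ioo (h.contDiffOn_frameForm.mono hI)
    fun t ht => (hF t ht).2, fun t ht => ⟨(hF t ht).1, hFo t ht, hFτ t ht, fun i => ?_,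
      fun i j => ?_⟩⟩
  · rw [hN t ht, (h.hasDerivAt_flatLift (hI ht)).deriv, mink_smul_left, mink_smul_right,
      h.mink_flatLift_flatTangent (hI ht), mul_zero, mul_zero]
  · rw [hN t ht, mink_smul_left, ← hFo t ht, (hF t ht).1, e.o_ν, mul_zero]

/-- The image of a pseudo-orthonormal basis under an orthogonal transformation. -/
def PseudoBasis.map (e : PseudoBasis n) {A : EndM n} (hA : IsLorentz A) : PseudoBasis n where
  o := A e.o
  ι := A e.ι
  τ := A e.τ
  ν i := A (e.ν i)
  o_o := (hA _ _).trans e.o_o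
  ι_ι := (hA _ _).trans e.ι_ι
  o_ι := (hA _ _).trans e.o_ι
  τ_τ := (hA _ _).trans e.τ_τ
  o_τ := (hA _ _).trans e.o_τ
  ι_τ := (hA _ _).trans e.ι_τ
  o_ν i := (hA _ _).trans (e.o_ν i)
  ι_ν i := (hA _ _).trans (e.ι_ν i)
  τ_ν i := (hA _ _).trans (e.τ_ν i)
  ν_ν i j := (hA _ _).trans (e.ν_ν i j)

namespace IsCurveFrame

variable {e : PseudoBasis n} {F : ℝ → EndM n}

theorem hasDerivAt_apply (hF : IsCurveFrame b c s e F) {t : ℝ} (ht : t ∈ Ioo 0 b) (x : Mink n) :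
    HasDerivAt (fun u => F u x) (deriv F t x) t := by
  have hd := (hF.1.hasDerivAt_of_isOpen isOpen_Ioo ht).clm_apply (hasDerivAt_const t x)
  simpa using hd

/-- Differentiating ⟨N_i, f_s⟩ = 0 and using ⟨dN_i, df⟩ = 0 shows that f_ss is orthogonal to all
N_i. So f_ss is Fι plus a multiple of f, and nullity of Fι determines the multiple. -/
theorem apply_ι (hn : 1 ≤ n) (h : IsParamCurve c s I) (hI : Ioo 0 b ⊆ I)
    (hF : IsCurveFrame b c s e F) {t : ℝ} (ht : t ∈ Ioo 0 b) : F t e.ι = flatDual c s t := by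
  obtain ⟨hL, ho, hτ, hdf, -⟩ := hF.2 t ht
  have hτ' : F t e.τ = flatTangent c s t := hτ
  have htI := hI ht
  have hs := (h.deriv_pos t htI).ne'
  have hν : ∀ i, mink (F t (e.ν i)) (flatAccel c s t) = 0 := fun i => by
    have h1 := mink_deriv_of_eqOn_const isOpen_Ioo ht (hF.hasDerivAt_apply ht (e.ν i))
      (h.hasDerivAt_flatTangent htI) (k := 0) fun u hu => by
        rw [flatTangent, ← (hF.2 u hu).2.2.1, (hF.2 u hu).1, mink_comm, e.τ_ν]
    have h2 := hdf i
    rw [(hF.hasDerivAt_apply ht (e.ν i)).deriv, (h.hasDerivAt_flatLift htI).deriv,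
      mink_smul_right] at h2
    rw [(mul_eq_zero.1 h2).resolve_left hs, zero_add, mink_smul_right] at h1
    exact (mul_eq_zero.1 h1).resolve_left hs
  have hexp := (e.map hL).eq_comb hn (flatAccel c s t)
  have hacc : flatAccel c s t =
      (-mink (F t e.ι) (flatAccel c s t)) • flatLift c s t + F t e.ι := by
    conv_lhs => rw [hexp]
    simp only [PseudoBasis.comb, PseudoBasis.map, hν, ho, hτ', h.mink_flatLift_flatAccel htI,
      h.mink_flatTangent_flatAccel htI, zero_smul, Finset.sum_const_zero, add_zero, neg_neg,
      one_smul]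
  have hfι : mink (flatLift c s t) (F t e.ι) = -1 := by rw [← ho, hL, e.o_ι]
  have hιι : mink (F t e.ι) (F t e.ι) = 0 := by rw [hL, e.ι_ι]
  have hsq : mink (flatAccel c s t) (flatAccel c s t) =
      2 * mink (F t e.ι) (flatAccel c s t) := by
    conv_lhs => rw [hacc]
    generalize mink (F t e.ι) (flatAccel c s t) = k
    simp only [mink_add_left, mink_add_right, mink_smul_left, mink_smul_right, hιι, hfι,
      mink_comm (F t e.ι) (flatLift c s t), h.mink_flatLift_flatLift htI]
    ring
  rw [flatDual, hsq]
  nth_rw 1 [hacc]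
  module

/-- The gauge computation must cover every admissible frame, not only the constructed one. The
equation is checked on the columns; for the N_i, the derivative is identified by its pairings with
the moving basis. -/
theorem hasDerivAt (hn : 1 ≤ n) (h : IsParamCurve c s I) (hI : Ioo 0 b ⊆ I)
    (hF : IsCurveFrame b c s e F) {t : ℝ} (ht : t ∈ Ioo 0 b) :
    HasDerivAt F (frameForm c s t * F t) t := by
  obtain ⟨hL, ho, hτ, hdf, hpar⟩ := hF.2 t ht
  have hτ' : F t e.τ = flatTangent c s t := hτ
  have hι := hF.apply_ι hn h hI ht
  have htI := hI ht
  have hs := (h.deriv_pos t htI).ne'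
  have hnhds : ∀ᶠ u in 𝓝 t, u ∈ Ioo 0 b := isOpen_Ioo.mem_nhds ht
  have hcol : ∀ {a : Mink n} {x : ℝ → Mink n} {x' : Mink n}, (∀ u ∈ Ioo 0 b, F u a = x u) →
      HasDerivAt x x' t → deriv F t a = x' := fun {a x x'} hax hx =>
    (hF.hasDerivAt_apply ht a).unique (hx.congr_of_eventuallyEq (hnhds.mono hax))
  refine (hF.1.hasDerivAt_of_isOpen isOpen_Ioo ht).congr_deriv ?_
  refine e.ext_endM hn ?_ ?_ ?_ fun i => ?_
  · rw [mul_apply_eq_comp, ho, h.frameForm_flatLift htI]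
    exact hcol (fun u hu => (hF.2 u hu).2.1) (h.hasDerivAt_flatLift htI)
  · rw [mul_apply_eq_comp, hι, h.frameForm_flatDual htI]
    exact hcol (fun u hu => hF.apply_ι hn h hI hu) (h.hasDerivAt_flatDual htI)
  · rw [mul_apply_eq_comp, hτ', h.frameForm_flatTangent htI]
    exact hcol (fun u hu => (hF.2 u hu).2.2.1) (h.hasDerivAt_flatTangent htI)
  · have hB : (frameForm c s t * F t) (e.ν i) =
        mink (deriv (flatDual c s) t) (F t (e.ν i)) • F t e.o := by
      rw [mul_apply_eq_comp]
      simp only [frameForm, _root_.sub_apply, _root_.smul_apply, wedge_apply]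
      rw [← ho, ← hτ', ← hι, hL, hL, hL, e.τ_ν, e.ι_ν, e.o_ν]
      module
    have hdN := hF.hasDerivAt_apply ht (e.ν i)
    have h1 := mink_deriv_of_eqOn_const isOpen_Ioo ht (h.hasDerivAt_flatLift htI) hdN (k := 0)
      fun u hu => by rw [← (hF.2 u hu).2.1, (hF.2 u hu).1, e.o_ν]
    rw [mink_smul_left, ← hτ', hL, e.τ_ν, mul_zero, zero_add, ← ho] at h1
    have h2 := mink_deriv_of_eqOn_const isOpen_Ioo ht (h.hasDerivAt_flatDual htI) hdN (k := 0)
      fun u hu => by rw [← hF.apply_ι hn h hI hu, (hF.2 u hu).1, e.ι_ν]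
    have h3 := hdf i
    rw [hdN.deriv, (h.hasDerivAt_flatLift htI).deriv, mink_smul_right] at h3
    have h4 := (mul_eq_zero.1 h3).resolve_left hs
    rw [hB]
    refine (e.map hL).ext_mink hn ?_ ?_ ?_ fun j => ?_
    · simp only [PseudoBasis.map]
      rw [h1, mink_smul_right, hL, e.o_o, mul_zero]
    · simp only [PseudoBasis.map]
      rw [mink_smul_right, hL, mink_comm e.ι, e.o_ι, hι]
      linarith
    · simp only [PseudoBasis.map]
      rw [mink_smul_right, hL, mink_comm e.τ, e.o_τ, mul_zero, hτ', mink_comm, h4]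
    · simp only [PseudoBasis.map]
      have h5 := hpar i j
      rw [hdN.deriv] at h5
      rw [mink_smul_right, hL, mink_comm (e.ν j), e.o_ν, mul_zero, mink_comm, h5]

end IsCurveFrame

/-! ### The gauge transform by the singular frame -/

theorem boost_apply (e : PseudoBasis n) (r : ℝ) (x : Mink n) : boost e r x =
    x + ((1 - r⁻¹) * mink e.ι x) • e.o + ((1 - r) * mink e.o x) • e.ι := rfl

theorem isLorentz_boost (e : PseudoBasis n) {r : ℝ} (hr : r ≠ 0) : IsLorentz (boost e r) :=
  fun x y => by
    simp only [boost_apply, mink_add_left, mink_add_right, mink_smul_left, mink_smul_right, e.o_o,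
      e.ι_ι, e.o_ι, mink_comm e.ι e.o, mink_comm x e.o, mink_comm x e.ι]
    field_simp
    ring

/-- The boosts form a one-parameter group in log r with generator ι ∧ o. -/
theorem hasDerivAt_boost (e : PseudoBasis n) {t s' : ℝ} (hs : HasDerivAt s s' t) (h0 : s t ≠ 0) :
    HasDerivAt (fun u => boost e (s u))
      (boost e (s t) * ((s' / s t) • wedge e.ι e.o)) t := by
  have hb : ∀ r, boost e r = 1 + (1 - r⁻¹) • (minkL n e.ι).smulRight e.o +
      (1 - r) • (minkL n e.o).smulRight e.ι := fun r => by
    ext1 x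
    simp only [boost_apply, _root_.add_apply, _root_.smul_apply, one_apply_eq_self,
      ContinuousLinearMap.smulRight_apply, minkL_apply, smul_smul]
  have h1 := (((hs.inv h0).const_sub 1).smul_const ((minkL n e.ι).smulRight e.o)).const_add
    (1 : EndM n)
  have h2 := (hs.const_sub 1).smul_const ((minkL n e.o).smulRight e.ι)
  simp only [hb]
  refine (h1.add h2).congr_deriv ?_
  rw [← hb]
  ext1 x
  simp only [mul_apply_eq_comp, _root_.add_apply, _root_.smul_apply, wedge_apply, map_smul, map_sub,
    boost_o, boost_ι, ContinuousLinearMap.smulRight_apply, minkL_apply]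
  have e1 : -(-s' / s t ^ 2) = s' / s t * (s t)⁻¹ := by field_simp
  have e2 : -s' = -(s' / s t * s t) := by field_simp
  rw [e1, e2]
  module

/-- The regular part of the gauge transform of `λω` by the singular frame is `-s o ∧ v` with this
vector `v`. -/
noncomputable def regularPart (c : ℝ → Mink n) (s : ℝ → ℝ) (F : ℝ → EndM n) (t : ℝ) : Mink n :=
  madj (F t) (deriv (flatDual c s) t)

/-- Moving g to the left turns f ∧ f_s into s o ∧ 𝔱, f_s ∧ f̄ into s⁻¹ 𝔱 ∧ ι, and f ∧ f̄' into s o ∧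
v. The terms with s'/s, contributed by λω, F' and R', add up to μ o ∧ 𝔱 + 𝔱 ∧ ι + ι ∧ o = -(o - 𝔱) ∧
(ι - μ𝔱), and only -s o ∧ v remains. -/
theorem singFrame_gauge_identity {e : PseudoBasis n} {F : ℝ → EndM n} {Q : ℝ → ℝ} {q : ℝ} (lam : ℝ)
    (hn : 1 ≤ n) (h : IsParamCurve c s I) (hI : Ioo 0 b ⊆ I) (hF : IsCurveFrame b c s e F) {t : ℝ}
    (ht : t ∈ Ioo 0 b) (h0 : s t ≠ 0) (hQ : Q t = q * (deriv s t) ^ 2 / (s t) ^ 2) :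
    ∃ g', HasDerivAt (singFrame s e F) g' t ∧
      (lam • assocForm c Q) t * singFrame s e F t + g' = singFrame s e F t *
        (poleForm s e (q * lam) t - s t • wedge e.o (regularPart c s F t)) := by
  obtain ⟨hL, ho, hτ, -, -⟩ := hF.2 t ht
  have hτ' : F t e.τ = flatTangent c s t := hτ
  have hι := hF.apply_ι hn h hI ht
  have htI := hI ht
  have hs := (h.deriv_pos t htI).ne'
  have hB := isLorentz_boost e h0
  have hFv : F t (regularPart c s F t) = deriv (flatDual c s) t := by
    rw [regularPart, ← mul_apply_eq_comp, hL.mul_madj_self]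
    rfl
  have hvo : mink e.o (regularPart c s F t) = 0 := by
    rw [← hL, hFv, ho, h.mink_flatLift_deriv_flatDual htI]
  have hvι : mink e.ι (regularPart c s F t) = 0 := by
    rw [← hL, hFv, hι, h.mink_flatDual_deriv_flatDual htI]
  set v := regularPart c s F t
  set R := boost e (s t) with hR
  have hRo : R (s t • e.o) = e.o := by
    rw [map_smul, hR, boost_o, smul_inv_smul₀ h0]
  have hRι : R ((s t)⁻¹ • e.ι) = e.ι := by
    rw [map_smul, hR, boost_ι, inv_smul_smul₀ h0]
  have hRτ : R e.τ = e.τ := boost_of_orthogonal e _ e.o_τ e.ι_τ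
  have hRv : R v = v := boost_of_orthogonal e _ hvo hvι
  have w1 : wedge (flatLift c s t) (flatTangent c s t) * (F t * R) =
      F t * R * wedge (s t • e.o) e.τ := by
    rw [mul_assoc, hB.mul_wedge, hRo, hRτ, ← mul_assoc, ← mul_assoc, hL.mul_wedge, ho, hτ']
  have w2 : wedge (flatTangent c s t) (flatDual c s t) * (F t * R) =
      F t * R * wedge e.τ ((s t)⁻¹ • e.ι) := by
    rw [mul_assoc, hB.mul_wedge, hRι, hRτ, ← mul_assoc, ← mul_assoc, hL.mul_wedge, hι, hτ']
  have w3 : wedge (flatLift c s t) (deriv (flatDual c s) t) * (F t * R) =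
      F t * R * wedge (s t • e.o) v := by
    rw [mul_assoc, hB.mul_wedge, hRo, hRv, ← mul_assoc, ← mul_assoc, hL.mul_wedge, ho, hFv]
  refine ⟨_, (hF.hasDerivAt hn h hI ht).mul
    (hasDerivAt_boost e (h.smooth.hasDerivAt_of_isOpen h.isOpen htI) h0), ?_⟩
  have hform : (lam • assocForm c Q) t =
      (q * lam * deriv s t / s t ^ 2) • wedge (flatLift c s t) (flatTangent c s t) := by
    rw [Pi.smul_apply, h.assocForm_eq htI, hQ, smul_smul_endM]
    congr 1
    field_simp
  rw [hform]
  change _ * (F t * R) + (_ * R + F t * (R * _)) = F t * R * _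
  rw [mul_assoc (frameForm c s t), ← mul_assoc (F t) R, frameForm, sub_mul, smul_mul_endM,
    smul_mul_endM, w1, w2, w3, ← mul_smul_endM, ← mul_smul_endM, ← mul_sub, ← mul_add, ← mul_add,
    poleForm_eq]
  congr 1
  rw [wedge_smul_left, wedge_smul_right, wedge_smul_left, smul_smul_endM, smul_smul_endM]
  have e1 : q * lam * deriv s t / s t ^ 2 * s t = deriv s t / s t * (q * lam) := by field_simp
  rw [e1, ← div_eq_mul_inv]
  ext1 x
  simp only [_root_.add_apply, _root_.sub_apply, _root_.smul_apply, wedge_apply, poleGen_apply]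
  module

end Frames

/-! ### Normal parameters -/

section NormalParam

/-- The parametric integral `∫₀¹ u^k f(ut) du`. -/
noncomputable def radialMean (f : ℝ → ℝ) (k : ℕ) (t : ℝ) : ℝ := ∫ u in (0 : ℝ)..1, u ^ k * f (u * t)

variable {a b : ℝ}

theorem mul_mem_Ioo_of_mem_Icc (ha : a < 0) (hb : 0 < b) {t u : ℝ} (ht : t ∈ Ioo a b)
    (hu : u ∈ Icc (0 : ℝ) 1) : u * t ∈ Ioo a b := by
  have h := (convex_Ioo a b).smul_mem_of_zero_mem (⟨ha, hb⟩ : (0 : ℝ) ∈ Ioo a b) ht hu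
  simpa using h

/-- Differentiation under the integral sign yields a mean of the same type for f' and k + 1, so
smoothness follows by induction over all f and k at once. -/
theorem hasDerivAt_radialMean (ha : a < 0) (hb : 0 < b) {f : ℝ → ℝ}
    (hf : ContDiffOn ℝ ∞ f (Ioo a b)) (k : ℕ) {t : ℝ} (ht : t ∈ Ioo a b) :
    HasDerivAt (radialMean f k) (radialMean (deriv f) (k + 1) t) t := by
  -- The subinterval contains both t and 0, hence also all products ux with u ∈ [0, 1]; f' is
  -- bounded on its compact closure.
  obtain ⟨α, hα1, hα2⟩ := exists_between (lt_min ht.1 ha)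
  obtain ⟨β, hβ1, hβ2⟩ := exists_between (max_lt ht.2 hb)
  have hα0 : α < 0 := hα2.trans_le (min_le_right _ _)
  have hβ0 : 0 < β := (le_max_right _ _).trans_lt hβ1
  have htI : t ∈ Ioo α β := ⟨hα2.trans_le (min_le_left _ _), (le_max_left _ _).trans_lt hβ1⟩
  have hK : Icc α β ⊆ Ioo a b := fun x hx => ⟨hα1.trans_le hx.1, hx.2.trans_lt hβ2⟩
  have hf' := hf.deriv_infty isOpen_Ioo
  obtain ⟨M, hM⟩ := isCompact_Icc.exists_bound_of_continuousOn (hf'.continuousOn.mono hK)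
  have hcont : ∀ {φ : ℝ → ℝ}, ContinuousOn φ (Ioo a b) → ∀ (j : ℕ) {x : ℝ}, x ∈ Ioo a b →
      ContinuousOn (fun u => u ^ j * φ (u * x)) (uIcc 0 1) := fun {φ} hφ j {x} hx => by
    rw [uIcc_of_le zero_le_one]
    refine (continuous_pow j).continuousOn.mul (hφ.comp (by fun_prop) fun u hu => ?_)
    exact mul_mem_Ioo_of_mem_Icc ha hb hx hu
  have huI : ∀ {u : ℝ}, u ∈ uIoc (0 : ℝ) 1 → u ∈ Icc (0 : ℝ) 1 := fun {u} hu => by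
    rw [uIoc_of_le zero_le_one] at hu
    exact ⟨hu.1.le, hu.2⟩
  refine (intervalIntegral.hasDerivAt_integral_of_dominated_loc_of_deriv_le
    (F := fun x u => u ^ k * f (u * x)) (F' := fun x u => u ^ (k + 1) * deriv f (u * x))
    (s := Ioo α β) (bound := fun _ => M) (isOpen_Ioo.mem_nhds htI) ?_ ?_ ?_ ?_ ?_ ?_).2
  · filter_upwards [isOpen_Ioo.mem_nhds ht] with x hx
    exact ((hcont hf.continuousOn k hx).intervalIntegrable).aestronglyMeasurable_restrict_uIoc
  · exact (hcont hf.continuousOn k ht).intervalIntegrable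
  · exact ((hcont hf'.continuousOn (k + 1)
      ht).intervalIntegrable).aestronglyMeasurable_restrict_uIoc
  · refine Eventually.of_forall fun u hu x hx => ?_
    have hu' := huI hu
    rw [norm_mul, norm_pow, Real.norm_eq_abs, abs_of_nonneg hu'.1]
    have h1 : u ^ (k + 1) ≤ 1 := pow_le_one₀ hu'.1 hu'.2
    have h2 := hM (u * x) (Ioo_subset_Icc_self (mul_mem_Ioo_of_mem_Icc hα0 hβ0 hx hu'))
    calc u ^ (k + 1) * ‖deriv f (u * x)‖ ≤ 1 * M :=
          mul_le_mul h1 h2 (norm_nonneg _) zero_le_one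
      _ = M := one_mul M
  · exact intervalIntegrable_const
  · refine Eventually.of_forall fun u hu x hx => ?_
    have hx' := mul_mem_Ioo_of_mem_Icc ha hb (hK (Ioo_subset_Icc_self hx)) (huI hu)
    have hlin : HasDerivAt (fun x => u * x) u x := by
      simpa using (hasDerivAt_id x).const_mul u
    have h1 := ((hf.hasDerivAt_of_isOpen isOpen_Ioo hx').comp x hlin).const_mul (u ^ k)
    refine h1.congr_deriv ?_
    ring

theorem contDiffOn_radialMean (ha : a < 0) (hb : 0 < b) {f : ℝ → ℝ}
    (hf : ContDiffOn ℝ ∞ f (Ioo a b)) (k : ℕ) : ContDiffOn ℝ ∞ (radialMean f k) (Ioo a b) := by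
  refine contDiffOn_infty.2 fun m => ?_
  induction m generalizing f k with
  | zero =>
    exact contDiffOn_zero.2 fun t ht =>
      (hasDerivAt_radialMean ha hb hf k ht).continuousAt.continuousWithinAt
  | succ m ih =>
    push_cast
    refine (contDiffOn_succ_iff_deriv_of_isOpen isOpen_Ioo).2 ⟨fun t ht =>
      (hasDerivAt_radialMean ha hb hf k ht).differentiableAt.differentiableWithinAt,
      fun h => by simp at h, ?_⟩
    exact (ih (hf.deriv_infty isOpen_Ioo) (k + 1)).congr fun t ht =>
      (hasDerivAt_radialMean ha hb hf k ht).deriv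

/-- Hadamard's lemma: a smooth function which vanishes at `0` is a smooth multiple of the
coordinate. -/
theorem exists_eq_mul_of_contDiffOn (ha : a < 0) (hb : 0 < b) {f : ℝ → ℝ}
    (hf : ContDiffOn ℝ ∞ f (Ioo a b)) (h0 : f 0 = 0) :
    ∃ ρ, ContDiffOn ℝ ∞ ρ (Ioo a b) ∧ ∀ t ∈ Ioo a b, f t = t * ρ t := by
  have hf' := hf.deriv_infty isOpen_Ioo
  refine ⟨radialMean (deriv f) 0, contDiffOn_radialMean ha hb hf' 0, fun t ht => ?_⟩
  have huI : ∀ {u : ℝ}, u ∈ uIcc (0 : ℝ) 1 → u ∈ Icc (0 : ℝ) 1 := fun {u} hu => by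
    rwa [uIcc_of_le zero_le_one] at hu
  have h := intervalIntegral.integral_eq_sub_of_hasDerivAt (a := 0) (b := 1)
    (f := fun u => f (u * t)) (f' := fun u => deriv f (u * t) * t) (fun u hu => by
      have hlin : HasDerivAt (fun u => u * t) t u := by
        simpa using (hasDerivAt_id u).mul_const t
      exact (hf.hasDerivAt_of_isOpen isOpen_Ioo
        (mul_mem_Ioo_of_mem_Icc ha hb ht (huI hu))).comp u hlin)
    (ContinuousOn.intervalIntegrable ((hf'.continuousOn.comp (by fun_prop) fun u hu =>
      mul_mem_Ioo_of_mem_Icc ha hb ht (huI hu)).mul continuousOn_const))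
  rw [intervalIntegral.integral_mul_const] at h
  simp only [one_mul, zero_mul, h0, sub_zero] at h
  simp only [radialMean, pow_zero, one_mul]
  linarith

theorem exists_smooth_primitive (ha : a < 0) (hb : 0 < b) {ρ : ℝ → ℝ}
    (hρ : ContDiffOn ℝ ∞ ρ (Ioo a b)) :
    ∃ E, ContDiffOn ℝ ∞ E (Ioo a b) ∧ ∀ t ∈ Ioo a b, HasDerivAt E (ρ t) t := by
  have hE : ∀ t ∈ Ioo a b, HasDerivAt (fun t => ∫ x in (0 : ℝ)..t, ρ x) (ρ t) t := fun t ht => by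
    have hsub : uIcc 0 t ⊆ Ioo a b := ordConnected_Ioo.uIcc_subset ⟨ha, hb⟩ ht
    exact intervalIntegral.integral_hasDerivAt_right
      ((hρ.continuousOn.mono hsub).intervalIntegrable)
      (hρ.continuousOn.stronglyMeasurableAtFilter isOpen_Ioo t ht)
      (hρ.continuousOn.continuousAt (isOpen_Ioo.mem_nhds ht))
  refine ⟨_, (contDiffOn_infty_iff_deriv_of_isOpen isOpen_Ioo).2
    ⟨fun t ht => (hE t ht).differentiableAt.differentiableWithinAt,
      hρ.congr fun t ht => (hE t ht).deriv⟩, hE⟩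

/-- With h = t²Q the equation Q = q s'²/s² reads s'/s = √(h/q) / t. Since √(h/q) is 1 at 0,
Hadamard's lemma gives √(h/q) = 1 + tρ with ρ smooth, and s = t exp(∫ρ) is the solution sought. -/
theorem exists_isNormalParam {Q : ℝ → ℝ} {q : ℝ} (hb : 0 < b) (hQ : ∀ t ∈ Ioo 0 b, Q t ≠ 0)
    (hpole : HasPole 2 b Q q) : ∃ s, IsNormalParam b Q q s := by
  obtain ⟨hq, δ, hδ, h, hh, hh0, hhQ⟩ := hpole
  have hIo : ∀ {t}, t ∈ Ioo 0 b → t ∈ Ioo (-δ) b := fun {t} ht => ⟨by linarith [ht.1], ht.2⟩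
  have h0mem : (0 : ℝ) ∈ Ioo (-δ) b := ⟨by linarith, hb⟩
  have hcont : ContinuousOn (fun t => h t / q) (Ioo (-δ) b) := hh.continuousOn.div_const q
  obtain ⟨η, hη, hηpos⟩ : ∃ η > 0, ∀ t ∈ Ioo (-η) η, t ∈ Ioo (-δ) b ∧ 0 < h t / q := by
    have h1 : ∀ᶠ t in 𝓝 (0 : ℝ), t ∈ Ioo (-δ) b ∧ 0 < h t / q := by
      refine Eventually.and (isOpen_Ioo.mem_nhds h0mem) ?_
      have h2 := hcont.continuousAt (isOpen_Ioo.mem_nhds h0mem)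
      refine h2.eventually_const_lt ?_
      simp [hh0, hq]
    obtain ⟨η, hη, hball⟩ := Metric.eventually_nhds_iff_ball.1 h1
    refine ⟨η, hη, fun t ht => hball t ?_⟩
    rw [Real.ball_eq_Ioo]
    simpa using ht
  have hpos : ∀ t ∈ Ioo (-η) b, t ∈ Ioo (-δ) b ∧ 0 < h t / q := by
    intro t ht
    rcases lt_or_ge t η with hlt | hge
    · exact hηpos t ⟨ht.1, hlt⟩
    · have ht0 : 0 < t := hη.trans_le hge
      refine ⟨hIo ⟨ht0, ht.2⟩, ?_⟩
      -- Failure of positivity would produce a zero of h in [0, t], which is excluded at 0 by q ≠ 0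
      -- and elsewhere by Q ≠ 0.
      by_contra! hle
      have hsub : Icc 0 t ⊆ Ioo (-δ) b := fun x hx => ⟨by linarith [hx.1], hx.2.trans_lt ht.2⟩
      obtain ⟨x, hx, hx0⟩ := intermediate_value_Icc' ht0.le (hcont.mono hsub)
        (⟨hle, by simp [hh0, hq]⟩ : (0 : ℝ) ∈ Icc (h t / q) (h 0 / q))
      have hhx : h x = 0 := by simpa [hq] using hx0
      rcases hx.1.eq_or_lt with h1 | h1
      · exact hq (hh0.symm.trans ((congrArg h h1).trans hhx))
      · have hxI : x ∈ Ioo 0 b := ⟨h1, hx.2.trans_lt ht.2⟩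
        have h3 := hhQ x hxI
        rw [hhx, eq_comm, mul_eq_zero] at h3
        rcases h3 with h3 | h3
        · exact hQ x hxI h3
        · simp at h3
          exact h1.ne' h3
  have hη0 : -η < 0 := by linarith
  have hsub : Ioo (-η) b ⊆ Ioo (-δ) b := fun t ht => (hpos t ht).1
  have hsqrt : ContDiffOn ℝ ∞ (fun t => √(h t / q)) (Ioo (-η) b) :=
    ((hh.mono hsub).div_const q).sqrt fun t ht => (hpos t ht).2.ne'
  obtain ⟨ρ, hρ, hρeq⟩ := exists_eq_mul_of_contDiffOn hη0 hb (hsqrt.sub (contDiffOn_const (c := 1)))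
    (by simp [hh0, hq])
  obtain ⟨E, hE, hE'⟩ := exists_smooth_primitive hη0 hb hρ
  have hs' : ∀ t ∈ Ioo (-η) b,
      HasDerivAt (fun t => t * Real.exp (E t)) (√(h t / q) * Real.exp (E t)) t := fun t ht => by
    refine ((hasDerivAt_id t).mul (hE' t ht).exp).congr_deriv ?_
    have h1 := hρeq t ht
    simp only [id]
    linear_combination (-Real.exp (E t)) * h1
  refine ⟨fun t => t * Real.exp (E t), ⟨η, hη, contDiffOn_id.mul hE.exp, fun t ht => ?_⟩,
    by simp, fun t ht => ?_⟩
  · rw [(hs' t ht).deriv]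
    exact mul_pos (Real.sqrt_pos.2 (hpos t ht).2) (Real.exp_pos _)
  · have htη : t ∈ Ioo (-η) b := ⟨hη0.trans ht.1, ht.2⟩
    rw [(hs' t htη).deriv, mul_pow, mul_pow, Real.sq_sqrt (hpos t htη).2.le, hhQ t ht]
    have := ht.1.ne'
    field_simp
    ring

end NormalParam

/-! ### Distances and speeds on the conformal sphere -/

section Sphere

variable {n : ℕ}

/-- The competitor is the chord projected radially to the sphere. The chord stays at distance at
least 1/2 from the origin, so each of the two terms of the derivative is at most 2‖d‖. -/
theorem conformalDist_le {φ : Amb n → ℝ} {K : ℝ} (hK : ∀ P ∈ Metric.sphere (0 : Amb n) 1, φ P ≤ K)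
    (hK0 : 0 ≤ K) {P P' : Amb n} (hP : ‖P‖ = 1) (hP' : ‖P'‖ = 1) (hPP : ‖P' - P‖ ≤ 1 / 2) :
    conformalDist φ P P' ≤ ENNReal.ofReal (K * (4 * ‖P' - P‖)) := by
  set d := P' - P with hd
  set v : ℝ → Amb n := fun u => P + u • d with hv
  set γ : ℝ → Amb n := fun u => (√(‖v u‖ ^ 2))⁻¹ • v u with hγ
  have hvpos : ∀ u ∈ Icc (0 : ℝ) 1, 1 / 2 ≤ ‖v u‖ := fun u hu => by
    have h1 : ‖P‖ ≤ ‖v u‖ + ‖u • d‖ := by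
      have h2 := norm_sub_le (v u) (u • d)
      simpa [hv] using h2
    rw [norm_smul, Real.norm_eq_abs, abs_of_nonneg hu.1, hP] at h1
    nlinarith [hu.2, norm_nonneg d]
  have hne : ∀ u ∈ Icc (0 : ℝ) 1, ‖v u‖ ≠ 0 := fun u hu =>
    ((by norm_num : (0 : ℝ) < 1 / 2).trans_le (hvpos u hu)).ne'
  have hvd : ∀ u, HasDerivAt v d u := fun u => by
    simpa only [id, one_smul] using ((hasDerivAt_id u).smul_const d).const_add P
  have hγd : ∀ u ∈ Icc (0 : ℝ) 1, ∃ γ', HasDerivAt γ γ' u ∧ ‖γ'‖ ≤ 4 * ‖d‖ := fun u hu => by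
    have h0 := hne u hu
    have h1 := ((hvd u).norm_sq.sqrt (pow_ne_zero 2 h0)).inv
      (by rw [Real.sqrt_sq (norm_nonneg _)]; exact h0)
    refine ⟨_, h1.smul (hvd u), ?_⟩
    simp only [Pi.inv_apply, Real.sqrt_sq (norm_nonneg (v u))]
    have hin : |inner ℝ (v u) d| ≤ ‖v u‖ * ‖d‖ := abs_real_inner_le_norm _ _
    have hN := hvpos u hu
    have hN0 : 0 < ‖v u‖ := by linarith
    refine (norm_add_le _ _).trans ?_
    rw [norm_smul, norm_smul, norm_div, norm_neg, norm_div, norm_mul, norm_inv, norm_pow, norm_mul,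
      norm_norm, Real.norm_eq_abs (inner ℝ (v u) d)]
    simp only [Real.norm_ofNat]
    have e1 : ‖v u‖⁻¹ ≤ 2 := by
      rw [inv_le_comm₀ hN0 (by norm_num)]
      linarith
    have e2 : 2 * |inner ℝ (v u) d| / (2 * ‖v u‖) / ‖v u‖ ^ 2 * ‖v u‖ ≤ ‖v u‖⁻¹ * ‖d‖ := by
      calc 2 * |inner ℝ (v u) d| / (2 * ‖v u‖) / ‖v u‖ ^ 2 * ‖v u‖
          = |inner ℝ (v u) d| / ‖v u‖ ^ 2 := by field_simp
        _ ≤ ‖v u‖ * ‖d‖ / ‖v u‖ ^ 2 := by gcongr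
        _ = ‖v u‖⁻¹ * ‖d‖ := by field_simp
    nlinarith [norm_nonneg d, mul_le_mul_of_nonneg_right e1 (norm_nonneg d)]
  have hγ1 : ∀ u ∈ Icc (0 : ℝ) 1, ‖γ u‖ = 1 := fun u hu => by
    simp only [hγ, Real.sqrt_sq (norm_nonneg (v u))]
    rw [norm_smul, norm_inv, norm_norm, inv_mul_cancel₀ (hne u hu)]
  have hγs : ContDiffOn ℝ 1 γ (Icc 0 1) := by
    have hvs : ContDiff ℝ 1 v := contDiff_const.add (contDiff_id.smul contDiff_const)
    refine ContDiffOn.smul (ContDiffOn.inv (ContDiffOn.sqrt (hvs.norm_sq ℝ).contDiffOn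
      fun u hu => pow_ne_zero 2 (hne u hu)) fun u hu => ?_) hvs.contDiffOn
    rw [Real.sqrt_sq (norm_nonneg _)]
    exact hne u hu
  have hγ0 : γ 0 = P := by simp [hγ, hv, hP]
  have hγe : γ 1 = P' := by simp [hγ, hv, hd, hP']
  refine (iInf₂_le γ ⟨hγs, hγ1, hγ0, hγe⟩).trans ?_
  calc ∫⁻ u in Icc (0 : ℝ) 1, ENNReal.ofReal (φ (γ u) * ‖derivWithin γ (Icc 0 1) u‖)
      ≤ ∫⁻ _ in Icc (0 : ℝ) 1, ENNReal.ofReal (K * (4 * ‖d‖)) := by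
        refine MeasureTheory.setLIntegral_mono' measurableSet_Icc fun u hu => ?_
        obtain ⟨γ', hγ', hle⟩ := hγd u hu
        rw [hγ'.hasDerivWithinAt.derivWithin (uniqueDiffOn_Icc zero_lt_one u hu)]
        refine ENNReal.ofReal_le_ofReal ?_
        exact mul_le_mul (hK _ (by simpa using hγ1 u hu)) hle (norm_nonneg _) hK0
    _ = ENNReal.ofReal (K * (4 * ‖d‖)) := by simp

theorem tendsto_conformalDist {α : Type*} {l : Filter α} {φ : Amb n → ℝ} (hφ : IsConformalFactor φ)
    {P P' : α → Amb n} (hP : ∀ᶠ t in l, ‖P t‖ = 1) (hP' : ∀ᶠ t in l, ‖P' t‖ = 1)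
    (h : Tendsto (fun t => ‖P' t - P t‖) l (𝓝 0)) :
    Tendsto (fun t => conformalDist φ (P t) (P' t)) l (𝓝 0) := by
  obtain ⟨K, hK⟩ := (isCompact_sphere (0 : Amb n) 1).exists_bound_of_continuousOn hφ.1
  have hK' : ∀ P ∈ Metric.sphere (0 : Amb n) 1, φ P ≤ |K| := fun P hP =>
    (le_abs_self _).trans ((hK P hP).trans (le_abs_self K))
  have hlim : Tendsto (fun t => ENNReal.ofReal (|K| * (4 * ‖P' t - P t‖))) l (𝓝 0) := by
    have h1 : Tendsto (fun t => |K| * (4 * ‖P' t - P t‖)) l (𝓝 (|K| * (4 * 0))) :=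
      (h.const_mul 4).const_mul |K|
    rw [mul_zero, mul_zero] at h1
    simpa using ENNReal.tendsto_ofReal h1
  refine tendsto_of_tendsto_of_tendsto_of_le_of_le' tendsto_const_nhds hlim
    (Eventually.of_forall fun _ => zero_le) ?_
  filter_upwards [hP, hP', h.eventually_le_const (show (0 : ℝ) < 1 / 2 by norm_num)]
    with t h1 h2 h3
  exact conformalDist_le hK' (abs_nonneg K) h1 h2 h3

theorem pt_smul {r : ℝ} (hr : r ≠ 0) (x : Mink n) : pt (r • x) = pt x := by
  ext i
  simp only [pt, PiLp.smul_apply, smul_eq_mul]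
  rw [mul_div_mul_left _ _ hr]

/-- For null vectors the time component controls the Euclidean norm; this later turns lower bounds
on norms into lower bounds on denominators of `pt`. -/
theorem norm_sq_eq_of_null {x : Mink n} (h : mink x x = 0) : ‖x‖ ^ 2 = 2 * x 0 ^ 2 := by
  rw [EuclideanSpace.real_norm_sq_eq, Fin.sum_univ_succ]
  simp only [mink, ← sq] at h
  linarith

/-- The spatial part of a vector. -/
noncomputable def spatial (n : ℕ) : Mink n →L[ℝ] Amb n :=
  LinearMap.toContinuousLinearMap
    { toFun := fun x => WithLp.toLp 2 fun i => x i.succ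
      map_add' := fun _ _ => rfl
      map_smul' := fun _ _ => rfl }

theorem spatial_apply (x : Mink n) (i : Fin (n + 1)) : spatial n x i = x i.succ := rfl

theorem norm_spatial_le (x : Mink n) : ‖spatial n x‖ ≤ ‖x‖ := by
  refine (sq_le_sq₀ (norm_nonneg _) (norm_nonneg _)).1 ?_
  rw [EuclideanSpace.real_norm_sq_eq, EuclideanSpace.real_norm_sq_eq,
    Fin.sum_univ_succ fun i => x i ^ 2]
  simp only [spatial_apply]
  linarith [sq_nonneg (x 0)]

theorem mink_eq_spatial (x y : Mink n) :
    mink x y = -(x 0 * y 0) + inner ℝ (spatial n x) (spatial n y) := by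
  rw [mink, PiLp.inner_apply]
  simp [spatial_apply, mul_comm]

theorem pt_eq_spatial (x : Mink n) : pt x = (x 0)⁻¹ • spatial n x := by
  ext i
  simp [pt, spatial_apply, div_eq_inv_mul]

/-- The estimate is asymmetric on purpose: since `pt x` is a unit vector, only the time component of
y needs a lower bound. -/
theorem norm_pt_sub_le {x y : Mink n} (hx : x ≠ 0) (hxx : mink x x = 0) (hy : y ≠ 0)
    (hyy : mink y y = 0) : ‖pt x - pt y‖ ≤ 2 * ‖x - y‖ / |y 0| := by
  have hx0 := mink_zero_ne hx hxx
  have hy0 := mink_zero_ne hy hyy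
  have h1 : pt x - pt y = (y 0)⁻¹ • (spatial n (x - y) + (y 0 - x 0) • pt x) := by
    have hsx : spatial n x = x 0 • pt x := by rw [pt_eq_spatial, smul_inv_smul₀ hx0]
    have hsy : spatial n y = y 0 • pt y := by rw [pt_eq_spatial y, smul_inv_smul₀ hy0]
    have h2 : spatial n (x - y) + (y 0 - x 0) • pt x = y 0 • (pt x - pt y) := by
      rw [map_sub, hsx, hsy]
      module
    rw [h2, inv_smul_smul₀ hy0]
  have h0 : |y 0 - x 0| ≤ ‖x - y‖ := by
    rw [abs_sub_comm]
    exact PiLp.norm_apply_le (x - y) 0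
  rw [h1, norm_smul, norm_inv, Real.norm_eq_abs, div_eq_inv_mul]
  gcongr
  refine (norm_add_le _ _).trans ?_
  rw [norm_smul, norm_pt hx hxx, mul_one, Real.norm_eq_abs]
  linarith [norm_spatial_le (x - y)]

/-- The speed of a curve in the sphere, in terms of a light cone lift. -/
theorem norm_deriv_pt {x : ℝ → Mink n} {x' : Mink n} {t : ℝ} (hx : HasDerivAt x x' t)
    (h0 : ∀ᶠ u in 𝓝 t, x u ≠ 0 ∧ mink (x u) (x u) = 0) :
    ‖deriv (fun u => pt (x u)) t‖ = √(mink x' x') / |x t 0| := by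
  obtain ⟨hxne, hxx⟩ := h0.self_of_nhds
  have hne := mink_zero_ne hxne hxx
  have hortho : mink (x t) x' = 0 := by
    have h1 : mink x' (x t) + mink (x t) x' = 0 :=
      (hx.mink hx).unique ((hasDerivAt_const t (0 : ℝ)).congr_of_eventuallyEq
        (h0.mono fun u hu => hu.2))
    rw [mink_comm x'] at h1
    linarith
  have hx0 : HasDerivAt (fun u => x u 0) (x' 0) t :=
    (EuclideanSpace.proj (𝕜 := ℝ) (0 : Fin (n + 2))).hasFDerivAt.comp_hasDerivAt t hx
  have hxs : HasDerivAt (fun u => spatial n (x u)) (spatial n x') t :=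
    (spatial n).hasFDerivAt.comp_hasDerivAt t hx
  have hd : HasDerivAt (fun u => pt (x u)) ((x t 0)⁻¹ • spatial n x' +
      (-x' 0 / x t 0 ^ 2) • spatial n (x t)) t := by
    simp only [pt_eq_spatial]
    exact (hx0.inv hne).smul hxs
  rw [hd.deriv, ← Real.sqrt_sq (norm_nonneg _), ← Real.sqrt_sq (abs_nonneg (x t 0)), sq_abs,
    ← Real.sqrt_div' _ (sq_nonneg _)]
  congr 1
  rw [norm_add_sq_real, norm_smul, norm_smul, inner_smul_left, inner_smul_right, mul_pow, mul_pow,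
    ← real_inner_self_eq_norm_sq (spatial n x'), ← real_inner_self_eq_norm_sq (spatial n (x t)),
    real_inner_comm (spatial n (x t))]
  have e1 := mink_eq_spatial x' x'
  have e2 := mink_eq_spatial (x t) x'
  have e3 := mink_eq_spatial (x t) (x t)
  rw [hortho] at e2
  rw [hxx] at e3
  rw [show inner ℝ (spatial n x') (spatial n x') = mink x' x' + x' 0 * x' 0 by linarith,
    show inner ℝ (spatial n (x t)) (spatial n (x t)) = x t 0 * x t 0 by linarith]
  rw [show inner ℝ (spatial n (x t)) (spatial n x') = x t 0 * x' 0 by linarith]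
  simp only [Real.norm_eq_abs, sq_abs, conj_trivial]
  field_simp
  ring

end Sphere

/-! ### The motion on the limit circle -/

section Motion

variable {n : ℕ} {b p q : ℝ} {Q s : ℝ → ℝ}

namespace IsNormalParam

theorem zero_mem (hb : 0 < b) {δ : ℝ} (hδ : δ > 0) : (0 : ℝ) ∈ Ioo (-δ) b := ⟨by linarith, hb⟩

theorem hasDerivAt_zero (h : IsNormalParam b Q q s) (hb : 0 < b) :
    HasDerivAt s (deriv s 0) 0 := by
  obtain ⟨⟨δ, hδ, hs, -⟩, -⟩ := h
  exact hs.hasDerivAt_of_isOpen isOpen_Ioo (zero_mem hb hδ)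

theorem hasDerivAt (h : IsNormalParam b Q q s) {t : ℝ} (ht : t ∈ Ioo 0 b) :
    HasDerivAt s (deriv s t) t := by
  obtain ⟨⟨δ, hδ, hs, -⟩, -⟩ := h
  exact hs.hasDerivAt_of_isOpen isOpen_Ioo ⟨by linarith [ht.1], ht.2⟩

theorem pos (h : IsNormalParam b Q q s) {t : ℝ} (ht : t ∈ Ioo 0 b) : 0 < s t := by
  obtain ⟨⟨δ, hδ, hs, hpos⟩, h0, -⟩ := h
  have hmono : StrictMonoOn s (Ioo (-δ) b) :=
    strictMonoOn_of_deriv_pos (convex_Ioo _ _) hs.continuousOn (by simpa using hpos)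
  rw [← h0]
  exact hmono (zero_mem (ht.1.trans ht.2) hδ) ⟨by linarith [ht.1], ht.2⟩ ht.1

theorem tendsto_zero (h : IsNormalParam b Q q s) (hb : 0 < b) : Tendsto s (𝓝[>] 0) (𝓝 0) := by
  have h1 := (h.hasDerivAt_zero hb).continuousAt.tendsto
  rw [h.2.1] at h1
  exact h1.mono_left nhdsWithin_le_nhds

/-- The logarithmic derivative of a normal parameter has a pole at `0`. -/
theorem tendsto_deriv_div (h : IsNormalParam b Q q s) (hb : 0 < b) :
    Tendsto (fun t => deriv s t / s t) (𝓝[>] 0) atTop := by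
  have h1 : Tendsto (fun t => (s t)⁻¹) (𝓝[>] 0) atTop := by
    refine tendsto_inv_nhdsGT_zero.comp (tendsto_nhdsWithin_iff.2 ⟨h.tendsto_zero hb, ?_⟩)
    filter_upwards [Ioo_mem_nhdsGT hb] with t ht
    exact h.pos ht
  obtain ⟨⟨δ, hδ, hs, hpos⟩, -⟩ := h
  have h2 : Tendsto (deriv s) (𝓝[>] 0) (𝓝 (deriv s 0)) :=
    ((hs.deriv_infty isOpen_Ioo).continuousOn.continuousAt
      (isOpen_Ioo.mem_nhds (zero_mem hb hδ))).tendsto.mono_left nhdsWithin_le_nhds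
  simpa only [div_eq_mul_inv] using h2.pos_mul_atTop (hpos 0 (zero_mem hb hδ)) h1

end IsNormalParam

/-- The parameter `log (s / s(p))` in which the pure pole form is constant. -/
noncomputable def logParam (s : ℝ → ℝ) (p t : ℝ) : ℝ := Real.log (s t / s p)

theorem logParam_self (h : IsNormalParam b Q q s) (hp : p ∈ Ioo 0 b) : logParam s p p = 0 := by
  rw [logParam, div_self (h.pos hp).ne', Real.log_one]

theorem logParam_swap (s : ℝ → ℝ) (p t : ℝ) : logParam s t p = -logParam s p t := by
  rw [logParam, logParam, ← Real.log_inv, inv_div]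

theorem hasDerivAt_logParam (h : IsNormalParam b Q q s) (hp : p ∈ Ioo 0 b) {t : ℝ}
    (ht : t ∈ Ioo 0 b) : HasDerivAt (logParam s p) (deriv s t / s t) t := by
  have hst := (h.pos ht).ne'
  have hsp := (h.pos hp).ne'
  refine (((h.hasDerivAt ht).div_const (s p)).log (div_ne_zero hst hsp)).congr_deriv ?_
  field_simp

/-- Near `0`, the logarithmic parameter takes all values close to `-∞`. -/
theorem exists_logParam_eq (h : IsNormalParam b Q q s) (hp : p ∈ Ioo 0 b) {δ : ℝ}
    (hδ : δ ∈ Ioc 0 b) : ∃ w₀, ∀ w ≤ w₀, ∃ t ∈ Ioo 0 δ, logParam s p t = w := by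
  have hb : 0 < b := hp.1.trans hp.2
  have hδ2 : δ / 2 ∈ Ioo 0 b := ⟨by linarith [hδ.1], by linarith [hδ.1, hδ.2]⟩
  have hsp := h.pos hp
  refine ⟨logParam s p (δ / 2), fun w hw => ?_⟩
  have hcont : ContinuousOn s (Icc 0 (δ / 2)) := fun t ht => by
    rcases ht.1.eq_or_lt with h0 | h0
    · rw [← h0]
      exact (h.hasDerivAt_zero hb).continuousAt.continuousWithinAt
    · exact (h.hasDerivAt ⟨h0, ht.2.trans_lt hδ2.2⟩).continuousAt.continuousWithinAt
  have hle : s p * Real.exp w ≤ s (δ / 2) := by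
    have h1 := Real.exp_le_exp.2 hw
    rw [logParam, Real.exp_log (div_pos (h.pos hδ2) hsp), le_div_iff₀ hsp] at h1
    linarith
  have hpos : 0 < s p * Real.exp w := mul_pos hsp (Real.exp_pos w)
  obtain ⟨t, ht, hst⟩ := intermediate_value_Icc hδ2.1.le hcont
    (⟨by rw [h.2.1]; exact hpos.le, hle⟩ : s p * Real.exp w ∈ Icc (s 0) (s (δ / 2)))
  refine ⟨t, ⟨ht.1.lt_of_ne fun h0 => ?_, by linarith [ht.2, hδ.1]⟩, ?_⟩
  · rw [← h0, h.2.1] at hst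
    exact hpos.ne hst
  · rw [logParam, hst, mul_div_cancel_left₀ _ hsp.ne', Real.log_exp]

variable (e : PseudoBasis n) {μ : ℝ}

/-- The pole form is the constant generator times d log s, so its primitive is the one-parameter
group evaluated at log (s / s(p)). -/
theorem isPrimitive_poleForm (h : IsNormalParam b Q q s) (hp : p ∈ Ioo 0 b)
    (hμ : 1 - 2 * μ < 0) :
    IsPrimitive b (poleForm s e μ) p fun t => poleRot e μ (logParam s p t) := by
  refine ⟨by simp only [logParam_self h hp, poleRot_zero], fun t ht => ?_⟩
  refine ((hasDerivAt_poleRot e hμ _).scomp t (hasDerivAt_logParam h hp ht)).congr_deriv ?_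
  rw [poleForm_eq, mul_smul_endM]

theorem continuousOn_deriv_div (h : IsNormalParam b Q q s) :
    ContinuousOn (fun t => deriv s t / s t) (Ioo 0 b) := by
  refine ContinuousOn.div ?_ (fun t ht => (h.hasDerivAt ht).continuousAt.continuousWithinAt)
    fun t ht => (h.pos ht).ne'
  obtain ⟨⟨δ, hδ, hs, -⟩, -⟩ := h
  exact (hs.deriv_infty isOpen_Ioo).continuousOn.mono fun t ht => ⟨by linarith [ht.1], ht.2⟩

theorem continuousOn_poleForm (h : IsNormalParam b Q q s) :
    ContinuousOn (poleForm s e μ) (Ioo 0 b) := by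
  have h1 : poleForm s e μ = fun t => (deriv s t / s t) • poleGen e μ :=
    funext fun t => poleForm_eq e μ s t
  rw [h1]
  exact (continuousOn_deriv_div h).smul continuousOn_const

theorem gam_poleForm (h : IsNormalParam b Q q s) (hp : p ∈ Ioo 0 b) (hμ : 1 - 2 * μ < 0) {t : ℝ}
    (ht : t ∈ Ioo 0 b) : Gam b (poleForm s e μ) p t = poleRot e μ (logParam s p t) :=
  (gam_spec (continuousOn_poleForm e h) hp).eqOn (continuousOn_poleForm e h) hp
    (isPrimitive_poleForm e h hp hμ) ht

/-- The limit circle is the orbit of a rotation. -/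
theorem sphereOf_eq_range (hμ : 1 - 2 * μ < 0) {A : EndM n} (hA : IsLorentz A) :
    sphereOf ((Submodule.span ℝ {e.o, e.ι, e.τ}).map A.toLinearMap) =
      range fun u => pt (A (poleRot e μ u e.o)) := by
  ext P
  constructor
  · rintro ⟨x, ⟨z, hz, rfl⟩, hx, hxx, rfl⟩
    have hz0 : z ≠ 0 := fun h0 => hx (by rw [h0, map_zero])
    have hzz : mink z z = 0 := by
      rw [← hA]
      exact hxx
    obtain ⟨u, r, hr, rfl⟩ := exists_smul_poleRot_o_eq e hμ hz hz0 hzz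
    refine ⟨u, ?_⟩
    change _ = pt (A (r • poleRot e μ u e.o))
    rw [map_smul, pt_smul hr]
  · rintro ⟨u, rfl⟩
    refine ⟨A (poleRot e μ u e.o), ⟨_, poleRot_o_mem e u, rfl⟩,
      hA.apply_ne_zero ((isLorentz_poleRot e hμ u).apply_ne_zero e.o_ne_zero), ?_, rfl⟩
    rw [hA, mink_poleRot_o e hμ]

/-- Rotating back by -u recovers o from x = A(rotated o), so ‖x‖ is bounded below, and |x₀| ≥ ‖x‖/2
because x is null. -/
theorem exists_time_bounds (hμ : 1 - 2 * μ < 0) {A : EndM n} (hA : IsLorentz A) :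
    ∃ m > 0, ∃ M > 0, ∀ u, m ≤ |A (poleRot e μ u e.o) 0| ∧ |A (poleRot e μ u e.o) 0| ≤ M := by
  obtain ⟨K, hK⟩ := exists_norm_poleRot_le e (μ := μ)
  have hK0 : 0 ≤ K := (norm_nonneg _).trans (hK 0)
  have ho : 0 < ‖e.o‖ := norm_pos_iff.2 e.o_ne_zero
  -- The added 1's only keep the denominator and the upper bound positive.
  refine ⟨‖e.o‖ / (2 * (K * ‖madj A‖ + 1)), by positivity, ‖A‖ * (K * ‖e.o‖) + 1, by positivity,
    fun u => ⟨?_, ?_⟩⟩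
  · set x := A (poleRot e μ u e.o) with hx
    have hback : e.o = poleRot e μ (-u) (madj A x) := by
      have h1 : madj A x = poleRot e μ u e.o := by
        rw [hx, ← mul_apply_eq_comp, hA.madj_mul_self]
        rfl
      rw [h1, ← mul_apply_eq_comp, poleRot_neg_mul e hμ]
      rfl
    have hnorm : ‖e.o‖ ≤ K * ‖madj A‖ * ‖x‖ := by
      calc ‖e.o‖ = ‖poleRot e μ (-u) (madj A x)‖ := by rw [← hback]
        _ ≤ ‖poleRot e μ (-u)‖ * ‖madj A x‖ := ContinuousLinearMap.le_opNorm _ _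
        _ ≤ K * (‖madj A‖ * ‖x‖) := by
          gcongr
          · exact hK _
          · exact ContinuousLinearMap.le_opNorm _ _
        _ = _ := by ring
    have hxx : mink x x = 0 := by rw [hx, hA, mink_poleRot_o e hμ]
    have hx2 : ‖x‖ ≤ 2 * |x 0| := by
      have h2 := norm_sq_eq_of_null hxx
      refine abs_le_of_sq_le_sq' ?_ (by positivity) |>.2
      rw [h2, mul_pow, sq_abs]
      nlinarith [sq_nonneg (x 0)]
    rw [div_le_iff₀ (by positivity)]
    have h3 : K * ‖madj A‖ * ‖x‖ ≤ K * ‖madj A‖ * (2 * |x 0|) := by gcongr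
    nlinarith [abs_nonneg (x 0)]
  · have h1 : |A (poleRot e μ u e.o) 0| ≤ ‖A (poleRot e μ u e.o)‖ :=
      PiLp.norm_apply_le (A (poleRot e μ u e.o)) 0
    have h2 : ‖A (poleRot e μ u e.o)‖ ≤ ‖A‖ * (K * ‖e.o‖) := by
      refine (ContinuousLinearMap.le_opNorm _ _).trans ?_
      gcongr
      refine (ContinuousLinearMap.le_opNorm _ _).trans ?_
      gcongr
      exact hK u
    linarith

/-- Subtracting enough periods moves any angle into the range near -∞ that the logarithmic parameter
attains on (0, δ). -/
theorem image_motion_eq (h : IsNormalParam b Q q s) (hp : p ∈ Ioo 0 b) (hμ : 1 - 2 * μ < 0)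
    (A : EndM n) {δ : ℝ} (hδ : δ ∈ Ioc 0 b) :
    (fun t => pt (A (poleRot e μ (logParam s p t) e.o))) '' Ioo 0 δ =
      range fun u => pt (A (poleRot e μ u e.o)) := by
  refine Subset.antisymm (fun P ⟨t, _, hP⟩ => ⟨logParam s p t, hP⟩) ?_
  rintro P ⟨u, rfl⟩
  obtain ⟨w₀, hw₀⟩ := exists_logParam_eq h hp hδ
  have hper : 0 < 2 * Real.pi / poleFreq μ := div_pos Real.two_pi_pos (poleFreq_pos hμ)
  obtain ⟨N, hN⟩ := exists_nat_ge ((u - w₀) / (2 * Real.pi / poleFreq μ))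
  rw [div_le_iff₀ hper] at hN
  obtain ⟨t, ht, htu⟩ := hw₀ (u - N * (2 * Real.pi / poleFreq μ)) (by linarith)
  exact ⟨t, ht, by simp only [htu, poleRot_sub_period e hμ]⟩

theorem isClosed_orbit (hμ : 1 - 2 * μ < 0) {A : EndM n} (hA : IsLorentz A) :
    IsClosed (range fun u => pt (A (poleRot e μ u e.o))) := by
  have hper : 0 < 2 * Real.pi / poleFreq μ := div_pos Real.two_pi_pos (poleFreq_pos hμ)
  have hperiodic : Function.Periodic (fun u => pt (A (poleRot e μ u e.o)))
      (2 * Real.pi / poleFreq μ) := fun u => by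
    have h1 := poleRot_sub_period e hμ (u + 2 * Real.pi / poleFreq μ) 1
    rw [Nat.cast_one, one_mul, add_sub_cancel_right] at h1
    simp only [h1]
  have hx : Continuous fun u => A (poleRot e μ u e.o) :=
    A.continuous.comp ((continuous_poleRot e hμ).clm_apply continuous_const)
  have hcont : Continuous fun u => pt (A (poleRot e μ u e.o)) := by
    simp only [pt_eq_spatial]
    have h0 : Continuous fun u => A (poleRot e μ u e.o) 0 :=
      (EuclideanSpace.proj (𝕜 := ℝ) (0 : Fin (n + 2))).continuous.comp hx
    refine (h0.inv₀ fun u => ?_).smul ((spatial n).continuous.comp hx)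
    exact mink_zero_ne (hA.apply_ne_zero ((isLorentz_poleRot e hμ u).apply_ne_zero e.o_ne_zero))
      (by rw [hA, mink_poleRot_o e hμ])
  rw [← hperiodic.image_Icc hper 0]
  exact (isCompact_Icc.image hcont).isClosed

/-- Nothing is assumed on u(t): the orbit is bounded and its time component is bounded away from
zero uniformly in the angle, so convergence of G in operator norm suffices. -/
theorem tendsto_norm_pt_sub (hμ : 1 - 2 * μ < 0) {α : Type*} {l : Filter α} {G : α → EndM n}
    {A : EndM n} (hA : IsLorentz A) (hG : ∀ᶠ t in l, IsLorentz (G t)) (hlim : Tendsto G l (𝓝 A))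
    (u : α → ℝ) :
    Tendsto (fun t => ‖pt (A (poleRot e μ (u t) e.o)) - pt (G t (poleRot e μ (u t) e.o))‖) l
      (𝓝 0) := by
  obtain ⟨m, hm, M, hM, hbound⟩ := exists_time_bounds e hμ hA
  obtain ⟨K, hK⟩ := exists_norm_poleRot_le e (μ := μ)
  have hK0 : 0 ≤ K := (norm_nonneg _).trans (hK 0)
  have h0 : Tendsto (fun t => 2 * (‖G t - A‖ * (K * ‖e.o‖)) / m) l (𝓝 0) := by
    have h1 := ((((tendsto_iff_norm_sub_tendsto_zero.1 hlim).mul_const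
      (K * ‖e.o‖)).const_mul 2).div_const m)
    simpa using h1
  refine squeeze_zero' (Eventually.of_forall fun _ => norm_nonneg _) ?_ h0
  filter_upwards [hG] with t ht
  have hy := (isLorentz_poleRot e hμ (u t)).apply_ne_zero e.o_ne_zero
  have hyy := mink_poleRot_o e hμ (u t)
  rw [norm_sub_rev]
  refine (norm_pt_sub_le (ht.apply_ne_zero hy) (by rw [ht, hyy]) (hA.apply_ne_zero hy)
    (by rw [hA, hyy])).trans ?_
  have h2 : ‖G t (poleRot e μ (u t) e.o) - A (poleRot e μ (u t) e.o)‖ ≤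
      ‖G t - A‖ * (K * ‖e.o‖) := by
    rw [← _root_.sub_apply]
    refine (ContinuousLinearMap.le_opNorm _ _).trans ?_
    gcongr
    refine (ContinuousLinearMap.le_opNorm _ _).trans ?_
    gcongr
    exact hK _
  gcongr
  exact (hbound (u t)).1

/-- The lift has derivative (s'/s) times an orthogonal image of the unit vector 𝔱 - o. Hence the
round speed is at least (s'/s)/M, and φ has a positive minimum on the compact sphere. -/
theorem tendsto_speed (h : IsNormalParam b Q q s) (hp : p ∈ Ioo 0 b) (hμ : 1 - 2 * μ < 0)
    {A : EndM n} (hA : IsLorentz A) {C : ℝ → Mink n}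
    (hC : ∀ t ∈ Ioo 0 b, C t = A (poleRot e μ (logParam s p t) e.o)) {φ : Amb n → ℝ}
    (hφ : IsConformalFactor φ) :
    Tendsto (fun t => φ (pt (C t)) * ‖deriv (fun u => pt (C u)) t‖) (𝓝[>] 0) atTop := by
  have hb : 0 < b := hp.1.trans hp.2
  obtain ⟨m, hm, M, hM, hbound⟩ := exists_time_bounds e hμ hA
  have hnull : ∀ t ∈ Ioo 0 b, C t ≠ 0 ∧ mink (C t) (C t) = 0 := fun t ht => by
    rw [hC t ht]
    exact ⟨hA.apply_ne_zero ((isLorentz_poleRot e hμ _).apply_ne_zero e.o_ne_zero), by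
      rw [hA, mink_poleRot_o e hμ]⟩
  have hsph : ∀ t ∈ Ioo 0 b, pt (C t) ∈ Metric.sphere (0 : Amb n) 1 := fun t ht => by
    simpa using norm_pt (hnull t ht).1 (hnull t ht).2
  obtain ⟨P, hP, hmin⟩ := (isCompact_sphere (0 : Amb n) 1).exists_isMinOn ⟨_, hsph p hp⟩ hφ.1
  have hφP := hφ.2 P hP
  have hspeed : ∀ t ∈ Ioo 0 b, deriv s t / s t / M ≤ ‖deriv (fun u => pt (C u)) t‖ :=
    fun t ht => by
      have hd : HasDerivAt C ((deriv s t / s t) •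
          A (poleRot e μ (logParam s p t) (e.τ - e.o))) t := by
        have h1 := ((hasDerivAt_poleRot e hμ _).scomp t (hasDerivAt_logParam h hp ht)).clm_apply
          (hasDerivAt_const t e.o)
        have h2 := A.hasFDerivAt.comp_hasDerivAt t h1
        refine (h2.congr_of_eventuallyEq ?_).congr_deriv ?_
        · filter_upwards [isOpen_Ioo.mem_nhds ht] with u hu
          exact hC u hu
        · simp only [map_zero, add_zero, _root_.smul_apply, mul_apply_eq_comp, poleGen_o, map_smul]
      rw [norm_deriv_pt hd (by
        filter_upwards [isOpen_Ioo.mem_nhds ht] with u hu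
        exact hnull u hu)]
      have h3 : mink (e.τ - e.o) (e.τ - e.o) = 1 := by
        simp only [mink_sub_left, mink_sub_right, e.o_o, e.τ_τ, e.o_τ, mink_comm e.τ e.o]
        ring
      rw [mink_smul_left, mink_smul_right, hA, isLorentz_poleRot e hμ, h3, mul_one, hC t ht]
      have h4 := hbound (logParam s p t)
      have h5 : deriv s t / s t ≤ √(deriv s t / s t * (deriv s t / s t)) := by
        rw [Real.sqrt_mul_self_eq_abs]
        exact le_abs_self _
      have h6 : 0 < |A (poleRot e μ (logParam s p t) e.o) 0| := hm.trans_le h4.1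
      calc deriv s t / s t / M ≤ √(deriv s t / s t * (deriv s t / s t)) / M := by gcongr
        _ ≤ _ := by
          gcongr
          exact h4.2
  have hlim : Tendsto (fun t => φ P * (deriv s t / s t / M)) (𝓝[>] 0) atTop :=
    ((h.tendsto_deriv_div hb).atTop_div_const hM).const_mul_atTop hφP
  refine tendsto_atTop_mono' _ ?_ hlim
  filter_upwards [Ioo_mem_nhdsGT hb, (h.tendsto_deriv_div hb).eventually_ge_atTop 0] with t ht ht0
  exact mul_le_mul (hmin (hsph t ht)) (hspeed t ht) (by positivity) (hφ.2 _ (hsph t ht)).le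

/-- A curve which tends towards a motion traversing the closed set `S` infinitely often has exactly
the points of `S` as accumulation points. -/
theorem mapClusterPt_eq_of_motion {E : Type*} [NormedAddCommGroup E] {S : Set E} {x y : ℝ → E}
    (hb : 0 < b) (hS : IsClosed S) (hy : ∀ δ ∈ Ioc 0 b, y '' Ioo 0 δ = S)
    (hxy : Tendsto (fun t => ‖y t - x t‖) (𝓝[>] 0) (𝓝 0)) :
    {P | MapClusterPt P (𝓝[>] 0) x} = S := by
  ext P
  simp only [mem_ofPred_eq, mapClusterPt_iff_frequently]
  constructor
  · intro hP
    rw [← hS.closure_eq, Metric.mem_closure_iff]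
    intro ε hε
    have h1 := hP _ (Metric.ball_mem_nhds P (half_pos hε))
    obtain ⟨t, ht1, ht2, ht3⟩ := (h1.and_eventually
      ((hxy.eventually_lt_const (half_pos hε)).and (Ioo_mem_nhdsGT hb))).exists
    refine ⟨y t, ?_, ?_⟩
    · rw [← hy b ⟨hb, le_rfl⟩]
      exact ⟨t, ht3, rfl⟩
    · rw [Metric.mem_ball, dist_comm] at ht1
      rw [← dist_eq_norm, dist_comm] at ht2
      linarith [dist_triangle P (x t) (y t)]
  · intro hP U hU
    obtain ⟨ε, hε, hball⟩ := Metric.mem_nhds_iff.1 hU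
    have hfreq : ∃ᶠ t in 𝓝[>] (0 : ℝ), y t = P := by
      rw [(nhdsGT_basis (0 : ℝ)).frequently_iff]
      intro δ hδ
      rw [← hy (min δ b) ⟨lt_min hδ hb, min_le_right _ _⟩] at hP
      obtain ⟨t, ht, hyt⟩ := hP
      exact ⟨t, ⟨ht.1, ht.2.trans_le (min_le_left _ _)⟩, hyt⟩
    refine (hfreq.and_eventually (hxy.eventually_lt_const hε)).mono fun t ht => hball ?_
    rw [Metric.mem_ball, dist_comm, dist_eq_norm, ← ht.1]
    exact ht.2

/-- Two distinct points of the circle are enough to exclude a limit. -/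
theorem pt_o_ne_pt_ι {A : EndM n} (hA : IsLorentz A) : pt (A e.o) ≠ pt (A e.ι) := fun h => by
  obtain ⟨r, -, hr⟩ := (pt_eq_pt_iff (hA.apply_ne_zero e.o_ne_zero) (by rw [hA, e.o_o])
    (hA.apply_ne_zero e.ι_ne_zero) (by rw [hA, e.ι_ι])).1 h
  have h1 : mink (A e.o) (A e.ι) = -1 := by rw [hA, e.o_ι]
  rw [hr, mink_smul_right, hA, e.o_o, mul_zero] at h1
  norm_num at h1

theorem pt_mem_sphereOf {A : EndM n} (hA : IsLorentz A) {x : Mink n}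
    (hx : x ∈ ({e.o, e.ι, e.τ} : Set (Mink n))) (hx0 : x ≠ 0) (hxx : mink x x = 0) :
    pt (A x) ∈ sphereOf ((Submodule.span ℝ {e.o, e.ι, e.τ}).map A.toLinearMap) :=
  ⟨A x, ⟨x, Submodule.subset_span hx, rfl⟩, hA.apply_ne_zero hx0, by rw [hA, hxx], rfl⟩

end Motion

/-! ### The limit of the regularized primitive -/

section Limit

variable {n : ℕ} {b p q : ℝ} {Q s : ℝ → ℝ} {c : ℝ → Mink n} {I : Set ℝ} {e : PseudoBasis n}
  {F : ℝ → EndM n}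

/-- That the common domain of c and s contains 0 in its interior keeps df̄/dt bounded at the pole.
-/
theorem IsNormalParam.exists_isParamCurve {ε : ℝ} (hb : 0 < b) (hε : 0 < ε)
    (hc : IsRegularLift c (Ioo (-ε) b)) (h : IsNormalParam b Q q s) :
    ∃ I, IsParamCurve c s I ∧ Ioo 0 b ⊆ I ∧ (0 : ℝ) ∈ I := by
  obtain ⟨⟨δ, hδ, hs, hpos⟩, -⟩ := h
  have h1 : Ioo (-min ε δ) b ⊆ Ioo (-ε) b :=
    Ioo_subset_Ioo_left (neg_le_neg (min_le_left _ _))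
  have h2 : Ioo (-min ε δ) b ⊆ Ioo (-δ) b :=
    Ioo_subset_Ioo_left (neg_le_neg (min_le_right _ _))
  have hm : -min ε δ < 0 := neg_neg_of_pos (lt_min hε hδ)
  exact ⟨Ioo (-min ε δ) b, ⟨isOpen_Ioo, ⟨hc.1.mono h1, fun t ht => hc.2 t (h1 ht)⟩, hs.mono h2,
    fun t ht => hpos t (h2 ht)⟩, Ioo_subset_Ioo_left hm.le, hm, hb⟩

theorem continuousOn_regularPart (h : IsParamCurve c s I) (hI : Ioo 0 b ⊆ I)
    (hF : IsCurveFrame b c s e F) : ContinuousOn (regularPart c s F) (Ioo 0 b) := by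
  have h1 : ContinuousOn (fun t => madj (F t)) (Ioo 0 b) := fun t ht =>
    (hF.1.hasDerivAt_of_isOpen isOpen_Ioo ht).madj.continuousAt.continuousWithinAt
  exact h1.clm_apply (h.contDiffOn_deriv_flatDual.continuousOn.mono hI)

/-- The regular part of the gauge transform stays bounded at the pole. -/
theorem norm_regularPart_le (hn : 1 ≤ n) (h : IsParamCurve c s I) (hI : Ioo 0 b ⊆ I)
    (hF : IsCurveFrame b c s e F) {t : ℝ} (ht : t ∈ Ioo 0 b) : ‖regularPart c s F t‖ ≤
      √(mink (deriv (flatDual c s) t) (deriv (flatDual c s) t)) * (‖e.τ‖ + ∑ i, ‖e.ν i‖) := by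
  obtain ⟨hL, ho, -⟩ := hF.2 t ht
  have hFv : F t (regularPart c s F t) = deriv (flatDual c s) t := by
    rw [regularPart, ← mul_apply_eq_comp, hL.mul_madj_self]
    rfl
  have hvo : mink e.o (regularPart c s F t) = 0 := by
    rw [← hL, hFv, ho, h.mink_flatLift_deriv_flatDual (hI ht)]
  have hvι : mink e.ι (regularPart c s F t) = 0 := by
    rw [← hL, hFv, hF.apply_ι hn h hI ht, h.mink_flatDual_deriv_flatDual (hI ht)]
  -- Orthogonality of F transfers the Minkowski length of f̄' to v, so no bound on F is needed.
  rw [← hFv, hL]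
  exact e.norm_le_of_orthogonal hn hvo hvι

theorem madj_poleRot {μ : ℝ} (e : PseudoBasis n) (hμ : 1 - 2 * μ < 0) (u : ℝ) :
    madj (poleRot e μ u) = poleRot e μ (-u) := by
  have h := (isLorentz_poleRot e hμ u).mul_madj_self
  calc madj (poleRot e μ u) = poleRot e μ (-u) * poleRot e μ u * madj (poleRot e μ u) := by
        rw [poleRot_neg_mul e hμ, one_mul]
    _ = poleRot e μ (-u) := by rw [mul_assoc, h, mul_one]

/-- The regularized form `-s Γ (o ∧ v) Γ⁻¹`, where `Γ` is the primitive of the pure pole form. -/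
noncomputable def regularForm (c : ℝ → Mink n) (s : ℝ → ℝ) (e : PseudoBasis n) (F : ℝ → EndM n)
    (μ p t : ℝ) : EndM n :=
  (-s t) • (poleRot e μ (logParam s p t) * wedge e.o (regularPart c s F t) *
    poleRot e μ (-logParam s p t))

variable {μ : ℝ}

theorem isSkew_regularForm (hμ : 1 - 2 * μ < 0) (t : ℝ) :
    IsSkew (regularForm c s e F μ p t) := by
  rw [regularForm, ← madj_poleRot e hμ]
  exact ((isSkew_wedge _ _).conj _).smul _

theorem continuousOn_logParam (hs : IsNormalParam b Q q s) (hp : p ∈ Ioo 0 b) :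
    ContinuousOn (logParam s p) (Ioo 0 b) := fun _ ht =>
  (hasDerivAt_logParam hs hp ht).continuousAt.continuousWithinAt

theorem continuousOn_wedge_regularPart (h : IsParamCurve c s I) (hI : Ioo 0 b ⊆ I)
    (hF : IsCurveFrame b c s e F) :
    ContinuousOn (fun t => wedge e.o (regularPart c s F t)) (Ioo 0 b) := by
  simp only [← wedgeL_apply]
  exact (wedgeL n e.o).continuous.comp_continuousOn (continuousOn_regularPart h hI hF)

theorem continuousOn_regularForm (hμ : 1 - 2 * μ < 0) (hs : IsNormalParam b Q q s)
    (hp : p ∈ Ioo 0 b) (h : IsParamCurve c s I) (hI : Ioo 0 b ⊆ I)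
    (hF : IsCurveFrame b c s e F) : ContinuousOn (regularForm c s e F μ p) (Ioo 0 b) := by
  have hu := continuousOn_logParam hs hp
  have hrot := continuous_poleRot e hμ
  have hsc : ContinuousOn s (Ioo 0 b) := fun t ht =>
    (hs.hasDerivAt ht).continuousAt.continuousWithinAt
  exact hsc.neg.smul (((hrot.comp_continuousOn hu).mul
    (continuousOn_wedge_regularPart h hI hF)).mul (hrot.comp_continuousOn hu.neg))

/-- The factor s tends to 0, while the rotations and the vector v stay bounded. -/
theorem tendsto_regularForm (hn : 1 ≤ n) (hs : IsNormalParam b Q q s)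
    (hb : 0 < b) (h : IsParamCurve c s I) (hI : Ioo 0 b ⊆ I) (h0 : (0 : ℝ) ∈ I)
    (hF : IsCurveFrame b c s e F) :
    Tendsto (regularForm c s e F μ p) (𝓝[>] 0) (𝓝 0) := by
  obtain ⟨K, hK⟩ := exists_norm_poleRot_le e (μ := μ)
  have hK0 : 0 ≤ K := (norm_nonneg _).trans (hK 0)
  set c₀ := ‖e.τ‖ + ∑ i, ‖e.ν i‖ with hc₀
  set D : ℝ → ℝ := fun t => √(mink (deriv (flatDual c s) t) (deriv (flatDual c s) t)) with hD
  have hDlim : Tendsto D (𝓝[>] 0) (𝓝 (D 0)) := by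
    have h1 : ContinuousAt (deriv (flatDual c s)) 0 :=
      h.contDiffOn_deriv_flatDual.continuousOn.continuousAt (h.isOpen.mem_nhds h0)
    exact ((h1.tendsto.mink h1.tendsto).sqrt).mono_left nhdsWithin_le_nhds
  have hlim : Tendsto (fun t => |s t| * (K * (‖wedgeL n e.o‖ * (D t * c₀)) * K)) (𝓝[>] 0)
      (𝓝 0) := by
    have h1 := (hs.tendsto_zero hb).abs.mul
      ((((hDlim.mul_const c₀).const_mul ‖wedgeL n e.o‖).const_mul K).mul_const K)
    simpa using h1
  refine squeeze_zero_norm' ?_ hlim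
  filter_upwards [Ioo_mem_nhdsGT hb] with t ht
  have hw : ‖wedge e.o (regularPart c s F t)‖ ≤ ‖wedgeL n e.o‖ * (D t * c₀) := by
    rw [← wedgeL_apply]
    refine (ContinuousLinearMap.le_opNorm _ _).trans ?_
    gcongr
    exact norm_regularPart_le hn h hI hF ht
  rw [regularForm, norm_smul, norm_neg, Real.norm_eq_abs]
  gcongr
  refine (norm_mul_le _ _).trans (mul_le_mul ((norm_mul_le _ _).trans
    (mul_le_mul (hK _) hw (norm_nonneg _) hK0)) (hK _) (norm_nonneg _) ?_)
  exact mul_nonneg hK0 ((norm_nonneg _).trans hw)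

/-- The gauge transform of `λω` by the singular frame is the pure pole form up to a regular
term. -/
theorem gauge_singFrame (hn : 1 ≤ n) (hs : IsNormalParam b Q q s)
    (h : IsParamCurve c s I) (hI : Ioo 0 b ⊆ I) (hF : IsCurveFrame b c s e F) (lam : ℝ) {t : ℝ}
    (ht : t ∈ Ioo 0 b) :
    IsLorentz (singFrame s e F t) ∧
    HasDerivAt (singFrame s e F) (deriv (singFrame s e F) t) t ∧
      (lam • assocForm c Q) t * singFrame s e F t + deriv (singFrame s e F) t =
        singFrame s e F t *
          (poleForm s e (q * lam) t - s t • wedge e.o (regularPart c s F t)) := by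
  obtain ⟨g', hg', hid⟩ := singFrame_gauge_identity lam hn h hI hF ht (hs.pos ht).ne'
    (hs.2.2 t ht)
  have hd := hg'.deriv
  subst hd
  exact ⟨(hF.2 t ht).1.mul (isLorentz_boost e (hs.pos ht).ne'), hg', hid⟩

/-- The rotations commute with their generator, so conjugation leaves the pole form unchanged and
its subtraction removes it entirely. -/
theorem gaugeBy_eq_regularForm (hn : 1 ≤ n) (hs : IsNormalParam b Q q s)
    (h : IsParamCurve c s I) (hI : Ioo 0 b ⊆ I) (hF : IsCurveFrame b c s e F) (lam : ℝ)
    (hμ : 1 - 2 * (q * lam) < 0) (hp : p ∈ Ioo 0 b) {t : ℝ} (ht : t ∈ Ioo 0 b) :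
    gaugeBy b (poleForm s e (q * lam)) p (gauge (singFrame s e F) (lam • assocForm c Q)) t =
      regularForm c s e F (q * lam) p t := by
  obtain ⟨hL, hd, hid⟩ := gauge_singFrame hn hs h hI hF lam ht
  rw [gaugeBy, gauge_eq hL hd hid, gam_poleForm e hs hp hμ ht, gam_poleForm e hs ht hμ hp,
    logParam_swap s p t, poleForm_eq, regularForm, mul_sub, sub_mul, mul_smul_endM, poleRot_commute,
    smul_mul_endM, mul_assoc (poleGen e (q * lam))]
  have hinv := poleRot_neg_mul e hμ (-logParam s p t)
  rw [neg_neg] at hinv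
  rw [hinv, mul_one, mul_smul_endM, smul_mul_endM, neg_smul_endM]
  abel

end Limit

end Calapso

/-! ### The theorem on the limit circle -/

open Calapso in
theorem theorem5p4 (n : ℕ) (hn : 1 ≤ n) (b ε : ℝ) (hb : 0 < b) (hε : 0 < ε)
    (c : ℝ → Mink n) (hc : IsRegularLift c (Ioo (-ε) b))
    (Q : ℝ → ℝ) (hQ : ∀ t ∈ Ioo 0 b, Q t ≠ 0) (q : ℝ) (hpole : HasPole 2 b Q q)
    (lam : ℝ) (hlam : 1 - 2 * (q * lam) < 0) (p : ℝ) (hp : p ∈ Ioo 0 b) (e : PseudoBasis n) :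
    (∃ s, IsNormalParam b Q q s) ∧
    ∀ s, IsNormalParam b Q q s →
      (∃ F, IsCurveFrame b c s e F) ∧
      ∀ F, IsCurveFrame b c s e F →
        let g := singFrame s e F
        let ξ := poleForm s e (q * lam)
        let Φ := gaugeBy b ξ p (gauge g (lam • assocForm c Q))
        ∃ Γ₀ : EndM n, Tendsto (Gam b Φ p) (𝓝[>] 0) (𝓝 Γ₀) ∧ IsLorentz Γ₀ ∧
          let C : ℝ → Mink n := fun t => g p (Γ₀ (Gam b ξ p t e.o))
          let circle : Set (Amb n) := sphereOf
            ((Submodule.span ℝ {e.o, e.ι, e.τ}).map (g p * Γ₀).toLinearMap)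
          -- the Calapso transform tends towards `⟨C⟩` for all representative metrics
          (∀ φ : Amb n → ℝ, IsConformalFactor φ →
            Tendsto (fun t => conformalDist φ (pt (calapso b c Q lam p t)) (pt (C t)))
              (𝓝[>] 0) (𝓝 0)) ∧
          -- `⟨C⟩` is a motion on the circle, which it traverses completely in every `(0, δ)`
          (∀ δ ∈ Ioc 0 b, (fun t => pt (C t)) '' Ioo 0 δ = circle) ∧
          -- the speed of `⟨C⟩` tends to infinity for all representative metrics
          (∀ φ : Amb n → ℝ, IsConformalFactor φ →
            Tendsto (fun t => φ (pt (C t)) * ‖deriv (fun u => pt (C u)) t‖) (𝓝[>] 0) atTop) ∧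
          -- the Calapso transform has no limit point, but the limit circle
          (¬ ∃ P, Tendsto (fun t => pt (calapso b c Q lam p t)) (𝓝[>] 0) (𝓝 P)) ∧
          {P | MapClusterPt P (𝓝[>] 0) (fun t => pt (calapso b c Q lam p t))} = circle := by
  refine ⟨exists_isNormalParam hb hQ hpole, fun s hs => ?_⟩
  obtain ⟨I, h, hI, h0I⟩ := hs.exists_isParamCurve hb hε hc
  refine ⟨exists_isCurveFrame hn h hI hp e, fun F hF => ?_⟩
  intro g ξ Φ
  have hΦ : EqOn Φ (regularForm c s e F (q * lam) p) (Ioo 0 b) := fun t ht =>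
    gaugeBy_eq_regularForm hn hs h hI hF lam hlam hp ht
  have hΦc : ContinuousOn Φ (Ioo 0 b) :=
    (continuousOn_regularForm hlam hs hp h hI hF).congr hΦ
  have hnear : ∀ᶠ t in 𝓝[>] (0 : ℝ), t ∈ Ioo 0 b := Ioo_mem_nhdsGT hb
  have hΦ0 : Tendsto Φ (𝓝[>] 0) (𝓝 0) :=
    (tendsto_regularForm hn hs hb h hI h0I hF).congr' (hnear.mono fun t ht => (hΦ ht).symm)
  have hG := gam_spec hΦc hp
  have hGL : ∀ t ∈ Ioo 0 b, IsLorentz (Gam b Φ p t) := fun t ht =>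
    hG.isLorentz hp (fun t ht => by rw [hΦ ht]; exact isSkew_regularForm hlam t) ht
  obtain ⟨Γ₀, hΓ₀⟩ := hG.exists_tendsto hp hΦc hΦ0
  have hΓ₀L : IsLorentz Γ₀ := isLorentz_of_tendsto hΓ₀ (hnear.mono hGL)
  refine ⟨Γ₀, hΓ₀, hΓ₀L, ?_⟩
  intro C circle
  have hgauge := fun t (ht : t ∈ Ioo 0 b) => gauge_singFrame hn hs h hI hF lam ht
  have hgL : ∀ t ∈ Ioo 0 b, IsLorentz (g t) := fun t ht => (hgauge t ht).1
  have hA : IsLorentz (g p * Γ₀) := (hgL p hp).mul hΓ₀L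
  have hC : ∀ t ∈ Ioo 0 b, C t = (g p * Γ₀) (poleRot e (q * lam) (logParam s p t) e.o) :=
    fun t ht => by
      change g p (Γ₀ (Gam b ξ p t e.o)) = _
      rw [gam_poleForm e hs hp hlam ht]
      rfl
  have hcircle : circle =
      range fun u => pt ((g p * Γ₀) (poleRot e (q * lam) u e.o)) := sphereOf_eq_range e hlam hA
  -- the Calapso transform in terms of the regularized primitive
  set Z : ℝ → EndM n := fun t => ξ t - s t • wedge e.o (regularPart c s F t) with hZ
  have hZc : ContinuousOn Z (Ioo 0 b) := (continuousOn_poleForm e hs).sub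
    (ContinuousOn.smul (fun t ht => (hs.hasDerivAt ht).continuousAt.continuousWithinAt)
      (continuousOn_wedge_regularPart h hI hF))
  have hΨc : ContinuousOn (lam • assocForm c Q) (Ioo 0 b) := by
    have hds : ContinuousOn (deriv s) (Ioo 0 b) := h.contDiffOn_deriv.continuousOn.mono hI
    -- Continuity of Q is read off from its normal form q s'²/s².
    have hQc : ContinuousOn Q (Ioo 0 b) := by
      refine ContinuousOn.congr (ContinuousOn.div (continuousOn_const.mul (hds.pow 2))
        (ContinuousOn.pow (fun t ht => (hs.hasDerivAt ht).continuousAt.continuousWithinAt) 2)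
        fun t ht => pow_ne_zero 2 (hs.pos ht).ne') hs.2.2
    refine ContinuousOn.const_smul (ContinuousOn.congr (ContinuousOn.smul (hQc.div hds
      fun t ht => (h.deriv_pos t (hI ht)).ne') ((h.contDiffOn_flatLift.wedge
        h.contDiffOn_flatTangent).continuousOn.mono hI)) fun t ht => h.assocForm_eq (hI ht) Q) lam
  -- Two primitives of Z with the same normalization at p: one built from Γ_p(λω), the other from
  -- Γ_p(Φ) and Γ_p(ξ). Their equality is the factorization of the Calapso transform.
  have hprim1 : IsPrimitive b Z p
      fun t => madj (g p) * Gam b (lam • assocForm c Q) p t * g t :=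
    (gam_spec hΨc hp).gauge hp hgL (fun t ht => (hgauge t ht).2.1)
      fun t ht => (hgauge t ht).2.2
  have hprim2 : IsPrimitive b Z p
      fun t => Gam b Φ p t * poleRot e (q * lam) (logParam s p t) := by
    refine hG.mul_of_commute (isPrimitive_poleForm e hs hp hlam)
      (E' := fun t => poleRot e (q * lam) (-logParam s p t)) (fun t _ => poleRot_neg_mul e hlam _)
      (fun t _ => ?_) fun t ht => ?_
    · rw [poleForm_eq, mul_smul_endM, smul_mul_endM, poleRot_commute]
    · change gaugeBy b ξ p _ t = _
      rw [gaugeBy, gauge_eq (hgL t ht) (hgauge t ht).2.1 (hgauge t ht).2.2,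
        gam_poleForm e hs hp hlam ht, gam_poleForm e hs ht hlam hp, logParam_swap s p t]
  have hcal : ∀ t ∈ Ioo 0 b, pt (calapso b c Q lam p t) =
      pt ((g p * Gam b Φ p t) (poleRot e (q * lam) (logParam s p t) e.o)) := fun t ht => by
    have hst := (hs.pos ht).ne'
    have hsc := (h.scale_pos (hI ht)).ne'
    -- Undoing the boost on o recovers f, a nonzero multiple of c; such factors are invisible to
    -- `pt`.
    have hgo : g t (s t • e.o) = flatLift c s t := by
      change (F t * boost e (s t)) (s t • e.o) = _
      rw [mul_apply_eq_comp, map_smul, boost_o, smul_inv_smul₀ hst, (hF.2 t ht).2.1]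
    have heq := hprim1.eqOn hZc hp hprim2 ht
    have heq' : Gam b (lam • assocForm c Q) p t * g t =
        g p * (Gam b Φ p t * poleRot e (q * lam) (logParam s p t)) := by
      rw [← heq, ← mul_assoc, ← mul_assoc, (hgL p hp).mul_madj_self, one_mul]
    have hfl : Gam b (lam • assocForm c Q) p t (flatLift c s t) =
        s t • (g p * Gam b Φ p t) (poleRot e (q * lam) (logParam s p t) e.o) := by
      rw [← hgo, ← mul_apply_eq_comp, heq', map_smul]
      rfl
    rw [← pt_smul hst ((g p * Gam b Φ p t) _), ← hfl, flatLift, map_smul, pt_smul hsc]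
    rfl
  have hGlim : Tendsto (fun t => g p * Gam b Φ p t) (𝓝[>] 0) (𝓝 (g p * Γ₀)) :=
    hΓ₀.const_mul (g p)
  have hGL' : ∀ t ∈ Ioo 0 b, IsLorentz (g p * Gam b Φ p t) := fun t ht =>
    (hgL p hp).mul (hGL t ht)
  have hnorm : Tendsto (fun t => ‖pt (C t) - pt (calapso b c Q lam p t)‖) (𝓝[>] 0) (𝓝 0) := by
    refine (tendsto_norm_pt_sub e hlam hA (hnear.mono hGL') hGlim (logParam s p)).congr' ?_
    filter_upwards [hnear] with t ht
    rw [hC t ht, hcal t ht]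
  have hunit : ∀ {A : EndM n}, IsLorentz A → ∀ u,
      ‖pt (A (poleRot e (q * lam) u e.o))‖ = 1 := fun {A} hA u =>
    norm_pt (hA.apply_ne_zero ((isLorentz_poleRot e hlam u).apply_ne_zero e.o_ne_zero))
      (by rw [hA, mink_poleRot_o e hlam])
  have himage : ∀ δ ∈ Ioc 0 b, (fun t => pt (C t)) '' Ioo 0 δ = circle := fun δ hδ => by
    rw [hcircle, ← image_motion_eq e hs hp hlam (g p * Γ₀) hδ]
    exact image_congr fun t ht => by rw [hC t ⟨ht.1, ht.2.trans_le hδ.2⟩]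
  have hcluster : {P | MapClusterPt P (𝓝[>] 0) (fun t => pt (calapso b c Q lam p t))} = circle :=
    mapClusterPt_eq_of_motion hb (by rw [hcircle]; exact isClosed_orbit e hlam hA) himage hnorm
  refine ⟨fun φ hφ => ?_, himage, fun φ hφ => tendsto_speed e hs hp hlam hA hC hφ, ?_, hcluster⟩
  · refine tendsto_conformalDist hφ ?_ ?_ hnorm
    · filter_upwards [hnear] with t ht
      rw [hcal t ht, hunit (hGL' t ht)]
    · filter_upwards [hnear] with t ht
      rw [hC t ht, hunit hA]
  · rintro ⟨P, hP⟩
    -- In a Hausdorff space a limit is the only accumulation point, whereas the circle contains the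
    -- distinct points ⟨Ao⟩ and ⟨Aι⟩.
    have huniq : ∀ P' ∈ circle, P' = P := fun P' hP' => by
      rw [← hcluster] at hP'
      have hne : (𝓝 P' ⊓ 𝓝 P).NeBot :=
        NeBot.mono (show (𝓝 P' ⊓ map _ (𝓝[>] (0 : ℝ))).NeBot from hP') (inf_le_inf_left _ hP)
      exact eq_of_nhds_neBot hne
    exact pt_o_ne_pt_ι e hA ((huniq _ (pt_mem_sphereOf e hA (by simp) e.o_ne_zero e.o_o)).trans
      (huniq _ (pt_mem_sphereOf e hA (by simp) e.ι_ne_zero e.ι_ι)).symm)
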